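/- **Theorem (QS2 security of hybrid encryption).** All algorithms are uniform families of circuits (classical or quantum) of size polynomial in the security parameter $\kappa$. Let $\Sigma^S=(\mathsf{KGen}^S,\mathsf{Enc}^S,\mathsf{Dec}^S)$ be an efficient SKE scheme that is perfectly correct ($\mathsf{Dec}^S_k(\mathsf{Enc}^S_k(m;r))=m$ for every key $k$ output by $\mathsf{KGen}^S$, every message $m$ and every randomness $r$), and let $\Sigma^P=(\mathsf{KGen}^P,\mathsf{Enc}^P,\mathsf{Dec}^P)$ be an efficient PKE scheme (no correctness is assumed) whose message space is the key space $\{0,1\}^{\ell(\kappa)}$ of $\Sigma^S$; messages, keys, randomness and ciphertexts are bit strings of lengths depending on $\kappa$. The hybrid scheme $\Sigma=(\mathsf{KGen},\mathsf{Enc},\mathsf{Dec})$ has $\mathsf{KGen}=\mathsf{KGen}^P$, $$\mathsf{Enc}_{pk}(m;(r_1,r_2,r_3))=\bigl(\mathsf{Enc}^S_k(m;r_2),\ \mathsf{Enc}^P_{pk}(k;r_3)\bigr),\quad k=\mathsf{KGen}^S(r_1),$$ and $\mathsf{Dec}_{sk}(c_1,c_2)=\mathsf{Dec}^S_{k}(c_1)$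 with $k=\mathsf{Dec}^P_{sk}(c_2)$. The *type-2 encryption oracle* $O^{(2)}_{\mathsf{Enc}}$ for a fixed key takes a quantum state $\phi$ on the message register, samples uniform classical randomness $r$, and returns the image of $\phi$ under the isometry $|m\rangle\mapsto|\mathsf{Enc}(m;r)\rangle$. Three games are considered; in each of them a uniformly random bit $b$ is to be guessed, and the advantage of a quantum polynomial-time two-stage adversary is $\mathrm{Adv}=|\Pr[\text{its guess equals } b]-\tfrac12|$. * *qIND-qCPA (PKE):* the adversary gets $pk$ and access to $O^{(2)}_{\mathsf{Enc}_{pk}}$ (before and after the challenge), outputs two message registers $\phi_0,\phi_1$ (possibly entangled with each other and with its memory), $\phi_{1-b}$ is traced out, and the adversary receives $O^{(2)}_{\mathsf{Enc}_{pk}}(\phi_b)$. * *IND-qCPA (PKE, QS1):* the adversary gets $pk$ and no oracle, outputs two classical messages $m_0,m_1$, and receives $\mathsf{Enc}_{pk}(m_b;r)$ for uniform $r$. * *qIND (SKE):* a key $k$ is generated; the adversary has no input and no oracle, outputs two message registers $\phi_0,\phi_1$ as above, $\phi_{1-b}$ is traced out, and the adversary receives $O^{(2)}_{\mathsf{Enc}^S_k}(\phi_b)$.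 Then for every quantum polynomial-time adversary $E$ against $\Sigma$ there are quantum polynomial-time adversaries $B$ against $\Sigma^P$ and $C$ against $\Sigma^S$ such that for all $\kappa$ $$\mathrm{Adv}^{\text{qIND-qCPA}}_{\Sigma}(E)\ \le\ 2\,\mathrm{Adv}^{\text{IND-qCPA}}_{\Sigma^P}(B)+\mathrm{Adv}^{\text{qIND}}_{\Sigma^S}(C).$$ (Here $2\,\mathrm{Adv}^{\text{IND-qCPA}}_{\Sigma^P}(B)$ is the distinguishing advantage $|\Pr[B\to1\mid b=1]-\Pr[B\to1\mid b=0]|$.) In particular, if $\Sigma^P$ is IND-qCPA secure and $\Sigma^S$ is qIND secure (all advantages of quantum polynomial-time adversaries are negligible), then $\Sigma$ is qIND-qCPA secure. -/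

import Mathlib

/-! ## Polynomial time and uniformity -/

/-- The polynomial-time computable functions on natural numbers in binary, as the least class
that contains the basic functions below and is closed under composition and bounded recursion on
notation (Cobham). Addition, truncated subtraction, multiplication and integer division are
polynomial-time computable; listing them among the basic functions does not enlarge the class. -/
inductive PolyTime : {n : ℕ} → ((Fin n → ℕ) → ℕ) → Prop
  | zero {n : ℕ} : PolyTime (fun _ : Fin n → ℕ => 0)
  | proj {n : ℕ} (i : Fin n) : PolyTime (fun v : Fin n → ℕ => v i)
  | even : PolyTime (fun v : Fin 1 → ℕ => 2 * v 0)
  | odd : PolyTime (fun v : Fin 1 → ℕ => 2 * v 0 + 1)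
  | smash : PolyTime (fun v : Fin 2 → ℕ => 2 ^ (Nat.size (v 0) * Nat.size (v 1)))
  | add : PolyTime (fun v : Fin 2 → ℕ => v 0 + v 1)
  | sub : PolyTime (fun v : Fin 2 → ℕ => v 0 - v 1)
  | mul : PolyTime (fun v : Fin 2 → ℕ => v 0 * v 1)
  | div : PolyTime (fun v : Fin 2 → ℕ => v 0 / v 1)
  | comp {m n : ℕ} {f : (Fin m → ℕ) → ℕ} {g : Fin m → (Fin n → ℕ) → ℕ}
      (hf : PolyTime f) (hg : ∀ i, PolyTime (g i)) : PolyTime (fun v => f (fun i => g i v))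
  | boundedRec {n : ℕ} {g : (Fin n → ℕ) → ℕ} {h₀ h₁ : (Fin (n + 2) → ℕ) → ℕ}
      {k f : (Fin (n + 1) → ℕ) → ℕ}
      (hg : PolyTime g) (hh₀ : PolyTime h₀) (hh₁ : PolyTime h₁) (hk : PolyTime k)
      (f_zero : ∀ v, f (Matrix.vecCons 0 v) = g v)
      (f_even : ∀ x v, x ≠ 0 → f (Matrix.vecCons (2 * x) v) =
        h₀ (Matrix.vecCons x (Matrix.vecCons (f (Matrix.vecCons x v)) v)))
      (f_odd : ∀ x v, f (Matrix.vecCons (2 * x + 1) v) =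
        h₁ (Matrix.vecCons x (Matrix.vecCons (f (Matrix.vecCons x v)) v)))
      (f_le : ∀ v, f v ≤ k v) : PolyTime f

/-- `ℓ` is polynomially bounded and `ℓ κ` is computable in time polynomial in `κ`. Here and below
the security parameter `κ` is given in unary, that is, as the number `2 ^ κ` of `κ + 1` binary
digits. -/
def UniformLength (ℓ : ℕ → ℕ) : Prop :=
  (∃ f : (Fin 1 → ℕ) → ℕ, PolyTime f ∧ ∀ κ, f ![2 ^ κ] = ℓ κ) ∧
    ∃ p : Polynomial ℕ, ∀ κ, ℓ κ ≤ p.eval κ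

/-- `d κ i` is computable in polynomial time from `κ` in unary and `i` in binary. -/
def UniformIndex (d : ℕ → ℕ → ℕ) : Prop :=
  ∃ f : (Fin 2 → ℕ) → ℕ, PolyTime f ∧ ∀ κ i, f ![2 ^ κ, i] = d κ i

/-! ## Bit strings and classical algorithms -/

/-- Bit strings of length `n`. -/
abbrev Bits (n : ℕ) := Fin n → Bool

/-- The first part of a concatenation. -/
def Bits.fst {m n : ℕ} (x : Bits (m + n)) : Bits m := fun i => x (Fin.castAdd n i)

/-- The second part of a concatenation. -/
def Bits.snd {m n : ℕ} (x : Bits (m + n)) : Bits n := fun i => x (Fin.natAdd m i)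

/-- Concatenation. -/
def Bits.pair {m n : ℕ} (x : Bits m) (y : Bits n) : Bits (m + n) := Fin.append x y

/-- A uniform family of Boolean circuits of polynomial size. The circuit for `κ` consists of
`size κ` NAND gates. With `m` input bits, wires `0, …, m - 1` are the inputs and wire `m + i` is
the output of gate `i`, whose inputs are the wires `left κ i` and `right κ i`; output bit `j` is
read from the wire `out κ j`. A wire that has not been assigned carries `false`. -/
structure BoolCircuits where
  size : ℕ → ℕ
  left : ℕ → ℕ → ℕ
  right : ℕ → ℕ → ℕ
  out : ℕ → ℕ → ℕ
  size_uniform : UniformLength size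
  left_uniform : UniformIndex left
  right_uniform : UniformIndex right
  out_uniform : UniformIndex out

/-- The values of the wires after the first gates (the last argument counts them). -/
def BoolCircuits.wires (C : BoolCircuits) (κ : ℕ) {m : ℕ} (x : Bits m) : ℕ → ℕ → Bool
  | 0 => fun w => if h : w < m then x ⟨w, h⟩ else false
  | i + 1 => Function.update (C.wires κ x i) (m + i)
      (!(C.wires κ x i (C.left κ i) && C.wires κ x i (C.right κ i)))

/-- The function computed by the circuit for `κ`. -/
def BoolCircuits.eval (C : BoolCircuits) (κ : ℕ) {m k : ℕ} (x : Bits m) : Bits k :=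
  fun j => C.wires κ x (C.size κ) (C.out κ j)

/-- The family of functions `f` is computed by a deterministic classical algorithm, that is, by a
uniform family of Boolean circuits of polynomial size. -/
def EfficientFun {m k : ℕ → ℕ} (f : ∀ κ, Bits (m κ) → Bits (k κ)) : Prop :=
  ∃ C : BoolCircuits, ∀ κ x, C.eval κ x = f κ x

/-! ## Quantum states and quantum circuits

The qubits are numbered by `ℕ`; all but finitely many of them are in the state `|0⟩` at the
beginning and are never touched. States are finitely supported. -/

/-- Computational basis states. -/
abbrev Mem := ℕ → Bool

/-- Vectors: finite linear combinations of basis states. -/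
abbrev Ket := Mem →₀ ℂ

/-- Operators: finite linear combinations of the `|x⟩⟨y|`, represented by the pairs `(x, y)`. -/
abbrev Dens := (Mem × Mem) →₀ ℂ

/-- The map `ρ ↦ K ρ K†`, where the operator `K` is given by the images of the basis states. -/
noncomputable def conjugate (K : Mem → Ket) : Dens →ₗ[ℂ] Dens :=
  Finsupp.linearCombination ℂ fun p =>
    (K p.1).sum fun x a => (K p.2).sum fun y b => Finsupp.single (x, y) (a * star b)

/-- The operator `|s⟩ ↦ |f s⟩`. -/
noncomputable def basisMap (f : Mem → Mem) : Mem → Ket := fun s => Finsupp.single (f s) 1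

/-- Elementary operations. The gates `h`, `t` and `cnot` are universal for quantum computation;
`measure a` measures qubit `a` in the computational basis, `reset a` discards qubit `a` and
replaces it by a new qubit in the state `|0⟩`, and `query` calls the oracle. -/
inductive Gate where
  | skip
  | x (a : ℕ)
  | cnot (a b : ℕ)
  | ccx (a b c : ℕ)
  | h (a : ℕ)
  | t (a : ℕ)
  | measure (a : ℕ)
  | reset (a : ℕ)
  | query

/-- The gate with a given operation code and operands. -/
def Gate.decode (op a b c : ℕ) : Gate :=
  match op with
  | 1 => .x a
  | 2 => .cnot a b
  | 3 => .ccx a b c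
  | 4 => .h a
  | 5 => .t a
  | 6 => .measure a
  | 7 => .reset a
  | 8 => .query
  | _ => .skip

/-- The action of a gate on states; `O` is the action of the oracle. A controlled gate whose
target is one of its controls does nothing. -/
noncomputable def Gate.channel (O : Dens →ₗ[ℂ] Dens) : Gate → Dens →ₗ[ℂ] Dens
  | .skip => LinearMap.id
  | .x a => conjugate (basisMap fun s => Function.update s a (!(s a)))
  | .cnot a b => conjugate (basisMap fun s =>
      if b = a then s else Function.update s b (xor (s b) (s a)))
  | .ccx a b c => conjugate (basisMap fun s =>
      if c = a ∨ c = b then s else Function.update s c (xor (s c) (s a && s b)))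
  | .h a => conjugate fun s =>
      Finsupp.single (Function.update s a false) (1 / (Real.sqrt 2 : ℂ)) +
        Finsupp.single (Function.update s a true)
          ((if s a = true then -1 else 1) / (Real.sqrt 2 : ℂ))
  | .t a => conjugate fun s =>
      Finsupp.single s (if s a = true then Complex.exp (Complex.I * Real.pi / 4) else 1)
  | .measure a => ∑ v : Bool, conjugate fun s =>
      if s a = v then Finsupp.single s 1 else 0
  | .reset a => ∑ v : Bool, conjugate fun s =>
      if s a = v then Finsupp.single (Function.update s a false) 1 else 0
  | .query => O

/-- A uniform family of quantum circuits of polynomial size: the circuit for `κ` consists of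
`size κ` gates. -/
structure QuantumCircuits where
  size : ℕ → ℕ
  op : ℕ → ℕ → ℕ
  arg₁ : ℕ → ℕ → ℕ
  arg₂ : ℕ → ℕ → ℕ
  arg₃ : ℕ → ℕ → ℕ
  size_uniform : UniformLength size
  op_uniform : UniformIndex op
  arg₁_uniform : UniformIndex arg₁
  arg₂_uniform : UniformIndex arg₂
  arg₃_uniform : UniformIndex arg₃

/-- The gates of the circuit for `κ`, in the order of their application. -/
def QuantumCircuits.gates (A : QuantumCircuits) (κ : ℕ) : List Gate :=
  (List.range (A.size κ)).map fun i =>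
    Gate.decode (A.op κ i) (A.arg₁ κ i) (A.arg₂ κ i) (A.arg₃ κ i)

/-- Running the circuit for `κ` on a state, with the oracle `O`. -/
noncomputable def QuantumCircuits.run (A : QuantumCircuits) (κ : ℕ) (O : Dens →ₗ[ℂ] Dens)
    (ρ : Dens) : Dens :=
  (A.gates κ).foldl (fun σ g => g.channel O σ) ρ

/-! ## Registers

The memory of an adversary has four tracks, each an infinite sequence of qubits: track 0 is work
space, tracks 1 and 2 hold what the adversary sends (the two challenge messages; the oracle query
and the final guess on track 1), track 3 holds what it receives (public key, ciphertexts). The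
adversary may use all of them freely. -/

/-- Qubit `i` of track `t`. -/
def wire (t : Fin 4) (i : ℕ) : ℕ := 4 * i + t

/-- The contents of the first `n` qubits of track `t`. -/
def readTrack (t : Fin 4) (n : ℕ) (s : Mem) : Bits n := fun i => s (wire t i)

/-- Replace the contents of the first `n` qubits of track `t`. -/
def writeTrack (t : Fin 4) {n : ℕ} (x : Bits n) (s : Mem) : Mem :=
  fun w => if h : w % 4 = t ∧ w / 4 < n then x ⟨w / 4, h.2⟩ else s w

/-- Trace out the first `n` qubits of track `t` and replace them by `|0…0⟩`. -/
noncomputable def discardTrack (t : Fin 4) (n : ℕ) : Dens →ₗ[ℂ] Dens :=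
  ∑ x : Bits n, conjugate fun s =>
    if readTrack t n s = x then Finsupp.single (writeTrack t (fun _ : Fin n => false) s) 1 else 0

/-- Measure the first `n` qubits of track `t` in the computational basis. -/
noncomputable def measureTrack (t : Fin 4) (n : ℕ) : Dens →ₗ[ℂ] Dens :=
  ∑ x : Bits n, conjugate fun s => if readTrack t n s = x then Finsupp.single s 1 else 0

/-- The probability that measuring the first qubit of track 1 yields `v`. -/
noncomputable def guessProb (v : Bool) (ρ : Dens) : ℝ :=
  open Classical in
  (ρ.sum fun p a => if p.1 = p.2 ∧ p.1 (wire 1 0) = v then a else 0).re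

/-- The expectation of `f r` for uniformly random `r`. -/
noncomputable def average {n : ℕ} (f : Bits n → ℝ) : ℝ := (∑ r, f r) / 2 ^ n

/-- The type-2 encryption oracle for a randomised encryption map `enc` (with fixed key), applied
to the message register on track `src`. For uniformly random classical `r` it performs
`|m⟩ ↦ |enc m r⟩`: the message register is consumed and the result is delivered on track 3,
whose previous contents are discarded. Every unitary `U` with `U |r, m, 0…0⟩ = |r, enc m r⟩`,
applied with ancillas in the state `|0…0⟩`, followed by tracing out the register of `r`, has this
action. -/
noncomputable def type2Oracle (src : Fin 4) {m r c : ℕ} (enc : Bits m → Bits r → Bits c) :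
    Dens →ₗ[ℂ] Dens :=
  ((1 : ℂ) / 2 ^ r) • ∑ z : Bits r,
    (conjugate (basisMap fun s =>
      writeTrack 3 (enc (readTrack src m s) z) (writeTrack src (fun _ : Fin m => false) s))) ∘ₗ
        discardTrack 3 c

/-- The track of challenge message `b`. -/
def msgTrack (b : Bool) : Fin 4 := if b then 2 else 1

/-- The quantum challenge: trace out message `1 - b`, then encrypt message `b` with the type-2
oracle. -/
noncomputable def quantumChallenge (b : Bool) {m r c : ℕ} (enc : Bits m → Bits r → Bits c) :
    Dens →ₗ[ℂ] Dens :=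
  type2Oracle (msgTrack b) enc ∘ₗ discardTrack (msgTrack !b) m

/-- The classical challenge: the two messages are measured (the adversary keeps the classical
messages), and an encryption of message `b` is delivered on track 3. -/
noncomputable def classicalChallenge (b : Bool) {m r c : ℕ} (enc : Bits m → Bits r → Bits c) :
    Dens →ₗ[ℂ] Dens :=
  ((1 : ℂ) / 2 ^ r) • ∑ z : Bits r,
    (conjugate (basisMap fun s => writeTrack 3 (enc (readTrack (msgTrack b) m s) z) s)) ∘ₗ
      discardTrack 3 c ∘ₗ measureTrack 2 m ∘ₗ measureTrack 1 m

/-- The initial state of an adversary with classical input `x`. -/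
noncomputable def initialState {n : ℕ} (x : Bits n) : Dens :=
  Finsupp.single (writeTrack 3 x (fun _ => false), writeTrack 3 x (fun _ => false)) 1

/-! ## Encryption schemes -/

/-- The algorithms of a public key encryption scheme for messages of length `msgLen κ`, as
functions of their inputs and of their randomness. -/
structure PKE (msgLen : ℕ → ℕ) where
  pkLen : ℕ → ℕ
  skLen : ℕ → ℕ
  ctxtLen : ℕ → ℕ
  kgenRand : ℕ → ℕ
  encRand : ℕ → ℕ
  kgen : ∀ κ, Bits (kgenRand κ) → Bits (pkLen κ) × Bits (skLen κ)
  enc : ∀ κ, Bits (pkLen κ) → Bits (msgLen κ) → Bits (encRand κ) → Bits (ctxtLen κ)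
  dec : ∀ κ, Bits (skLen κ) → Bits (ctxtLen κ) → Bits (msgLen κ)

/-- The algorithms of a symmetric key encryption scheme. -/
structure SKE where
  keyLen : ℕ → ℕ
  msgLen : ℕ → ℕ
  ctxtLen : ℕ → ℕ
  kgenRand : ℕ → ℕ
  encRand : ℕ → ℕ
  kgen : ∀ κ, Bits (kgenRand κ) → Bits (keyLen κ)
  enc : ∀ κ, Bits (keyLen κ) → Bits (msgLen κ) → Bits (encRand κ) → Bits (ctxtLen κ)
  dec : ∀ κ, Bits (keyLen κ) → Bits (ctxtLen κ) → Bits (msgLen κ)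

/-- All algorithms of the scheme are uniform families of circuits of polynomial size. -/
structure PKE.Efficient {msgLen : ℕ → ℕ} (P : PKE msgLen) : Prop where
  msgLen_uniform : UniformLength msgLen
  pkLen_uniform : UniformLength P.pkLen
  skLen_uniform : UniformLength P.skLen
  ctxtLen_uniform : UniformLength P.ctxtLen
  kgenRand_uniform : UniformLength P.kgenRand
  encRand_uniform : UniformLength P.encRand
  kgen_efficient : EfficientFun (m := P.kgenRand) (k := fun κ => P.pkLen κ + P.skLen κ)
    fun κ r => Bits.pair (P.kgen κ r).1 (P.kgen κ r).2
  enc_efficient : EfficientFun (m := fun κ => P.pkLen κ + (msgLen κ + P.encRand κ))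
    (k := P.ctxtLen) fun κ x => P.enc κ x.fst x.snd.fst x.snd.snd
  dec_efficient : EfficientFun (m := fun κ => P.skLen κ + P.ctxtLen κ) (k := msgLen)
    fun κ x => P.dec κ x.fst x.snd

/-- All algorithms of the scheme are uniform families of circuits of polynomial size. -/
structure SKE.Efficient (S : SKE) : Prop where
  keyLen_uniform : UniformLength S.keyLen
  msgLen_uniform : UniformLength S.msgLen
  ctxtLen_uniform : UniformLength S.ctxtLen
  kgenRand_uniform : UniformLength S.kgenRand
  encRand_uniform : UniformLength S.encRand
  kgen_efficient : EfficientFun (m := S.kgenRand) (k := S.keyLen) S.kgen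
  enc_efficient : EfficientFun (m := fun κ => S.keyLen κ + (S.msgLen κ + S.encRand κ))
    (k := S.ctxtLen) fun κ x => S.enc κ x.fst x.snd.fst x.snd.snd
  dec_efficient : EfficientFun (m := fun κ => S.keyLen κ + S.ctxtLen κ) (k := S.msgLen)
    fun κ x => S.dec κ x.fst x.snd

/-- Decryption never fails for keys output by key generation. -/
def SKE.PerfectlyCorrect (S : SKE) : Prop :=
  ∀ κ r m z, S.dec κ (S.kgen κ r) (S.enc κ (S.kgen κ r) m z) = m

/-- The canonical hybrid encryption scheme. -/
def hybrid (S : SKE) (P : PKE S.keyLen) : PKE S.msgLen where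
  pkLen := P.pkLen
  skLen := P.skLen
  ctxtLen := fun κ => S.ctxtLen κ + P.ctxtLen κ
  kgenRand := P.kgenRand
  encRand := fun κ => S.kgenRand κ + (S.encRand κ + P.encRand κ)
  kgen := P.kgen
  enc := fun κ pk m r =>
    let k := S.kgen κ r.fst
    Bits.pair (S.enc κ k m r.snd.fst) (P.enc κ pk k r.snd.snd)
  dec := fun κ sk c => S.dec κ (P.dec κ sk c.snd) c.fst

/-! ## Security games -/

/-- A quantum polynomial-time adversary: a first stage, which ends with the two challenge messages
on tracks 1 and 2, and a second stage, which starts with the challenge ciphertext on track 3 and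
the memory that the first stage left behind, and ends with the guess on the first qubit of
track 1. -/
structure Adversary where
  stage₁ : QuantumCircuits
  stage₂ : QuantumCircuits

/-- The probability that the adversary wins, that is, that its guess is the challenge bit `b`,
when it starts in the state `ρ`, has access to the oracle `O` in both stages, and is given the
challenge `chal b`, where `b` is uniformly random. -/
noncomputable def Adversary.winProb (A : Adversary) (κ : ℕ) (O : Dens →ₗ[ℂ] Dens)
    (chal : Bool → Dens →ₗ[ℂ] Dens) (ρ : Dens) : ℝ :=
  (∑ b : Bool, guessProb b (A.stage₂.run κ O (chal b (A.stage₁.run κ O ρ)))) / 2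

/-- The advantage in the qIND-qCPA game for public key encryption: quantum challenge, and access
to the type-2 encryption oracle in both stages. -/
noncomputable def PKE.qINDqCPAAdv {msgLen : ℕ → ℕ} (P : PKE msgLen) (A : Adversary) (κ : ℕ) : ℝ :=
  |average (fun r => A.winProb κ
      (type2Oracle 1 (P.enc κ (P.kgen κ r).1))
      (fun b => quantumChallenge b (P.enc κ (P.kgen κ r).1))
      (initialState (P.kgen κ r).1)) - 1 / 2|

/-- The advantage in the IND-qCPA game for public key encryption: classical challenge, no oracle
(the operation `query` does nothing). -/
noncomputable def PKE.INDqCPAAdv {msgLen : ℕ → ℕ} (P : PKE msgLen) (A : Adversary) (κ : ℕ) : ℝ :=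
  |average (fun r => A.winProb κ LinearMap.id
      (fun b => classicalChallenge b (P.enc κ (P.kgen κ r).1))
      (initialState (P.kgen κ r).1)) - 1 / 2|

/-- The advantage in the qIND game for symmetric key encryption: quantum challenge, no input and
no oracle (the operation `query` does nothing). -/
noncomputable def SKE.qINDAdv (S : SKE) (A : Adversary) (κ : ℕ) : ℝ :=
  |average (fun r => A.winProb κ LinearMap.id
      (fun b => quantumChallenge b (S.enc κ (S.kgen κ r)))
      (initialState (fun i : Fin 0 => i.elim0))) - 1 / 2|

/-- Negligible functions: smaller than every inverse polynomial. -/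
def Negligible (f : ℕ → ℝ) : Prop :=
  Asymptotics.SuperpolynomialDecay Filter.atTop (fun κ : ℕ => (κ : ℝ)) f

/-- qIND-qCPA security of a public key encryption scheme. -/
def PKE.QINDqCPASecure {msgLen : ℕ → ℕ} (P : PKE msgLen) : Prop :=
  ∀ A : Adversary, Negligible (P.qINDqCPAAdv A)

/-- IND-qCPA (QS1) security of a public key encryption scheme. -/
def PKE.INDqCPASecure {msgLen : ℕ → ℕ} (P : PKE msgLen) : Prop :=
  ∀ A : Adversary, Negligible (P.INDqCPAAdv A)

/-- qIND security of a symmetric key encryption scheme. -/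
def SKE.QINDSecure (S : SKE) : Prop :=
  ∀ A : Adversary, Negligible (S.qINDAdv A)

/-!
The proof is a game hop. Let `p_real` be the probability that the adversary `E` wins its game
against the hybrid scheme, and let `p_fake` be the same probability if the second part of the
challenge ciphertext is a public key encryption of `0` instead of the symmetric key. Then
`|p_real - 1/2| ≤ |p_real - p_fake| + |p_fake - 1/2|`.

* The adversary `B` against the public key scheme generates a symmetric key `k` and submits the
  messages `k` and `0`. It chooses a bit `β`, encrypts message `β` of `E` under `k`, uses its
  challenge ciphertext as the second part, and guesses "`k`" if `E` finds `β`. As the circuits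
  preserve traces (`guessProb_add_PKE`), its two guesses have complementary probabilities, and
  twice its advantage is `|p_real - p_fake|` (`guessProb_PKE`).
* The adversary `C` against the symmetric scheme generates a key pair, submits the message
  registers of `E`, and completes its challenge ciphertext by an encryption of `0`. Its advantage
  is `|p_fake - 1/2|` (`guessProb_SKE`).

These equalities are exact because both reductions simulate the memory and the encryption oracle of
`E` exactly. The memory of `E` is the register `e` of the reduction, and `embed d` inserts a state
of `E` into a reduction whose other registers are given by `d`. Apart from the gates `h` and `t`,
all operations are mixtures of maps of the form `filterMap`, which map basis states to basis states
and cancel some coherences. An oracle call is answered by `queryGates`, which tosses the coins of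
the encryption by measuring qubits in the state `(|0⟩ + |1⟩) / √2`, evaluates the circuits of the
schemes reversibly with uncomputation of all intermediate results
(`BoolCircuits.actList_xorGates`), and discards the coins. The type-2 oracle consumes the message
register, so the circuit must erase the message coherently. This is where perfect correctness
enters: given the key, the message is a function of the symmetric ciphertext, and adding the
decryption of the ciphertext to the message register leaves `0` (`act_sealGates`). No correctness
of the public key scheme is needed, as its message is the key, which is recomputed from the coins.
The result is `runList_queryGates`, and `runList_simulate` extends it to whole circuits.

The challenges are treated in the same way, by `runList_sealChallengeGates` and
`classicalChallenge_embed` for `B`, and by `quantumChallenge_moveGates` and `runList_completeGates`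
for `C`. All of them are compared with `fixedChallenge`, the hybrid challenge with a given second
part.

The reductions have to be uniform: the description of the gate at position `i` has to be a
polynomial-time function of `i`. The circuit of `E` with its oracle calls expanded is made of
blocks of equal length, padded with gates that do nothing (`Gate.simulate`), so that a division
finds the gate of `E` to which a position belongs (`UniformProg.simulate`).
-/

/-! ### Polynomial-time index functions -/

namespace PolyTime

variable {n : ℕ} {f g h k : (Fin n → ℕ) → ℕ}

theorem comp₁ {F : (Fin 1 → ℕ) → ℕ} (hF : PolyTime F) (hf : PolyTime f) :
    PolyTime fun v => F ![f v] := by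
  have := PolyTime.comp (g := ![f]) hF (by intro i; fin_cases i; exact hf)
  convert this using 3 with v
  ext i; fin_cases i; rfl

theorem comp₂ {F : (Fin 2 → ℕ) → ℕ} (hF : PolyTime F) (hf : PolyTime f) (hg : PolyTime g) :
    PolyTime fun v => F ![f v, g v] := by
  have := PolyTime.comp (g := ![f, g]) hF (by intro i; fin_cases i; exacts [hf, hg])
  convert this using 3 with v
  ext i; fin_cases i <;> rfl

theorem add' (hf : PolyTime f) (hg : PolyTime g) : PolyTime fun v => f v + g v :=
  comp₂ .add hf hg

theorem sub' (hf : PolyTime f) (hg : PolyTime g) : PolyTime fun v => f v - g v :=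
  comp₂ .sub hf hg

theorem mul' (hf : PolyTime f) (hg : PolyTime g) : PolyTime fun v => f v * g v :=
  comp₂ .mul hf hg

theorem div' (hf : PolyTime f) (hg : PolyTime g) : PolyTime fun v => f v / g v :=
  comp₂ .div hf hg

theorem const (c : ℕ) : PolyTime fun _ : Fin n → ℕ => c := by
  induction c with
  | zero => exact .zero
  | succ c ih => exact ih.add' (comp₁ .odd .zero)

theorem mod' (hf : PolyTime f) (hg : PolyTime g) : PolyTime fun v => f v % g v := by
  simpa only [Nat.mod_eq_sub_mul_div] using hf.sub' (hg.mul' (hf.div' hg))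

theorem ite_lt (hf : PolyTime f) (hg : PolyTime g) (hh : PolyTime h) (hk : PolyTime k) :
    PolyTime fun v => if f v < g v then h v else k v := by
  -- `1 - (f + 1 - g)` is the truth value of `f < g`, in truncated arithmetic
  have hc : PolyTime fun v => 1 - (f v + 1 - g v) :=
    (const 1).sub' ((hf.add' (const 1)).sub' hg)
  have := (hc.mul' hh).add' (((const 1).sub' hc).mul' hk)
  convert this using 2 with v
  split_ifs with hlt
  · rw [show f v + 1 - g v = 0 by omega]; simp
  · rw [show 1 - (f v + 1 - g v) = 0 by omega]; simp

theorem ite_eq (hf : PolyTime f) (hg : PolyTime g) (hh : PolyTime h) (hk : PolyTime k) :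
    PolyTime fun v => if f v = g v then h v else k v := by
  have := ite_lt hf hg hk (ite_lt hg hf hk hh)
  convert this using 2 with v
  split_ifs <;> first | rfl | omega

end PolyTime

namespace UniformIndex

variable {d e f g : ℕ → ℕ → ℕ} {ℓ : ℕ → ℕ}

theorem of_polyTime {F : (Fin 2 → ℕ) → ℕ} (hF : PolyTime F) :
    UniformIndex fun κ i => F ![2 ^ κ, i] := ⟨F, hF, fun _ _ => rfl⟩

theorem const (c : ℕ) : UniformIndex fun _ _ => c := of_polyTime (.const c)

theorem id : UniformIndex fun _ i => i := of_polyTime (.proj 1)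

theorem add (hd : UniformIndex d) (he : UniformIndex e) :
    UniformIndex fun κ i => d κ i + e κ i := by
  obtain ⟨F, hF, hFd⟩ := hd; obtain ⟨G, hG, hGe⟩ := he
  exact ⟨_, hF.add' hG, fun κ i => by rw [hFd, hGe]⟩

theorem sub (hd : UniformIndex d) (he : UniformIndex e) :
    UniformIndex fun κ i => d κ i - e κ i := by
  obtain ⟨F, hF, hFd⟩ := hd; obtain ⟨G, hG, hGe⟩ := he
  exact ⟨_, hF.sub' hG, fun κ i => by rw [hFd, hGe]⟩

theorem mul (hd : UniformIndex d) (he : UniformIndex e) :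
    UniformIndex fun κ i => d κ i * e κ i := by
  obtain ⟨F, hF, hFd⟩ := hd; obtain ⟨G, hG, hGe⟩ := he
  exact ⟨_, hF.mul' hG, fun κ i => by rw [hFd, hGe]⟩

theorem div (hd : UniformIndex d) (he : UniformIndex e) :
    UniformIndex fun κ i => d κ i / e κ i := by
  obtain ⟨F, hF, hFd⟩ := hd; obtain ⟨G, hG, hGe⟩ := he
  exact ⟨_, hF.div' hG, fun κ i => by rw [hFd, hGe]⟩

theorem mod (hd : UniformIndex d) (he : UniformIndex e) :
    UniformIndex fun κ i => d κ i % e κ i := by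
  obtain ⟨F, hF, hFd⟩ := hd; obtain ⟨G, hG, hGe⟩ := he
  exact ⟨_, hF.mod' hG, fun κ i => by rw [hFd, hGe]⟩

theorem ite_lt (hd : UniformIndex d) (he : UniformIndex e) (hf : UniformIndex f)
    (hg : UniformIndex g) : UniformIndex fun κ i => if d κ i < e κ i then f κ i else g κ i := by
  obtain ⟨D, hD, hDd⟩ := hd; obtain ⟨E, hE, hEe⟩ := he
  obtain ⟨F, hF, hFf⟩ := hf; obtain ⟨G, hG, hGg⟩ := hg
  exact ⟨_, hD.ite_lt hE hF hG, fun κ i => by rw [hDd, hEe, hFf, hGg]⟩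

theorem ite_eq (hd : UniformIndex d) (he : UniformIndex e) (hf : UniformIndex f)
    (hg : UniformIndex g) : UniformIndex fun κ i => if d κ i = e κ i then f κ i else g κ i := by
  obtain ⟨D, hD, hDd⟩ := hd; obtain ⟨E, hE, hEe⟩ := he
  obtain ⟨F, hF, hFf⟩ := hf; obtain ⟨G, hG, hGg⟩ := hg
  exact ⟨_, hD.ite_eq hE hF hG, fun κ i => by rw [hDd, hEe, hFf, hGg]⟩

theorem comp (hd : UniformIndex d) (he : UniformIndex e) :
    UniformIndex fun κ i => d κ (e κ i) := by
  obtain ⟨F, hF, hFd⟩ := hd; obtain ⟨G, hG, hGe⟩ := he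
  refine ⟨_, hF.comp₂ (.proj 0) hG, fun κ i => ?_⟩
  rw [hGe]; exact hFd κ (e κ i)

end UniformIndex

namespace UniformLength

variable {ℓ ℓ' : ℕ → ℕ}

theorem index (h : UniformLength ℓ) : UniformIndex fun κ _ => ℓ κ := by
  obtain ⟨⟨f, hf, hfℓ⟩, -⟩ := h
  exact ⟨_, hf.comp₁ (.proj 0), fun κ i => hfℓ κ⟩

theorem const (c : ℕ) : UniformLength fun _ => c :=
  ⟨⟨_, .const c, fun _ => rfl⟩, Polynomial.C c, fun _ => by simp⟩

theorem add (h : UniformLength ℓ) (h' : UniformLength ℓ') :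
    UniformLength fun κ => ℓ κ + ℓ' κ := by
  obtain ⟨⟨f, hf, hfℓ⟩, p, hp⟩ := h; obtain ⟨⟨g, hg, hgℓ⟩, q, hq⟩ := h'
  exact ⟨⟨_, hf.add' hg, fun κ => by rw [hfℓ, hgℓ]⟩, p + q,
    fun κ => by rw [Polynomial.eval_add]; exact Nat.add_le_add (hp κ) (hq κ)⟩

theorem mul (h : UniformLength ℓ) (h' : UniformLength ℓ') :
    UniformLength fun κ => ℓ κ * ℓ' κ := by
  obtain ⟨⟨f, hf, hfℓ⟩, p, hp⟩ := h; obtain ⟨⟨g, hg, hgℓ⟩, q, hq⟩ := h'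
  exact ⟨⟨_, hf.mul' hg, fun κ => by rw [hfℓ, hgℓ]⟩, p * q,
    fun κ => by rw [Polynomial.eval_mul]; exact Nat.mul_le_mul (hp κ) (hq κ)⟩

end UniformLength

/-! ### Uniform families of gate lists -/

/-- The gate lists `G κ` are those of a uniform family of quantum circuits of polynomial size. -/
def UniformProg (G : ℕ → List Gate) : Prop :=
  ∃ A : QuantumCircuits, ∀ κ, A.gates κ = G κ

theorem List.flatMap_range_map {α : Type*} (n L : ℕ) (f : ℕ → ℕ → α) :
    (List.range n).flatMap (fun q => (List.range L).map (f q)) =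
      (List.range (n * L)).map fun i => f (i / L) (i % L) := by
  induction n with
  | zero => simp
  | succ n ih =>
    rw [List.range_succ, List.flatMap_append, ih, Nat.succ_mul, List.range_add, List.map_append,
      List.map_map]
    congr 1
    simp only [List.flatMap_cons, List.flatMap_nil, List.append_nil]
    refine List.map_congr_left fun r hr => ?_
    rw [List.mem_range] at hr
    have hL : 0 < L := by omega
    simp only [Function.comp]
    rw [Nat.mul_comm n L, Nat.mul_add_div hL, Nat.mul_add_mod, Nat.div_eq_of_lt hr,
      Nat.mod_eq_of_lt hr, Nat.add_zero]

namespace UniformProg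

variable {n : ℕ → ℕ} {op a b c : ℕ → ℕ → ℕ} {G H : ℕ → List Gate}

theorem of_range (hn : UniformLength n) (ho : UniformIndex op) (ha : UniformIndex a)
    (hb : UniformIndex b) (hc : UniformIndex c) :
    UniformProg fun κ => (List.range (n κ)).map fun i =>
      Gate.decode (op κ i) (a κ i) (b κ i) (c κ i) :=
  ⟨⟨n, op, a, b, c, hn, ho, ha, hb, hc⟩, fun _ => rfl⟩

theorem cnot (hn : UniformLength n) (ha : UniformIndex a) (hb : UniformIndex b) :
    UniformProg fun κ => (List.range (n κ)).map fun i => Gate.cnot (a κ i) (b κ i) :=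
  of_range hn (.const 2) ha hb (.const 0)

theorem ccx (hn : UniformLength n) (ha : UniformIndex a) (hb : UniformIndex b)
    (hc : UniformIndex c) :
    UniformProg fun κ => (List.range (n κ)).map fun i => Gate.ccx (a κ i) (b κ i) (c κ i) :=
  of_range hn (.const 3) ha hb hc

theorem reset (hn : UniformLength n) (ha : UniformIndex a) :
    UniformProg fun κ => (List.range (n κ)).map fun i => Gate.reset (a κ i) :=
  of_range hn (.const 7) ha (.const 0) (.const 0)

theorem append (hG : UniformProg G) (hH : UniformProg H) : UniformProg fun κ => G κ ++ H κ := by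
  obtain ⟨A, hA⟩ := hG; obtain ⟨B, hB⟩ := hH
  have key {d e : ℕ → ℕ → ℕ} (hd : UniformIndex d) (he : UniformIndex e) :
      UniformIndex fun κ i => if i < A.size κ then d κ i else e κ (i - A.size κ) :=
    .ite_lt .id A.size_uniform.index hd (he.comp (.sub .id A.size_uniform.index))
  refine ⟨⟨_, _, _, _, _, A.size_uniform.add B.size_uniform, key A.op_uniform B.op_uniform,
    key A.arg₁_uniform B.arg₁_uniform, key A.arg₂_uniform B.arg₂_uniform,
    key A.arg₃_uniform B.arg₃_uniform⟩, fun κ => ?_⟩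
  beta_reduce
  rw [← hA, ← hB]
  simp only [QuantumCircuits.gates, List.range_add, List.map_append, List.map_map]
  congr 1
  · refine List.map_congr_left fun i hi => ?_
    simp [List.mem_range.1 hi]
  · refine List.map_congr_left fun i _ => ?_
    simp

theorem reverse (hG : UniformProg G) : UniformProg fun κ => (G κ).reverse := by
  obtain ⟨A, hA⟩ := hG
  have key {d : ℕ → ℕ → ℕ} (hd : UniformIndex d) :
      UniformIndex fun κ i => d κ (A.size κ - 1 - i) :=
    hd.comp ((A.size_uniform.index.sub (.const 1)).sub .id)
  refine ⟨⟨_, _, _, _, _, A.size_uniform, key A.op_uniform,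
    key A.arg₁_uniform, key A.arg₂_uniform, key A.arg₃_uniform⟩, fun κ => ?_⟩
  beta_reduce
  rw [← hA]
  refine List.ext_getElem (by simp [QuantumCircuits.gates]) fun i h₁ h₂ => ?_
  simp [QuantumCircuits.gates, List.getElem_reverse]

end UniformProg

/-! ### Simulating an adversary with oracle access -/

/-- Rename the wires of a gate; an oracle call is dropped. -/
def Gate.mapWires (e : ℕ → ℕ) : Gate → Gate
  | .skip => .skip
  | .x a => .x (e a)
  | .cnot a b => .cnot (e a) (e b)
  | .ccx a b c => .ccx (e a) (e b) (e c)
  | .h a => .h (e a)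
  | .t a => .t (e a)
  | .measure a => .measure (e a)
  | .reset a => .reset (e a)
  | .query => .skip

/-- Whether a gate is an oracle call. -/
def Gate.isQuery : Gate → Bool
  | .query => true
  | _ => false

/-- The gates that replace the gate `g`: its wires are renamed, and an oracle call is replaced by
the circuit `Q`. All replacements are padded to the same length, so that a position in the
resulting circuit determines the replaced gate by a division. -/
def Gate.simulate (e : ℕ → ℕ) (Q : List Gate) (g : Gate) : List Gate :=
  g.mapWires e :: if g.isQuery then Q else List.replicate Q.length .skip

theorem Gate.isQuery_decode (op a b c : ℕ) : (Gate.decode op a b c).isQuery = decide (op = 8) := by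
  unfold Gate.decode
  split <;> simp_all [Gate.isQuery]

theorem Gate.mapWires_decode (e : ℕ → ℕ) (op a b c : ℕ) :
    (Gate.decode op a b c).mapWires e =
      Gate.decode (if op = 8 then 0 else op) (e a) (e b) (e c) := by
  by_cases h : op = 8
  · subst h; rfl
  · rw [if_neg h]
    unfold Gate.decode
    split <;> simp_all [Gate.mapWires]

/-- The gate at position `i` of the simulating circuit belongs to the gate `i / (L + 1)` of `A`, where
`L` is the length of the circuit `Q`, and is its first replacement or the gate `i % (L + 1) - 1` of
`Q` (or of the padding). -/
theorem UniformProg.simulate (A : QuantumCircuits) {Q : ℕ → List Gate} (hQ : UniformProg Q)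
    {e : ℕ → ℕ} (he : UniformIndex fun _ i => e i) :
    UniformProg fun κ => (A.gates κ).flatMap (Gate.simulate e (Q κ)) := by
  obtain ⟨B, hB⟩ := hQ
  have hL : UniformLength fun κ => B.size κ + 1 := B.size_uniform.add (.const 1)
  have hq : UniformIndex fun κ i => i / (B.size κ + 1) := .div .id hL.index
  have hr : UniformIndex fun κ i => i % (B.size κ + 1) := .mod .id hL.index
  have harg {d d' : ℕ → ℕ → ℕ} (hd : UniformIndex d) (hd' : UniformIndex d') :
      UniformIndex fun κ i => if i % (B.size κ + 1) = 0 then e (d κ (i / (B.size κ + 1)))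
        else d' κ (i % (B.size κ + 1) - 1) :=
    .ite_eq hr (.const 0) (he.comp (hd.comp hq)) (hd'.comp (hr.sub (.const 1)))
  have hop : UniformIndex fun κ i =>
      if i % (B.size κ + 1) = 0 then
        (if A.op κ (i / (B.size κ + 1)) = 8 then 0 else A.op κ (i / (B.size κ + 1)))
      else (if A.op κ (i / (B.size κ + 1)) = 8 then B.op κ (i % (B.size κ + 1) - 1) else 0) :=
    .ite_eq hr (.const 0)
      (.ite_eq (A.op_uniform.comp hq) (.const 8) (.const 0) (A.op_uniform.comp hq))
      (.ite_eq (A.op_uniform.comp hq) (.const 8) (B.op_uniform.comp (hr.sub (.const 1))) (.const 0))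
  refine ⟨⟨_, _, _, _, _, A.size_uniform.mul hL, hop, harg A.arg₁_uniform B.arg₁_uniform,
    harg A.arg₂_uniform B.arg₂_uniform, harg A.arg₃_uniform B.arg₃_uniform⟩, fun κ => ?_⟩
  beta_reduce
  rw [← hB]
  simp only [QuantumCircuits.gates, List.flatMap_map]
  rw [← List.flatMap_range_map (A.size κ) (B.size κ + 1) fun q r => Gate.decode
    (if r = 0 then (if A.op κ q = 8 then 0 else A.op κ q)
      else (if A.op κ q = 8 then B.op κ (r - 1) else 0))
    (if r = 0 then e (A.arg₁ κ q) else B.arg₁ κ (r - 1))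
    (if r = 0 then e (A.arg₂ κ q) else B.arg₂ κ (r - 1))
    (if r = 0 then e (A.arg₃ κ q) else B.arg₃ κ (r - 1))]
  refine List.flatMap_congr fun q _ => ?_
  rw [List.range_succ_eq_map, List.map_cons, List.map_map, Gate.simulate, Gate.isQuery_decode,
    Gate.mapWires_decode]
  congr 1
  by_cases h8 : A.op κ q = 8
  · simp [h8, Function.comp_def]
  · simp [h8, Function.comp_def, Gate.decode]

/-! ### Mixtures over uniformly random bit strings -/

section Mix

variable {V W : Type*} [AddCommGroup V] [Module ℂ V] [AddCommGroup W] [Module ℂ W]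

/-- The uniform mixture of the vectors `Φ z`. -/
noncomputable def mix {n : ℕ} (Φ : Bits n → V) : V := ((1 : ℂ) / 2 ^ n) • ∑ z, Φ z

theorem map_mix {n : ℕ} (L : V →ₗ[ℂ] W) (Φ : Bits n → V) : L (mix Φ) = mix fun z => L (Φ z) := by
  simp [mix, map_sum]

theorem mix_apply {n : ℕ} (Φ : Bits n → V →ₗ[ℂ] W) (v : V) : mix Φ v = mix fun z => Φ z v := by
  simp [mix]

theorem comp_mix {U : Type*} [AddCommGroup U] [Module ℂ U] {n : ℕ} (L : V →ₗ[ℂ] W)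
    (Φ : Bits n → U →ₗ[ℂ] V) : L ∘ₗ mix Φ = mix fun z => L ∘ₗ Φ z := by
  ext; simp [mix, map_sum]

theorem mix_comp {U : Type*} [AddCommGroup U] [Module ℂ U] {n : ℕ}
    (Φ : Bits n → V →ₗ[ℂ] W) (L : U →ₗ[ℂ] V) : mix Φ ∘ₗ L = mix fun z => Φ z ∘ₗ L := by
  ext; simp [mix]

theorem mix_pair {m n : ℕ} (Φ : Bits (m + n) → V) :
    mix Φ = mix fun x : Bits m => mix fun y : Bits n => Φ (Bits.pair x y) := by
  simp only [mix, ← Finset.smul_sum, smul_smul]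
  congr 1
  · rw [pow_add]; ring
  · rw [← Fintype.sum_prod_type' (f := fun (x : Bits m) (y : Bits n) => Φ (Bits.pair x y))]
    exact (Fintype.sum_equiv (Fin.appendEquiv m n) _ _ fun _ => rfl).symm

theorem mix_zero (Φ : Bits 0 → V) : mix Φ = Φ (fun i => i.elim0) := by
  simp only [mix, pow_zero, div_one, one_smul, Fintype.sum_unique]
  exact congrArg Φ (Subsingleton.elim _ _)

theorem mix_snoc {n : ℕ} (Φ : Bits (n + 1) → V) :
    mix Φ = mix fun z : Bits n => ((1 : ℂ) / 2) • ∑ v : Bool, Φ (Fin.snoc z v) := by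
  simp only [mix, ← Finset.smul_sum, smul_smul]
  congr 1
  · rw [pow_succ]; ring
  · rw [Finset.sum_comm, ← Fintype.sum_prod_type' (f := fun (v : Bool) (x : Bits n) =>
      Φ (Fin.snoc x v : Bits (n + 1)))]
    exact (Fintype.sum_equiv (Fin.snocEquiv fun _ : Fin (n + 1) => Bool) _ _ fun _ => rfl).symm

theorem mix_const {n : ℕ} (v : V) : mix (fun _ : Bits n => v) = v := by
  simp only [mix, Finset.sum_const, Finset.card_univ, Fintype.card_pi, Fintype.card_bool,
    Finset.prod_const, Fintype.card_fin]
  rw [← Nat.cast_smul_eq_nsmul ℂ, smul_smul]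
  push_cast
  rw [one_div, inv_mul_cancel₀ (pow_ne_zero _ two_ne_zero), one_smul]

end Mix

/-! ### Channels of basis-preserving form -/

open Classical in
/-- The linear map that sends `|s⟩⟨t|` to `|f s⟩⟨f t|` if `R s t` holds, and to `0` otherwise.
Classical reversible computations, measurements and the discarding of qubits have this form. -/
noncomputable def filterMap (R : Mem → Mem → Prop) (f : Mem → Mem) : Dens →ₗ[ℂ] Dens :=
  Finsupp.linearCombination ℂ fun p =>
    if R p.1 p.2 then Finsupp.single (f p.1, f p.2) 1 else 0

open Classical in
theorem filterMap_single (R : Mem → Mem → Prop) (f : Mem → Mem) (s t : Mem) (a : ℂ) :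
    filterMap R f (Finsupp.single (s, t) a) =
      if R s t then Finsupp.single (f s, f t) a else 0 := by
  rw [filterMap, Finsupp.linearCombination_single]
  split_ifs <;> simp

theorem Dens.hom_ext {V : Type*} [AddCommGroup V] [Module ℂ V] {Φ Ψ : Dens →ₗ[ℂ] V}
    (h : ∀ s t, Φ (Finsupp.single (s, t) 1) = Ψ (Finsupp.single (s, t) 1)) : Φ = Ψ := by
  refine Finsupp.lhom_ext' fun p => LinearMap.ext_ring ?_
  exact h p.1 p.2

theorem filterMap_comp (R R' : Mem → Mem → Prop) (f f' : Mem → Mem) :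
    filterMap R f ∘ₗ filterMap R' f' =
      filterMap (fun s t => R' s t ∧ R (f' s) (f' t)) (f ∘ f') := by
  classical
  refine Dens.hom_ext fun s t => ?_
  simp only [LinearMap.comp_apply, filterMap_single]
  by_cases h : R' s t
  · simp [h, filterMap_single]
  · simp [h]

theorem filterMap_congr {R R' : Mem → Mem → Prop} {f f' : Mem → Mem}
    (hR : ∀ s t, R s t ↔ R' s t) (hf : ∀ s t, R' s t → f s = f' s ∧ f t = f' t) :
    filterMap R f = filterMap R' f' := by
  classical
  refine Dens.hom_ext fun s t => ?_
  simp only [filterMap_single, hR s t]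
  split_ifs with h
  · rw [(hf s t h).1, (hf s t h).2]
  · rfl

theorem filterMap_id : filterMap (fun _ _ => True) (fun s => s) = LinearMap.id :=
  Dens.hom_ext fun s t => by rw [filterMap_single]; simp

/-- The operator `|u⟩⟨v|`. -/
noncomputable def ketBra (u v : Ket) : Dens :=
  u.sum fun x a => v.sum fun y b => Finsupp.single (x, y) (a * star b)

theorem conjugate_single (K : Mem → Ket) (s t : Mem) (a : ℂ) :
    conjugate K (Finsupp.single (s, t) a) = a • ketBra (K s) (K t) := by
  rw [conjugate, Finsupp.linearCombination_single, ketBra]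

theorem ketBra_single (x y : Mem) (a b : ℂ) :
    ketBra (Finsupp.single x a) (Finsupp.single y b) = Finsupp.single (x, y) (a * star b) := by
  rw [ketBra, Finsupp.sum_single_index, Finsupp.sum_single_index] <;> simp

theorem ketBra_add_left (u u' v : Ket) : ketBra (u + u') v = ketBra u v + ketBra u' v := by
  unfold ketBra
  rw [Finsupp.sum_add_index']
  · simp
  · intro x a b
    simp only [add_mul, Finsupp.single_add]
    exact Finsupp.sum_add

theorem ketBra_add_right (u v v' : Ket) : ketBra u (v + v') = ketBra u v + ketBra u v' := by
  unfold ketBra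
  rw [← Finsupp.sum_add]
  refine Finsupp.sum_congr fun x _ => ?_
  rw [Finsupp.sum_add_index']
  · simp
  · intro x a b
    simp [mul_add]

theorem ketBra_zero_left (v : Ket) : ketBra 0 v = 0 := by simp [ketBra]

theorem ketBra_zero_right (u : Ket) : ketBra u 0 = 0 := by simp [ketBra]

theorem conjugate_basisMap (f : Mem → Mem) :
    conjugate (basisMap f) = filterMap (fun _ _ => True) f := by
  refine Dens.hom_ext fun s t => ?_
  rw [conjugate_single, filterMap_single, basisMap, basisMap, ketBra_single]
  simp

/-- A measurement of `obs` followed by `f`. Coherences survive only between basis states with the same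
outcome. -/
theorem sum_conjugate_eq_filterMap {X : Type*} [Fintype X] [DecidableEq X] (obs : Mem → X)
    (f : Mem → Mem) :
    (∑ x : X, conjugate fun s => if obs s = x then Finsupp.single (f s) 1 else 0) =
      filterMap (fun s t => obs s = obs t) f := by
  refine Dens.hom_ext fun s t => ?_
  rw [LinearMap.sum_apply, filterMap_single, Finset.sum_eq_single (obs s)]
  · rw [conjugate_single]
    by_cases h : obs s = obs t
    · simp [h, ketBra_single]
    · simp [h, Ne.symm h, ketBra_zero_right]
  · intro x _ hx
    rw [conjugate_single, if_neg (Ne.symm hx), ketBra_zero_left, smul_zero]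
  · simp

/-- Clear the first `n` qubits of track `t`. -/
def clearTrack (t : Fin 4) (n : ℕ) (s : Mem) : Mem := writeTrack t (fun _ : Fin n => false) s

theorem discardTrack_eq (t : Fin 4) (n : ℕ) : discardTrack t n =
    filterMap (fun s s' => readTrack t n s = readTrack t n s')
      (clearTrack t n) :=
  sum_conjugate_eq_filterMap _ _

theorem measureTrack_eq (t : Fin 4) (n : ℕ) : measureTrack t n =
    filterMap (fun s s' => readTrack t n s = readTrack t n s') (fun s => s) :=
  sum_conjugate_eq_filterMap _ _

theorem type2Oracle_eq (src : Fin 4) {m r c : ℕ} (enc : Bits m → Bits r → Bits c) :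
    type2Oracle src enc = mix fun z => filterMap (fun s s' => readTrack 3 c s = readTrack 3 c s')
      (fun s => writeTrack 3
        (enc (readTrack src m (clearTrack 3 c s)) z)
        (clearTrack src m (clearTrack 3 c s))) := by
  rw [type2Oracle, mix]
  congr 1
  refine Finset.sum_congr rfl fun z _ => ?_
  rw [conjugate_basisMap, discardTrack_eq, filterMap_comp]
  exact filterMap_congr (by simp) fun _ _ _ => ⟨rfl, rfl⟩

/-! ### Running lists of gates -/

/-- The action of a list of gates, as a linear map. -/
noncomputable def runList (O : Dens →ₗ[ℂ] Dens) : List Gate → Dens →ₗ[ℂ] Dens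
  | [] => LinearMap.id
  | g :: l => runList O l ∘ₗ g.channel O

section RunList

variable (O : Dens →ₗ[ℂ] Dens)

theorem runList_append (l l' : List Gate) :
    runList O (l ++ l') = runList O l' ∘ₗ runList O l := by
  induction l with
  | nil => rfl
  | cons g l ih => rw [List.cons_append, runList, runList, ih, LinearMap.comp_assoc]

theorem runList_singleton (g : Gate) : runList O [g] = g.channel O := rfl

theorem QuantumCircuits.run_eq (A : QuantumCircuits) (κ : ℕ) (ρ : Dens) :
    A.run κ O ρ = runList O (A.gates κ) ρ := by
  rw [QuantumCircuits.run]
  generalize A.gates κ = l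
  induction l generalizing ρ with
  | nil => rfl
  | cons g l ih => rw [List.foldl_cons, ih]; rfl

/-- The function on basis states computed by a classical reversible gate. -/
def Gate.act : Gate → Mem → Mem
  | .x a, s => Function.update s a (!(s a))
  | .cnot a b, s => if b = a then s else Function.update s b (xor (s b) (s a))
  | .ccx a b c, s => if c = a ∨ c = b then s else Function.update s c (xor (s c) (s a && s b))
  | _, s => s

/-- Classical reversible gates. -/
def Gate.IsClassical : Gate → Prop
  | .skip | .x _ | .cnot _ _ | .ccx _ _ _ => True
  | _ => False

/-- The function on basis states computed by a list of classical reversible gates. -/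
def actList (l : List Gate) (s : Mem) : Mem := l.foldl (fun s g => g.act s) s

theorem actList_append (l l' : List Gate) (s : Mem) :
    actList (l ++ l') s = actList l' (actList l s) := List.foldl_append

theorem Gate.channel_of_isClassical {g : Gate} (hg : g.IsClassical) :
    g.channel O = filterMap (fun _ _ => True) g.act := by
  cases g <;> simp only [Gate.IsClassical] at hg
  · exact filterMap_id.symm
  all_goals exact conjugate_basisMap _

theorem runList_of_isClassical {l : List Gate} (hl : ∀ g ∈ l, g.IsClassical) :
    runList O l = filterMap (fun _ _ => True) (actList l) := by
  induction l with
  | nil => exact filterMap_id.symm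
  | cons g l ih =>
    rw [runList, ih fun g' hg' => hl g' (List.mem_cons_of_mem _ hg'),
      Gate.channel_of_isClassical O (hl g List.mem_cons_self), filterMap_comp]
    exact filterMap_congr (by simp) fun _ _ _ => ⟨rfl, rfl⟩

/-- Set the wires `w 0, …, w (n - 1)` to `false`. -/
def clearWires (n : ℕ) (w : ℕ → ℕ) (s : Mem) : Mem :=
  fun v => if ∃ i < n, w i = v then false else s v

/-- Add the bits of `z` modulo 2 to the wires `w 0, …, w (n - 1)`. -/
def xorBits {n : ℕ} (w : ℕ → ℕ) (z : Bits n) (s : Mem) : Mem :=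
  fun v => xor (s v) (decide (∃ i : Fin n, w i = v ∧ z i = true))

theorem Gate.channel_reset (a : ℕ) : (Gate.reset a).channel O =
    filterMap (fun s t => s a = t a) (fun s => Function.update s a false) :=
  sum_conjugate_eq_filterMap (fun s => s a) _

theorem Gate.channel_measure (a : ℕ) : (Gate.measure a).channel O =
    filterMap (fun s t => s a = t a) (fun s => s) :=
  sum_conjugate_eq_filterMap (fun s => s a) _

theorem runList_reset (n : ℕ) (w : ℕ → ℕ) :
    runList O ((List.range n).map fun i => Gate.reset (w i)) =
      filterMap (fun s t => ∀ i < n, s (w i) = t (w i)) (clearWires n w) := by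
  induction n with
  | zero =>
    refine filterMap_id.symm.trans (filterMap_congr (by simp) fun s t _ => ?_)
    constructor <;> (ext v; simp [clearWires])
  | succ n ih =>
    rw [List.range_succ, List.map_append, runList_append, ih, List.map_singleton,
      runList_singleton, Gate.channel_reset, filterMap_comp]
    refine filterMap_congr (fun s t => ?_) fun s t _ => ?_
    · rw [Nat.forall_lt_succ_right]
      refine and_congr_right fun h => ?_
      simp only [clearWires]
      split_ifs with h'
      · obtain ⟨i, hi, hw⟩ := h'
        simp [← hw, h i hi]
      · rfl
    · have (s : Mem) : Function.update (clearWires n w s) (w n) false =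
          clearWires (n + 1) w s := by
        ext v
        simp only [clearWires, Function.update_apply, Nat.exists_lt_succ_right]
        by_cases h : v = w n
        · simp [h]
        · simp [h, Ne.symm h]
      exact ⟨this s, this t⟩

/-- Toss a fair coin into each of the wires `w 0, …, w (n - 1)`. -/
def coinGates (n : ℕ) (w : ℕ → ℕ) : List Gate :=
  (List.range n).flatMap fun i => [Gate.h (w i), Gate.measure (w i)]

/-- Measuring `(|0⟩ + |1⟩) / √2` yields a fair coin. -/
theorem runList_coin (a : ℕ) (f : Mem → Mem) (hf : ∀ s, f s a = false) :
    runList O [Gate.h a, Gate.measure a] ∘ₗ filterMap (fun _ _ => True) f =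
      ((1 : ℂ) / 2) • ∑ v : Bool,
        filterMap (fun _ _ => True) (fun s => Function.update (f s) a v) := by
  have hsqrt : ((Real.sqrt 2 : ℂ))⁻¹ * (Real.sqrt 2 : ℂ)⁻¹ = 2⁻¹ := by
    rw [← mul_inv, ← Complex.ofReal_mul, Real.mul_self_sqrt zero_le_two]; norm_num
  refine Dens.hom_ext fun s t => ?_
  simp only [runList, LinearMap.comp_apply, LinearMap.id_apply, Gate.channel_measure]
  simp only [filterMap_single, if_true, Gate.channel, conjugate_single, hf, one_smul,
    ketBra_add_left, ketBra_add_right, ketBra_single, map_add, LinearMap.smul_apply,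
    Fintype.sum_bool, LinearMap.add_apply]
  simp [hsqrt, Finsupp.smul_single, add_comm]

theorem runList_coinGates (n : ℕ) (w : ℕ → ℕ) (hw : Function.Injective w) (f : Mem → Mem)
    (hf : ∀ s, ∀ i < n, f s (w i) = false) :
    runList O (coinGates n w) ∘ₗ filterMap (fun _ _ => True) f =
      mix fun z : Bits n => filterMap (fun _ _ => True) (fun s => xorBits w z (f s)) := by
  induction n with
  | zero =>
    rw [mix_zero, show runList O (coinGates 0 w) = LinearMap.id from rfl, LinearMap.id_comp]
    refine filterMap_congr (by simp) fun s t _ => ?_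
    constructor <;> (ext v; simp [xorBits])
  | succ n ih =>
    rw [coinGates, List.range_succ, List.flatMap_append, runList_append, LinearMap.comp_assoc,
      ← coinGates, ih fun s i hi => hf s i (by omega), comp_mix, mix_snoc]
    congr 1
    funext z
    rw [List.flatMap_singleton, runList_coin]
    · congr 1
      refine Finset.sum_congr rfl fun v _ => filterMap_congr (by simp) fun s t _ => ?_
      have (s : Mem) : Function.update (xorBits w z (f s)) (w n) v =
          xorBits w (Fin.snoc z v : Bits (n + 1)) (f s) := by
        ext u
        simp only [xorBits, Function.update_apply, Fin.exists_fin_succ', Fin.snoc_castSucc,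
          Fin.snoc_last, Fin.val_castSucc, Fin.val_last]
        by_cases h : u = w n
        · subst h
          rw [if_pos rfl, hf s n (by omega)]
          have : ¬ ∃ i : Fin n, w i = w n ∧ z i = true := by
            rintro ⟨i, hi, -⟩
            have := hw hi
            omega
          simp only [this]
          cases v <;> simp
        · simp [h, Ne.symm h]
      exact ⟨this s, this t⟩
    · intro s
      rw [xorBits, hf s n (by omega)]
      have : ¬ ∃ i : Fin n, w i = w n ∧ z i = true := by
        rintro ⟨i, hi, -⟩
        have := hw hi
        omega
      simp [this]

end RunList

/-! ### Traces and guesses -/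

open Classical in
/-- The trace of an operator. -/
noncomputable def trace : Dens →ₗ[ℂ] ℂ :=
  Finsupp.linearCombination ℂ fun p => if p.1 = p.2 then 1 else 0

open Classical in
theorem trace_single (s t : Mem) (a : ℂ) :
    trace (Finsupp.single (s, t) a) = if s = t then a else 0 := by
  simp [trace, Finsupp.linearCombination_single]

open Classical in
/-- The probability `guessProb v` as a complex linear functional. -/
noncomputable def guessFunctional (v : Bool) : Dens →ₗ[ℂ] ℂ :=
  Finsupp.linearCombination ℂ fun p => if p.1 = p.2 ∧ p.1 (wire 1 0) = v then 1 else 0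

open Classical in
theorem guessFunctional_single (v : Bool) (s t : Mem) (a : ℂ) :
    guessFunctional v (Finsupp.single (s, t) a) =
      if s = t ∧ s (wire 1 0) = v then a else 0 := by
  rw [guessFunctional, Finsupp.linearCombination_single]
  split_ifs <;> simp

theorem guessProb_eq (v : Bool) (ρ : Dens) : guessProb v ρ = (guessFunctional v ρ).re := by
  rw [guessProb, guessFunctional, Finsupp.linearCombination_apply]
  congr 1
  refine Finsupp.sum_congr fun p _ => ?_
  split_ifs <;> simp

theorem guessProb_mix (v : Bool) {n : ℕ} (ρ : Bits n → Dens) :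
    guessProb v (mix ρ) = average fun z => guessProb v (ρ z) := by
  simp only [guessProb_eq, average, mix, map_smul, map_sum]
  rw [show ((1 : ℂ) / 2 ^ n) = ((1 / 2 ^ n : ℝ) : ℂ) by push_cast; rfl, smul_eq_mul,
    Complex.re_ofReal_mul, Complex.re_sum]
  ring

theorem guessProb_false_add_true (ρ : Dens) :
    guessProb false ρ + guessProb true ρ = (trace ρ).re := by
  rw [guessProb_eq, guessProb_eq, ← Complex.add_re, ← LinearMap.add_apply]
  congr 2
  refine Dens.hom_ext fun s t => ?_
  rw [LinearMap.add_apply, guessFunctional_single, guessFunctional_single, trace_single]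
  by_cases h : s = t
  · subst h
    generalize s (wire 1 0) = b
    cases b <;> simp
  · simp [h]

/-- Within each measurement outcome the map `f` has to be injective, that is, to act as an isometry. -/
theorem trace_comp_filterMap (R : Mem → Mem → Prop) (f : Mem → Mem) (hR : ∀ s, R s s)
    (hf : ∀ s t, R s t → f s = f t → s = t) : trace ∘ₗ filterMap R f = trace := by
  classical
  refine Dens.hom_ext fun s t => ?_
  rw [LinearMap.comp_apply, filterMap_single, trace_single]
  by_cases h : s = t
  · subst h; simp [hR, trace_single]
  · by_cases hR' : R s t
    · rw [if_pos hR', trace_single, if_neg fun h' => h (hf s t hR' h'), if_neg h]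
    · simp [hR', h]

theorem Gate.act_act (g : Gate) (s : Mem) : g.act (g.act s) = s := by
  cases g with
  | x a => simp [Gate.act]
  | cnot a b =>
    simp only [Gate.act]
    by_cases h : b = a
    · simp [h]
    · simp [h, Ne.symm h]
  | ccx a b c =>
    simp only [Gate.act]
    by_cases h : c = a ∨ c = b
    · simp [h]
    · have h' := h
      push Not at h'
      simp [h'.1, h'.2, Ne.symm h'.1, Ne.symm h'.2]
  | _ => rfl

theorem Gate.trace_comp_channel {O : Dens →ₗ[ℂ] Dens} (hO : trace ∘ₗ O = trace) (g : Gate) :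
    trace ∘ₗ g.channel O = trace := by
  by_cases hc : g.IsClassical
  · rw [Gate.channel_of_isClassical O hc]
    exact trace_comp_filterMap _ _ (fun _ => trivial) fun s t _ h => by
      rw [← Gate.act_act g s, h, Gate.act_act]
  have hsqrt : ((Real.sqrt 2 : ℂ))⁻¹ * (Real.sqrt 2 : ℂ)⁻¹ = 2⁻¹ := by
    rw [← mul_inv, ← Complex.ofReal_mul, Real.mul_self_sqrt zero_le_two]; norm_num
  cases g with
  | h a =>
    refine Dens.hom_ext fun s t => ?_
    have e1 (u : Bool) : (Function.update s a u : Mem) = Function.update t a u ↔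
        ∀ b, b ≠ a → s b = t b := by
      rw [funext_iff]
      refine forall_congr' fun b => ?_
      by_cases hb : b = a <;> simp [hb]
    have e2 (u v : Bool) (huv : u ≠ v) : (Function.update s a u : Mem) ≠ Function.update t a v := by
      intro h
      have := congrFun h a
      simp [huv] at this
    have e3 : s = t ↔ s a = t a ∧ ∀ b, b ≠ a → s b = t b := by
      constructor
      · rintro rfl; simp
      · rintro ⟨h1, h2⟩; ext b
        by_cases hb : b = a
        · rw [hb, h1]
        · rw [h2 b hb]
    simp only [Gate.channel, LinearMap.comp_apply, conjugate_single, ketBra_add_left,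
      ketBra_add_right, ketBra_single, one_smul, map_add, trace_single,
      e2 true false (by decide), e2 false true (by decide), if_false]
    by_cases h : ∀ b, b ≠ a → s b = t b
    · have e4 : s = t ↔ s a = t a := e3.trans (and_iff_left h)
      by_cases hst : s a = t a
      · simp only [e4.2 hst, if_true]
        cases t a <;> simp [hsqrt, neg_div] <;> norm_num
      · rw [if_pos ((e1 false).2 h), if_pos ((e1 true).2 h), if_neg (mt e4.1 hst)]
        revert hst
        cases s a <;> cases t a <;> simp [hsqrt, neg_div]
    · rw [if_neg (mt (e1 false).1 h), if_neg (mt (e1 true).1 h),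
        if_neg fun h' => h (e3.1 h').2]
      simp
  | t a =>
    refine Dens.hom_ext fun s t => ?_
    simp only [Gate.channel, LinearMap.comp_apply, conjugate_single, ketBra_single, one_smul,
      trace_single]
    by_cases h : s = t
    · subst h
      simp only [if_true]
      split_ifs
      · rw [Complex.star_def, ← Complex.exp_conj, ← Complex.exp_add]
        rw [show Complex.I * Real.pi / 4 + (starRingEnd ℂ) (Complex.I * Real.pi / 4) = 0 by
          rw [map_div₀, map_mul, Complex.conj_I, Complex.conj_ofReal, Complex.conj_ofNat]; ring]
        exact Complex.exp_zero
      · simp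
    · simp [h]
  | measure a =>
    rw [Gate.channel_measure]
    exact trace_comp_filterMap _ _ (fun _ => rfl) fun s t _ h => h
  | reset a =>
    rw [Gate.channel_reset]
    refine trace_comp_filterMap _ _ (fun _ => rfl) fun s t h h' => ?_
    ext b
    by_cases hb : b = a
    · rw [hb, h]
    · simpa [hb] using congrFun h' b
  | query => exact hO
  | _ => exact absurd trivial hc

theorem trace_runList {O : Dens →ₗ[ℂ] Dens} (hO : trace ∘ₗ O = trace) (l : List Gate) (ρ : Dens) :
    trace (runList O l ρ) = trace ρ := by
  induction l generalizing ρ with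
  | nil => rfl
  | cons g l ih =>
    rw [runList, LinearMap.comp_apply, ih, ← LinearMap.comp_apply, Gate.trace_comp_channel hO]

/-! ### Reversible evaluation of Boolean circuits -/

theorem xorBits_of_forall_ne {n : ℕ} {w : ℕ → ℕ} {z : Bits n} {s : Mem} {v : ℕ}
    (h : ∀ i < n, w i ≠ v) : xorBits w z s v = s v := by
  have : ¬ ∃ i : Fin n, w i = v ∧ z i = true := by
    rintro ⟨i, hi, -⟩
    exact h i i.2 hi
  simp [xorBits, this]

theorem xorBits_apply {n : ℕ} {w : ℕ → ℕ} (hw : Function.Injective w) (z : Bits n) (s : Mem)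
    (i : Fin n) : xorBits w z s (w i) = xor (s (w i)) (z i) := by
  have : (∃ j : Fin n, w j = w i ∧ z j = true) ↔ z i = true := by
    constructor
    · rintro ⟨j, hj, hz⟩
      rwa [Fin.ext (hw hj)] at hz
    · exact fun h => ⟨i, rfl, h⟩
  simp [xorBits, this]

/-- A list of gates, the `j`-th of which adds the bit `val j s` to the wire `dst j`, where `val`
does not depend on the target wires. -/
theorem actList_eq_xorBits {k : ℕ} {g : ℕ → Gate} {dst : ℕ → ℕ} (hdst : Function.Injective dst)
    {val : ℕ → Mem → Bool}
    (hg : ∀ j < k, ∀ s, (g j).act s = Function.update s (dst j) (xor (s (dst j)) (val j s)))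
    (hval : ∀ j < k, ∀ s s' : Mem, (∀ v, (∀ i < k, dst i ≠ v) → s v = s' v) → val j s = val j s')
    (s : Mem) : actList ((List.range k).map g) s = xorBits dst (fun j : Fin k => val j s) s := by
  have key (n : ℕ) (hn : n ≤ k) :
      actList ((List.range n).map g) s = xorBits dst (fun j : Fin n => val j s) s := by
    induction n with
    | zero => ext v; simp [actList, xorBits]
    | succ n ih =>
      rw [List.range_succ, List.map_append, actList_append, ih (by omega), List.map_singleton]
      rw [actList, List.foldl_cons, List.foldl_nil, hg n (by omega)]
      rw [hval n (by omega) _ s fun v hv => xorBits_of_forall_ne fun i hi => hv i (by omega)]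
      ext v
      by_cases h : v = dst n
      · subst h
        rw [Function.update_self]
        rw [xorBits_of_forall_ne fun i hi h => by have := hdst h; omega]
        exact (xorBits_apply hdst (fun j : Fin (n + 1) => val j s) s (Fin.last n)).symm
      · rw [Function.update_of_ne h]
        simp [xorBits, Fin.exists_fin_succ', Ne.symm h]
  exact key k le_rfl

/-- Gates that add the contents of the wires `src j` to the wires `dst j`. -/
def copyGates (k : ℕ) (src dst : ℕ → ℕ) : List Gate :=
  (List.range k).map fun j => Gate.cnot (src j) (dst j)

theorem actList_copyGates {k : ℕ} {src dst : ℕ → ℕ} (hdst : Function.Injective dst)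
    (h : ∀ i < k, ∀ j < k, dst j ≠ src i) (s : Mem) :
    actList (copyGates k src dst) s = xorBits dst (fun j : Fin k => s (src j)) s := by
  refine actList_eq_xorBits hdst (val := fun j s => s (src j)) (fun j hj s => ?_) ?_ s
  · simp [Gate.act, h j hj j hj]
  · exact fun j hj s s' hs => hs _ fun i hi => h j hj i hi

/-- The wire that carries wire `w` of a Boolean circuit with `m` inputs: the inputs are read from
the wires `src`, the gates write to the wires `work`. -/
def circuitWire (m : ℕ) (src work : ℕ → ℕ) (w : ℕ) : ℕ := if w < m then src w else work w

namespace BoolCircuits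

variable (C : BoolCircuits) (κ : ℕ)

/-- Reversible evaluation of the first `n` gates of a circuit; the wires `work` have to be in the
state `0`. -/
def nandGates (n m : ℕ) (src work : ℕ → ℕ) : List Gate :=
  (List.range n).flatMap fun i =>
    [Gate.ccx (circuitWire m src work (C.left κ i)) (circuitWire m src work (C.right κ i))
      (work (m + i)), Gate.x (work (m + i))]

/-- Gates that add the first `k` outputs of the circuit, evaluated on the wires `src`, to the wires
`dst`; the wires `work` are returned to the state `0`. -/
def xorGates (m k : ℕ) (src work dst : ℕ → ℕ) : List Gate :=
  C.nandGates κ (C.size κ) m src work ++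
    copyGates k (fun j => circuitWire m src work (C.out κ j)) dst ++
      (C.nandGates κ (C.size κ) m src work).reverse

theorem wires_of_le {m : ℕ} (x : Bits m) (i w : ℕ) (hw : m + i ≤ w) :
    C.wires κ x i w = false := by
  induction i with
  | zero => simp [wires, show ¬ w < m by omega]
  | succ i ih =>
    rw [wires, Function.update_of_ne (by omega)]
    exact ih (by omega)

variable {m : ℕ} {src work : ℕ → ℕ} (hwork : Function.Injective work)
  (hsrc : ∀ i < m, ∀ w, src i ≠ work w)
include hwork hsrc

/-- After the first `n` gates the wires carry the values in the Boolean circuit. -/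
theorem actList_nandGates_spec {s : Mem} (hs : ∀ w, s (work w) = false) (n : ℕ) :
    (∀ w, actList (C.nandGates κ n m src work) s (circuitWire m src work w) =
      C.wires κ (fun i : Fin m => s (src i)) n w) ∧
    ∀ v, (∀ w, work w ≠ v) → actList (C.nandGates κ n m src work) s v = s v := by
  induction n with
  | zero =>
    refine ⟨fun w => ?_, fun v _ => rfl⟩
    simp only [circuitWire, wires]
    split_ifs
    · rfl
    · exact hs w
  | succ n ih =>
    obtain ⟨ih₁, ih₂⟩ := ih
    rw [nandGates, List.range_succ, List.flatMap_append, ← nandGates]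
    simp only [actList_append, List.flatMap_singleton]
    set s' := actList (C.nandGates κ n m src work) s
    set x : Bits m := fun i => s (src i)
    have htarget : s' (work (m + n)) = false := by
      have := ih₁ (m + n)
      rw [circuitWire, if_neg (by omega)] at this
      rw [this, wires_of_le _ _ _ _ _ le_rfl]
    -- a controlled gate whose target is one of its controls has no effect, which agrees with
    -- the convention that a wire carries `false` before it has been assigned
    have hstep : actList [Gate.ccx (circuitWire m src work (C.left κ n))
        (circuitWire m src work (C.right κ n)) (work (m + n)), Gate.x (work (m + n))] s' =
        Function.update s' (work (m + n))
          (!(C.wires κ x n (C.left κ n) && C.wires κ x n (C.right κ n))) := by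
      rw [← ih₁, ← ih₁]
      simp only [actList, List.foldl_cons, List.foldl_nil, Gate.act]
      split_ifs with h
      · rw [htarget]
        rcases h with h | h <;> rw [← h, htarget] <;> simp
      · simp [htarget]
    rw [hstep]
    refine ⟨fun w => ?_, fun v hv => ?_⟩
    · rw [wires]
      by_cases hw : w = m + n
      · subst hw
        rw [circuitWire, if_neg (by omega), Function.update_self, Function.update_self]
      · have hne : circuitWire m src work w ≠ work (m + n) := by
          rw [circuitWire]
          split_ifs with h
          · exact hsrc w h _
          · exact fun h' => hw (hwork h')
        rw [Function.update_of_ne hw, Function.update_of_ne hne, ih₁]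
    · rw [Function.update_of_ne (hv _).symm, ih₂ v hv]

omit hwork hsrc in
theorem actList_reverse (l : List Gate) (s : Mem) : actList l.reverse (actList l s) = s := by
  induction l generalizing s with
  | nil => rfl
  | cons g l ih =>
    rw [List.reverse_cons, actList_append]
    have : actList (g :: l) s = actList l (g.act s) := rfl
    rw [this, ih]
    exact Gate.act_act g s

omit hwork hsrc in
/-- Gates commute with the addition of a fixed bit string if each of them does. -/
theorem actList_xor {l : List Gate} {D : Mem}
    (hl : ∀ g ∈ l, ∀ s : Mem, g.act (fun v => xor (s v) (D v)) = fun v => xor (g.act s v) (D v))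
    (s : Mem) : actList l (fun v => xor (s v) (D v)) = fun v => xor (actList l s v) (D v) := by
  induction l generalizing s with
  | nil => rfl
  | cons g l ih =>
    have (s : Mem) : actList (g :: l) s = actList l (g.act s) := rfl
    rw [this, this, hl g List.mem_cons_self, ih fun g' hg' => hl g' (List.mem_cons_of_mem _ hg')]

theorem actList_xorGates {k : ℕ} {dst : ℕ → ℕ} (hdst : Function.Injective dst)
    (hdw : ∀ j < k, ∀ w, dst j ≠ work w) (hds : ∀ j < k, ∀ i < m, dst j ≠ src i) {s : Mem}
    (hs : ∀ w, s (work w) = false) :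
    actList (C.xorGates κ m k src work dst) s =
      xorBits dst (C.eval κ (fun i : Fin m => s (src i)) : Bits k) s := by
  obtain ⟨h₁, h₂⟩ := C.actList_nandGates_spec κ hwork hsrc hs (C.size κ)
  set l := C.nandGates κ (C.size κ) m src work with hl
  have hne (j : ℕ) (hj : j < k) (w : ℕ) : dst j ≠ circuitWire m src work w := by
    rw [circuitWire]
    split_ifs with h
    exacts [hds j hj w h, hdw j hj w]
  have hcopy : actList (copyGates k (fun j => circuitWire m src work (C.out κ j)) dst)
      (actList l s) = xorBits dst (C.eval κ (fun i : Fin m => s (src i)) : Bits k)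
        (actList l s) := by
    rw [actList_copyGates hdst fun i _ j hj => hne j hj _]
    congr 1
    funext j
    exact h₁ _
  rw [xorGates, actList_append, actList_append, ← hl, hcopy]
  -- the outputs are added on wires that the evaluation does not touch, so that the addition
  -- commutes with the inverse evaluation
  set y : Bits k := C.eval κ fun i : Fin m => s (src i)
  have hD (w : ℕ) : decide (∃ i : Fin k, dst i = circuitWire m src work w ∧ y i = true) = false := by
    rw [decide_eq_false]
    rintro ⟨i, hi, -⟩
    exact hne i i.2 w hi
  have hDw (n : ℕ) : decide (∃ i : Fin k, dst i = work n ∧ y i = true) = false := by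
    rw [decide_eq_false]
    rintro ⟨i, hi, -⟩
    exact hdw i i.2 n hi
  have := actList_xor (l := l.reverse)
    (D := fun v => decide (∃ i : Fin k, dst i = v ∧ y i = true)) ?_ (actList l s)
  · refine this.trans ?_
    rw [actList_reverse]
    rfl
  · intro g hg s
    rw [List.mem_reverse, hl, nandGates, List.mem_flatMap] at hg
    obtain ⟨i, -, hg⟩ := hg
    simp only [List.mem_cons, List.not_mem_nil, or_false] at hg
    have key (a : ℕ) (b b' : Bool) (s : Mem)
        (ha : decide (∃ i : Fin k, dst i = a ∧ y i = true) = false) (hb : b = b') :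
        Function.update (fun v => xor (s v) (decide (∃ i : Fin k, dst i = v ∧ y i = true))) a b =
          fun v => xor (Function.update s a b' v)
            (decide (∃ i : Fin k, dst i = v ∧ y i = true)) := by
      subst hb
      ext v
      by_cases hv : v = a
      · subst hv
        rw [Function.update_self, Function.update_self, ha, Bool.xor_false]
      · rw [Function.update_of_ne hv, Function.update_of_ne hv]
    rcases hg with rfl | rfl
    · simp only [Gate.act]
      split_ifs with h
      · rfl
      · refine key _ _ _ _ (hDw _) ?_
        rw [hD, hD, hDw]
        simp
    · refine key _ _ _ _ (hDw _) ?_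
      beta_reduce
      rw [hDw, Bool.xor_false]

end BoolCircuits

theorem isClassical_copyGates {k : ℕ} {src dst : ℕ → ℕ} :
    ∀ g ∈ copyGates k src dst, g.IsClassical := by
  simp only [copyGates, List.mem_map]
  rintro g ⟨j, -, rfl⟩
  trivial

theorem BoolCircuits.isClassical_xorGates {C : BoolCircuits} {κ m k : ℕ} {src work dst : ℕ → ℕ} :
    ∀ g ∈ C.xorGates κ m k src work dst, g.IsClassical := by
  have h : ∀ g ∈ C.nandGates κ (C.size κ) m src work, g.IsClassical := by
    simp only [nandGates, List.mem_flatMap, List.mem_cons, List.not_mem_nil, or_false]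
    rintro g ⟨i, -, rfl | rfl⟩ <;> trivial
  intro g hg
  simp only [xorGates, List.mem_append, List.mem_reverse] at hg
  rcases hg with (hg | hg) | hg
  exacts [h g hg, isClassical_copyGates g hg, h g hg]

namespace UniformProg

variable {m k : ℕ → ℕ} {src work dst : ℕ → ℕ → ℕ}

theorem copyGates (hk : UniformLength k) (hsrc : UniformIndex src) (hdst : UniformIndex dst) :
    UniformProg fun κ => _root_.copyGates (k κ) (src κ) (dst κ) := cnot hk hsrc hdst

theorem coinGates (hk : UniformLength k) (hdst : UniformIndex dst) :
    UniformProg fun κ => _root_.coinGates (k κ) (dst κ) := by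
  have hhalf : UniformIndex fun _ i => i / 2 := .div .id (.const 2)
  have := of_range (hk.mul (.const 2))
    (UniformIndex.ite_eq (.mod .id (.const 2)) (.const 0) (.const 4) (.const 6))
    (hdst.comp hhalf) (.const 0) (.const 0)
  convert this using 2 with κ
  refine Eq.trans ?_ (List.flatMap_range_map (k κ) 2 fun q r =>
    Gate.decode (if r = 0 then 4 else 6) (dst κ q) 0 0)
  rfl

theorem xorGates (C : BoolCircuits) (hm : UniformLength m) (hk : UniformLength k)
    (hsrc : UniformIndex src) (hwork : UniformIndex work) (hdst : UniformIndex dst) :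
    UniformProg fun κ => C.xorGates κ (m κ) (k κ) (src κ) (work κ) (dst κ) := by
  have hwire : UniformIndex fun κ i => circuitWire (m κ) (src κ) (work κ) i :=
    .ite_lt .id hm.index hsrc hwork
  have hhalf : UniformIndex fun _ i => i / 2 := .div .id (.const 2)
  have htarget : UniformIndex fun κ i => work κ (m κ + i / 2) := hwork.comp (hm.index.add hhalf)
  have hpar : UniformIndex fun _ i => i % 2 := .mod .id (.const 2)
  have hnand : UniformProg fun κ => C.nandGates κ (C.size κ) (m κ) (src κ) (work κ) := by
    have := of_range (C.size_uniform.mul (.const 2))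
      (UniformIndex.ite_eq hpar (.const 0) (.const 3) (.const 1))
      (UniformIndex.ite_eq hpar (.const 0) (hwire.comp (C.left_uniform.comp hhalf)) htarget)
      (hwire.comp (C.right_uniform.comp hhalf)) htarget
    convert this using 2 with κ
    refine Eq.trans ?_ (List.flatMap_range_map (C.size κ) 2 fun q r =>
      Gate.decode (if r = 0 then 3 else 1)
        (if r = 0 then circuitWire (m κ) (src κ) (work κ) (C.left κ q) else work κ (m κ + q))
        (circuitWire (m κ) (src κ) (work κ) (C.right κ q)) (work κ (m κ + q)))
    rfl
  exact (hnand.append (copyGates hk (hwire.comp C.out_uniform) hdst)).append hnand.reverse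

end UniformProg

/-! ### The memory of the reductions -/

/-- The registers of a reduction, each an infinite sequence of qubits: `e` holds the whole memory
of the simulated adversary, `t1`, `t2`, `t3` are the communication tracks of the reduction, and the
others are scratch registers on track 0. -/
inductive Reg where
  | e | pk | k | r1 | r2 | r3 | beta | work | t1 | t2 | t3

/-- The contents of the registers. -/
structure Cfg where
  (e pk k r1 r2 r3 beta work t1 t2 t3 : ℕ → Bool)

/-- The contents of a register. -/
def Cfg.get (d : Cfg) : Reg → ℕ → Bool
  | .e => d.e | .pk => d.pk | .k => d.k | .r1 => d.r1 | .r2 => d.r2 | .r3 => d.r3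
  | .beta => d.beta | .work => d.work | .t1 => d.t1 | .t2 => d.t2 | .t3 => d.t3

/-- Replace the contents of a register. -/
def Cfg.set (d : Cfg) (r : Reg) (f : ℕ → Bool) : Cfg :=
  match r with
  | .e => { d with e := f } | .pk => { d with pk := f } | .k => { d with k := f }
  | .r1 => { d with r1 := f } | .r2 => { d with r2 := f } | .r3 => { d with r3 := f }
  | .beta => { d with beta := f } | .work => { d with work := f }
  | .t1 => { d with t1 := f } | .t2 => { d with t2 := f } | .t3 => { d with t3 := f }

/-- The wire of qubit `i` of a register. -/
def cell (r : Reg) (i : ℕ) : ℕ :=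
  match r with
  | .e => 4 * (8 * i) | .pk => 4 * (8 * i + 1) | .k => 4 * (8 * i + 2)
  | .r1 => 4 * (8 * i + 3) | .r2 => 4 * (8 * i + 4) | .r3 => 4 * (8 * i + 5)
  | .beta => 4 * (8 * i + 6) | .work => 4 * (8 * i + 7)
  | .t1 => 4 * i + 1 | .t2 => 4 * i + 2 | .t3 => 4 * i + 3

/-- The register to which a wire belongs. -/
def regOf (w : ℕ) : Reg :=
  match w % 4 with
  | 1 => .t1 | 2 => .t2 | 3 => .t3
  | _ => match w / 4 % 8 with
    | 0 => .e | 1 => .pk | 2 => .k | 3 => .r1 | 4 => .r2 | 5 => .r3 | 6 => .beta | _ => .work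

/-- The position of a wire in its register. -/
def posOf (w : ℕ) : ℕ := if w % 4 = 0 then w / 4 / 8 else w / 4

theorem regOf_cell (r : Reg) (i : ℕ) : regOf (cell r i) = r := by
  cases r <;> simp only [cell, regOf]
  all_goals simp

theorem posOf_cell (r : Reg) (i : ℕ) : posOf (cell r i) = i := by
  rw [posOf]
  split_ifs <;> cases r <;> simp only [cell] at * <;> omega

theorem cell_regOf_posOf (w : ℕ) : cell (regOf w) (posOf w) = w := by
  unfold regOf posOf
  split
  · simp only [cell]; split_ifs <;> omega
  · simp only [cell]; split_ifs <;> omega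
  · simp only [cell]; split_ifs <;> omega
  · rename_i h₁ h₂ h₃
    have : w % 4 = 0 := by
      have := Nat.mod_lt w (show 0 < 4 by omega)
      have : w % 4 ≠ 1 := h₁
      have : w % 4 ≠ 2 := h₂
      have : w % 4 ≠ 3 := h₃
      omega
    rw [if_pos this]
    split
    case h_8 h₀ h₁ h₂ h₃ h₄ h₅ h₆ =>
      have := Nat.mod_lt (w / 4) (show 0 < 8 by omega)
      have : w / 4 % 8 ≠ 0 := h₀
      have : w / 4 % 8 ≠ 1 := h₁
      have : w / 4 % 8 ≠ 2 := h₂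
      have : w / 4 % 8 ≠ 3 := h₃
      have : w / 4 % 8 ≠ 4 := h₄
      have : w / 4 % 8 ≠ 5 := h₅
      have : w / 4 % 8 ≠ 6 := h₆
      simp only [cell]; omega
    all_goals simp only [cell]; omega

theorem cell_inj {r r' : Reg} {i i' : ℕ} : cell r i = cell r' i' ↔ r = r' ∧ i = i' := by
  refine ⟨fun h => ⟨?_, ?_⟩, by rintro ⟨rfl, rfl⟩; rfl⟩
  · rw [← regOf_cell r i, h, regOf_cell]
  · rw [← posOf_cell r i, h, posOf_cell]

theorem cell_injective (r : Reg) : Function.Injective (cell r) := fun _ _ h => (cell_inj.1 h).2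

theorem cell_comp_injective (r : Reg) {u : ℕ → ℕ} (hu : Function.Injective u) :
    Function.Injective fun j => cell r (u j) := (cell_injective r).comp hu

theorem UniformIndex.cell (r : Reg) {f : ℕ → ℕ → ℕ} (hf : UniformIndex f) :
    UniformIndex fun κ i => cell r (f κ i) := by
  cases r
  · exact (const 4).mul ((const 8).mul hf)
  iterate 7 exact (const 4).mul (((const 8).mul hf).add (const _))
  all_goals exact ((const 4).mul hf).add (const _)

theorem wire_injective (t : Fin 4) : Function.Injective (wire t) := fun i j h => by
  simp only [wire] at h; omega

theorem wire_offset_injective (t : Fin 4) (a : ℕ) : Function.Injective fun j => wire t (a + j) :=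
  fun i j h => by simp only [wire] at h; omega

theorem UniformIndex.wire (t : Fin 4) {f : ℕ → ℕ → ℕ} (hf : UniformIndex f) :
    UniformIndex fun κ i => wire t (f κ i) := ((const 4).mul hf).add (const _)

theorem wire_inj {t t' : Fin 4} {i i' : ℕ} : wire t i = wire t' i' ↔ t = t' ∧ i = i' := by
  refine ⟨fun h => ?_, by rintro ⟨rfl, rfl⟩; rfl⟩
  simp only [wire] at h
  have := t.2; have := t'.2
  exact ⟨Fin.ext (by omega), by omega⟩

/-- The basis state with the given contents of the registers. -/
def asm (d : Cfg) : Mem := fun w => d.get (regOf w) (posOf w)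

theorem asm_cell (d : Cfg) (r : Reg) (i : ℕ) : asm d (cell r i) = d.get r i := by
  rw [asm, regOf_cell, posOf_cell]

theorem Cfg.get_set_self (d : Cfg) (r : Reg) (f : ℕ → Bool) : (d.set r f).get r = f := by
  cases r <;> rfl

theorem Cfg.get_set_of_ne (d : Cfg) {r r' : Reg} (h : r' ≠ r) (f : ℕ → Bool) :
    (d.set r f).get r' = d.get r' := by
  cases r <;> cases r' <;> first | rfl | exact absurd rfl h

theorem eq_asm_set {s : Mem} {d : Cfg} {r : Reg} {f : ℕ → Bool}
    (h₁ : ∀ i, s (cell r i) = f i) (h₂ : ∀ r' i, r' ≠ r → s (cell r' i) = asm d (cell r' i)) :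
    s = asm (d.set r f) := by
  ext w
  rw [← cell_regOf_posOf w]
  by_cases h : regOf w = r
  · rw [h, h₁, asm_cell, Cfg.get_set_self]
  · rw [h₂ _ _ h, asm_cell, asm_cell, Cfg.get_set_of_ne _ h]

theorem update_asm (d : Cfg) (r : Reg) (a : ℕ) (v : Bool) :
    Function.update (asm d) (cell r a) v = asm (d.set r (Function.update (d.get r) a v)) := by
  refine eq_asm_set (fun i => ?_) fun r' i h => ?_
  · by_cases hi : i = a
    · subst hi; simp
    · rw [Function.update_of_ne hi, Function.update_of_ne fun h => hi (cell_inj.1 h).2, asm_cell]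
  · rw [Function.update_of_ne fun h' => h (cell_inj.1 h').1]

theorem xorBits_asm (d : Cfg) (r : Reg) (u : ℕ → ℕ) {n : ℕ} (z : Bits n) :
    xorBits (fun j => cell r (u j)) z (asm d) = asm (d.set r (xorBits u z (d.get r))) := by
  refine eq_asm_set (fun i => ?_) fun r' i h => ?_
  · simp only [xorBits, asm_cell, cell_inj, true_and]
  · exact xorBits_of_forall_ne fun j _ h' => h (cell_inj.1 h').1.symm

theorem clearWires_asm (d : Cfg) (r : Reg) (u : ℕ → ℕ) (n : ℕ) :
    clearWires n (fun j => cell r (u j)) (asm d) =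
      asm (d.set r (clearWires n u (d.get r))) := by
  refine eq_asm_set (fun i => ?_) fun r' i h => ?_
  · simp only [clearWires, asm_cell, cell_inj, true_and]
  · rw [clearWires, if_neg]
    rintro ⟨j, -, h'⟩
    exact h (cell_inj.1 h').1.symm

/-- Replace the first `n` bits of a sequence. -/
def overwrite {n : ℕ} (x : Bits n) (f : ℕ → Bool) : ℕ → Bool :=
  fun i => if h : i < n then x ⟨i, h⟩ else f i

/-- The bit string `x`, followed by zeros. -/
def pad {n : ℕ} (x : Bits n) : ℕ → Bool := overwrite x fun _ => false

theorem writeTrack_wire (t : Fin 4) {n : ℕ} (x : Bits n) (s : Mem) (i : ℕ) :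
    writeTrack t x s (wire t i) = overwrite x (fun i => s (wire t i)) i := by
  have h₁ : wire t i % 4 = t := by have := t.2; simp only [wire]; omega
  have h₂ : wire t i / 4 = i := by have := t.2; simp only [wire]; omega
  simp only [writeTrack, overwrite, h₁, h₂, true_and]

theorem writeTrack_of_ne {t : Fin 4} {n : ℕ} (x : Bits n) (s : Mem) {w : ℕ}
    (h : ∀ i < n, wire t i ≠ w) : writeTrack t x s w = s w := by
  rw [writeTrack, dif_neg]
  rintro ⟨h₁, h₂⟩
  exact h _ h₂ (by simp only [wire]; omega)

theorem writeTrack_asm {t : Fin 4} {r : Reg} (hr : ∀ i, cell r i = wire t i) {n : ℕ} (x : Bits n)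
    (d : Cfg) : writeTrack t x (asm d) = asm (d.set r (overwrite x (d.get r))) := by
  refine eq_asm_set (fun i => ?_) fun r' i h => ?_
  · rw [hr, writeTrack_wire]
    simp only [← hr, asm_cell]
  · exact writeTrack_of_ne _ _ fun j _ h' => h (cell_inj.1 ((hr j).trans h')).1.symm

theorem readTrack_asm {t : Fin 4} {r : Reg} (hr : ∀ i, cell r i = wire t i) (n : ℕ) (d : Cfg) :
    readTrack t n (asm d) = fun i : Fin n => d.get r i := by
  funext i
  rw [readTrack, ← hr, asm_cell]

/-! ### Bit strings on tracks and registers -/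

theorem pad_apply {n : ℕ} (x : Bits n) (i : Fin n) : pad x i = x i := by
  simp [pad, overwrite]

theorem xorBits_id_zero {n : ℕ} (x : Bits n) : xorBits (fun j => j) x (fun _ => false) = pad x := by
  ext i
  by_cases h : i < n
  · have := xorBits_apply (fun _ _ h => h) x (fun _ => false) ⟨i, h⟩
    rw [this]
    simp [pad, overwrite, h]
  · rw [xorBits_of_forall_ne fun j hj h' => h (by omega)]
    simp [pad, overwrite, h]

theorem xorBits_id_pad {n : ℕ} (x : Bits n) : xorBits (fun j => j) x (pad x) = fun _ => false := by
  ext i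
  by_cases h : i < n
  · have := xorBits_apply (fun _ _ h => h) x (pad x) ⟨i, h⟩
    rw [this, pad_apply, Bool.xor_self]
  · rw [xorBits_of_forall_ne fun j hj h' => h (by omega)]
    simp [pad, overwrite, h]

theorem clearWires_id_pad {n : ℕ} (x : Bits n) :
    clearWires n (fun j => j) (pad x) = fun _ => false := by
  ext i
  by_cases h : i < n <;> simp [clearWires, pad, overwrite, h]

theorem clearWires_wire (t : Fin 4) (n : ℕ) (s : Mem) :
    clearWires n (wire t) s = clearTrack t n s := by
  ext w
  rw [clearTrack]
  by_cases h : ∃ i < n, wire t i = w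
  · obtain ⟨i, hi, rfl⟩ := h
    rw [clearWires, if_pos ⟨i, hi, rfl⟩, writeTrack_wire, overwrite, dif_pos hi]
  · rw [clearWires, if_neg h, writeTrack_of_ne]
    exact fun i hi h' => h ⟨i, hi, h'⟩

theorem xorBits_wire_wire (t : Fin 4) {n : ℕ} (x : Bits n) (s : Mem) (i : ℕ) :
    xorBits (wire t) x s (wire t i) = xor (s (wire t i)) (pad x i) := by
  by_cases h : i < n
  · have := xorBits_apply (wire_injective t) x s ⟨i, h⟩
    rw [this]
    simp [pad, overwrite, h]
  · rw [xorBits_of_forall_ne fun j hj h' => h (by rwa [← wire_injective t h'])]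
    simp [pad, overwrite, h]

theorem xorBits_wire_of_ne {t : Fin 4} (u : ℕ → ℕ) {n : ℕ} (x : Bits n) (s : Mem) {t' : Fin 4}
    (h : t' ≠ t) (i : ℕ) : xorBits (fun j => wire t (u j)) x s (wire t' i) = s (wire t' i) :=
  xorBits_of_forall_ne fun _ _ h' => h (wire_inj.1 h').1.symm

theorem writeTrack_wire_of_ne {t : Fin 4} {n : ℕ} (x : Bits n) (s : Mem) {t' : Fin 4}
    (h : t' ≠ t) (i : ℕ) : writeTrack t x s (wire t' i) = s (wire t' i) :=
  writeTrack_of_ne _ _ fun _ _ h' => h (wire_inj.1 h').1.symm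

theorem clearTrack_wire (t : Fin 4) (n : ℕ) (s : Mem) (i : ℕ) :
    clearTrack t n s (wire t i) = if i < n then false else s (wire t i) := by
  rw [clearTrack, writeTrack_wire, overwrite]
  split_ifs <;> rfl

theorem clearTrack_wire_of_ne {t t' : Fin 4} (h : t' ≠ t) (n : ℕ) (s : Mem) (i : ℕ) :
    clearTrack t n s (wire t' i) = s (wire t' i) := writeTrack_wire_of_ne _ _ h i

theorem eq_of_forall_wire {s s' : Mem} (h : ∀ t i, s (wire t i) = s' (wire t i)) : s = s' := by
  ext w
  have : wire ⟨w % 4, by omega⟩ (w / 4) = w := by simp only [wire]; omega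
  rw [← this, h]

theorem Bits.fst_pair {m n : ℕ} (x : Bits m) (y : Bits n) : (Bits.pair x y).fst = x := by
  funext i; exact Fin.append_left x y i

theorem Bits.snd_pair {m n : ℕ} (x : Bits m) (y : Bits n) : (Bits.pair x y).snd = y := by
  funext i; exact Fin.append_right x y i

/-- The concatenation of the first `a` wires of `f` with the wires `g`. -/
def seqWires (a : ℕ) (f g : ℕ → ℕ) (i : ℕ) : ℕ := if i < a then f i else g (i - a)

theorem read_seqWires (a b : ℕ) (f g : ℕ → ℕ) (s : Mem) :
    (fun i : Fin (a + b) => s (seqWires a f g i)) =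
      Bits.pair (fun i : Fin a => s (f i)) (fun i : Fin b => s (g i)) := by
  funext i
  refine Fin.addCases (fun i => ?_) (fun i => ?_) i
  · simp [Bits.pair, seqWires]
  · simp [Bits.pair, seqWires]

theorem forall_seqWires {a b : ℕ} {f g : ℕ → ℕ} {p : ℕ → Prop} (hf : ∀ i < a, p (f i))
    (hg : ∀ i < b, p (g i)) : ∀ i < a + b, p (seqWires a f g i) := by
  intro i hi
  rw [seqWires]
  split_ifs with h
  exacts [hf i h, hg _ (by omega)]

theorem UniformIndex.seqWires {a : ℕ → ℕ} (ha : UniformLength a) {f g : ℕ → ℕ → ℕ}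
    (hf : UniformIndex f) (hg : UniformIndex g) :
    UniformIndex fun κ i => seqWires (a κ) (f κ) (g κ) i :=
  .ite_lt .id ha.index hf (hg.comp (.sub .id ha.index))

/-! ### Steps of the reductions -/

/-- The linear map that sends `|s⟩⟨t|` to `|D s⟩⟨D t|` if `R s t` holds and to `0` otherwise, where
basis states are given by the contents of the registers. -/
noncomputable def cfgMap (R : Mem → Mem → Prop) (D : Mem → Cfg) : Dens →ₗ[ℂ] Dens :=
  filterMap R fun s => asm (D s)

/-- Insert a state as the memory of the simulated adversary into a reduction whose other registers
are given by `d`. -/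
noncomputable def embed (d : Cfg) : Dens →ₗ[ℂ] Dens := cfgMap (fun _ _ => True) (d.set .e)

/-- Discard the first `n` qubits of a register. -/
def resetReg (r : Reg) (n : ℕ) : List Gate :=
  (List.range n).map fun i => Gate.reset (cell r i)

theorem cfgMap_congr {R R' : Mem → Mem → Prop} {D D' : Mem → Cfg} (hR : ∀ s t, R s t ↔ R' s t)
    (hD : ∀ s, D s = D' s) : cfgMap R D = cfgMap R' D' := by
  obtain rfl : D = D' := funext hD
  exact filterMap_congr hR fun _ _ _ => ⟨rfl, rfl⟩

section Steps

variable (O : Dens →ₗ[ℂ] Dens) {R : Mem → Mem → Prop} {D : Mem → Cfg}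

theorem runList_classical {l : List Gate} (hl : ∀ g ∈ l, g.IsClassical) {D' : Mem → Cfg}
    (h : ∀ s, actList l (asm (D s)) = asm (D' s)) :
    runList O l ∘ₗ cfgMap R D = cfgMap R D' := by
  rw [runList_of_isClassical O hl, cfgMap, filterMap_comp]
  exact filterMap_congr (by simp) fun s t _ => ⟨h s, h t⟩

theorem runList_resetWires (r : Reg) (u : ℕ → ℕ) (n : ℕ) :
    runList O ((List.range n).map fun i => Gate.reset (cell r (u i))) ∘ₗ cfgMap R D =
      cfgMap (fun s t => R s t ∧ ∀ i < n, (D s).get r (u i) = (D t).get r (u i))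
        (fun s => (D s).set r (clearWires n u ((D s).get r))) := by
  rw [runList_reset O n fun i => cell r (u i), cfgMap, filterMap_comp]
  refine filterMap_congr (fun s t => ?_) fun s t _ => ?_
  · simp only [asm_cell]
  · exact ⟨clearWires_asm _ _ _ _, clearWires_asm _ _ _ _⟩

/-- Discarding a register whose contents do not depend on the basis state leaves the coherences
untouched. -/
theorem runList_resetPad (r : Reg) {n : ℕ} (x : Bits n) (h : ∀ s, (D s).get r = pad x) :
    runList O (resetReg r n) ∘ₗ cfgMap R D = cfgMap R (fun s => (D s).set r fun _ => false) := by
  rw [resetReg, runList_resetWires O r fun i => i]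
  refine filterMap_congr (fun s t => ?_) fun s t _ => ?_
  · simp [h]
  · simp only [h, clearWires_id_pad]
    exact ⟨trivial, trivial⟩

/-- Coin tosses into a register that is in the state `0`. -/
theorem runList_coins (r : Reg) (n : ℕ) (h : ∀ s, (D s).get r = fun _ => false) :
    runList O (coinGates n (cell r)) ∘ₗ cfgMap R D =
      mix fun z : Bits n => cfgMap R (fun s => (D s).set r (pad z)) := by
  have hR (f : Mem → Mem) : filterMap R f =
      filterMap (fun _ _ => True) f ∘ₗ filterMap R fun s => s := by
    rw [filterMap_comp]
    exact filterMap_congr (by simp) fun _ _ _ => ⟨rfl, rfl⟩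
  rw [cfgMap, hR, ← LinearMap.comp_assoc, runList_coinGates O n _ (cell_injective r), mix_comp]
  · congr 1
    funext z
    rw [filterMap_comp]
    refine filterMap_congr (by simp) fun s t _ => ?_
    have (s : Mem) : xorBits (cell r) z (asm (D s)) = asm ((D s).set r (pad z)) := by
      rw [← xorBits_id_zero, ← h s]
      exact xorBits_asm _ _ (fun j => j) z
    exact ⟨this s, this t⟩
  · intro s i _
    rw [asm_cell, h]

/-- Reversible evaluation of a circuit, with the result added to a register. -/
theorem actList_xorGates_asm (C : BoolCircuits) (κ : ℕ) {m k : ℕ} {src : ℕ → ℕ} {r : Reg}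
    {u : ℕ → ℕ} (hu : Function.Injective u) (hr : r ≠ .work)
    (hsrc : ∀ i < m, ∀ j, src i ≠ cell .work j) (hdst : ∀ i < m, ∀ j < k, src i ≠ cell r (u j))
    {d : Cfg} (hd : d.work = fun _ => false) :
    actList (C.xorGates κ m k src (cell .work) fun j => cell r (u j)) (asm d) =
      asm (d.set r (xorBits u (C.eval κ (fun i : Fin m => asm d (src i)) : Bits k) (d.get r))) := by
  rw [C.actList_xorGates κ (cell_injective _) hsrc (cell_comp_injective r hu), xorBits_asm]
  · exact fun j _ w h => hr (cell_inj.1 h).1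
  · exact fun j hj i hi h => hdst i hi j hj h.symm
  · intro w
    rw [asm_cell]
    exact congrFun hd w

theorem actList_copyGates_asm {k : ℕ} {r r' : Reg} {u v : ℕ → ℕ} (hu : Function.Injective u)
    (h : ∀ i j, cell r (u j) ≠ cell r' (v i)) (d : Cfg) :
    actList (copyGates k (fun j => cell r' (v j)) fun j => cell r (u j)) (asm d) =
      asm (d.set r (xorBits u (fun j : Fin k => d.get r' (v j)) (d.get r))) := by
  rw [actList_copyGates (cell_comp_injective r hu) fun i _ j _ => h i j, xorBits_asm]
  simp only [asm_cell]

/-! ### The simulation -/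

variable (d : Cfg)

theorem embed_single (s t : Mem) (a : ℂ) : embed d (Finsupp.single (s, t) a) =
    Finsupp.single (asm (d.set .e s), asm (d.set .e t)) a := by
  rw [embed, cfgMap, filterMap_single, if_pos trivial]

theorem update_asm_e (s : Mem) (a : ℕ) (v : Bool) :
    Function.update (asm (d.set .e s)) (cell .e a) v =
      asm (d.set .e (Function.update s a v)) :=
  update_asm _ _ _ _

theorem asm_set_e (s : Mem) (a : ℕ) : asm (d.set .e s) (cell .e a) = s a := asm_cell _ _ _

theorem act_mapWires (g : Gate) (s : Mem) : (g.mapWires (cell .e)).act (asm (d.set .e s)) =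
    asm (d.set .e (g.act s)) := by
  cases g <;> simp only [Gate.mapWires, Gate.act, asm_set_e, update_asm_e, cell_inj, true_and,
    apply_ite (fun s => asm (d.set .e s))]

/-- Elementary gates commute with the insertion of the memory of the simulated adversary. -/
theorem channel_mapWires (O' : Dens →ₗ[ℂ] Dens) {g : Gate} (hg : g.isQuery = false) :
    (g.mapWires (cell .e)).channel O ∘ₗ embed d = embed d ∘ₗ g.channel O' := by
  by_cases hc : g.IsClassical
  · have hc' : (g.mapWires (cell .e)).IsClassical := by
      cases g <;> trivial
    rw [Gate.channel_of_isClassical _ hc, Gate.channel_of_isClassical _ hc', embed, cfgMap,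
      filterMap_comp, filterMap_comp]
    exact filterMap_congr (by simp) fun s t _ => ⟨act_mapWires d g s, act_mapWires d g t⟩
  cases g with
  | h a =>
    refine Dens.hom_ext fun s t => ?_
    simp only [Gate.mapWires, Gate.channel, LinearMap.comp_apply, embed_single, conjugate_single,
      ketBra_add_left, ketBra_add_right, ketBra_single, one_smul, map_add, update_asm_e, asm_set_e]
  | t a =>
    refine Dens.hom_ext fun s t => ?_
    simp only [Gate.mapWires, Gate.channel, LinearMap.comp_apply, embed_single, conjugate_single,
      ketBra_single, one_smul, asm_set_e]
  | measure a =>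
    simp only [Gate.mapWires, Gate.channel_measure, embed, cfgMap, filterMap_comp]
    exact filterMap_congr (by simp [asm_set_e]) fun s t _ => ⟨rfl, rfl⟩
  | reset a =>
    simp only [Gate.mapWires, Gate.channel_reset, embed, cfgMap, filterMap_comp]
    exact filterMap_congr (by simp [asm_set_e]) fun s t _ =>
      ⟨update_asm_e d s a _, update_asm_e d t a _⟩
  | query => simp [Gate.isQuery] at hg
  | _ => exact absurd trivial hc

theorem runList_replicate_skip (n : ℕ) : runList O (List.replicate n .skip) = LinearMap.id := by
  induction n with
  | zero => rfl
  | succ n ih => rw [List.replicate_succ, runList, ih]; rfl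

/-- If the circuit `Q` simulates the oracle `O'`, then the reduction simulates the adversary. -/
theorem runList_simulate (O' : Dens →ₗ[ℂ] Dens) {Q : List Gate}
    (hQ : runList O Q ∘ₗ embed d = embed d ∘ₗ O') (l : List Gate) :
    runList O (l.flatMap (Gate.simulate (cell .e) Q)) ∘ₗ embed d =
      embed d ∘ₗ runList O' l := by
  induction l with
  | nil => rfl
  | cons g l ih =>
    rw [List.flatMap_cons, runList_append, LinearMap.comp_assoc, runList,
      ← LinearMap.comp_assoc _ _ (embed d), ← ih, LinearMap.comp_assoc]
    congr 1
    rw [Gate.simulate, runList]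
    cases hg : g.isQuery
    · rw [if_neg (by simp), runList_replicate_skip, LinearMap.id_comp, channel_mapWires _ _ _ hg]
    · rw [if_pos rfl]
      cases g <;> first | exact hQ | simp [Gate.isQuery] at hg

theorem trace_embed (ρ : Dens) : trace (embed d ρ) = trace ρ := by
  rw [← LinearMap.comp_apply, embed, cfgMap, trace_comp_filterMap _ _ (fun _ => trivial)]
  intro s t _ h
  ext a
  rw [← asm_set_e d s a, h, asm_set_e]

end Steps

/-! ### Simulating the encryption oracle of the hybrid scheme -/

/-- Boolean circuits for the algorithms of the two schemes that the reductions run. -/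
structure SchemeCircuits (S : SKE) (P : PKE S.keyLen) where
  kgenS : BoolCircuits
  encS : BoolCircuits
  decS : BoolCircuits
  kgenP : BoolCircuits
  encP : BoolCircuits
  kgenS_eval : ∀ κ z, kgenS.eval κ z = S.kgen κ z
  encS_eval : ∀ κ k m z, encS.eval κ (Bits.pair k (Bits.pair m z)) = S.enc κ k m z
  decS_eval : ∀ κ k c, decS.eval κ (Bits.pair k c) = S.dec κ k c
  kgenP_eval : ∀ κ z, kgenP.eval κ z = (P.kgen κ z).1
  encP_eval : ∀ κ pk m z, encP.eval κ (Bits.pair pk (Bits.pair m z)) = P.enc κ pk m z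

theorem SchemeCircuits.nonempty {S : SKE} {P : PKE S.keyLen} (hS : S.Efficient)
    (hP : P.Efficient) : Nonempty (SchemeCircuits S P) := by
  obtain ⟨kgenS, h₁⟩ := hS.kgen_efficient
  obtain ⟨encS, h₂⟩ := hS.enc_efficient
  obtain ⟨decS, h₃⟩ := hS.dec_efficient
  obtain ⟨kgenP, h₄⟩ := hP.kgen_efficient
  obtain ⟨encP, h₅⟩ := hP.enc_efficient
  refine ⟨⟨kgenS, encS, decS, kgenP, encP, h₁, fun κ k m z => ?_, fun κ k c => ?_,
    fun κ z => ?_, fun κ pk m z => ?_⟩⟩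
  · rw [h₂]; beta_reduce; rw [Bits.fst_pair, Bits.snd_pair, Bits.fst_pair, Bits.snd_pair]
  · rw [h₃]; beta_reduce; rw [Bits.fst_pair, Bits.snd_pair]
  · rw [← Bits.fst_pair (P.kgen κ z).1 (P.kgen κ z).2]
    exact congrArg Bits.fst (h₄ κ z)
  · rw [h₅]; beta_reduce; rw [Bits.fst_pair, Bits.snd_pair, Bits.fst_pair, Bits.snd_pair]

/-- Encryption in the hybrid scheme, with the lengths of the bit strings unfolded. -/
def hybridEnc (S : SKE) (P : PKE S.keyLen) (κ : ℕ) (pk : Bits (P.pkLen κ))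
    (m : Bits (S.msgLen κ)) (z : Bits (S.kgenRand κ + (S.encRand κ + P.encRand κ))) :
    Bits (S.ctxtLen κ + P.ctxtLen κ) := (hybrid S P).enc κ pk m z

theorem hybridEnc_pair (S : SKE) (P : PKE S.keyLen) (κ : ℕ) (pk : Bits (P.pkLen κ))
    (m : Bits (S.msgLen κ)) (z₁ : Bits (S.kgenRand κ)) (z₂ : Bits (S.encRand κ))
    (z₃ : Bits (P.encRand κ)) : hybridEnc S P κ pk m (Bits.pair z₁ (Bits.pair z₂ z₃)) =
      Bits.pair (S.enc κ (S.kgen κ z₁) m z₂) (P.enc κ pk (S.kgen κ z₁) z₃) := by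
  simp only [hybridEnc, hybrid, Bits.fst_pair, Bits.snd_pair]

/-- Discard the first `n` qubits of track `t` of the simulated adversary. -/
def resetTrack (t : Fin 4) (n : ℕ) : List Gate :=
  (List.range n).map fun i => Gate.reset (cell .e (wire t i))

theorem runList_append_comp (O : Dens →ₗ[ℂ] Dens) (l l' : List Gate) (X : Dens →ₗ[ℂ] Dens) :
    runList O (l ++ l') ∘ₗ X = runList O l' ∘ₗ (runList O l ∘ₗ X) := by
  rw [runList_append, LinearMap.comp_assoc]

theorem runList_resetTrack (O : Dens →ₗ[ℂ] Dens) {R : Mem → Mem → Prop} {D : Mem → Cfg}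
    (t : Fin 4) (n : ℕ) :
    runList O (resetTrack t n) ∘ₗ cfgMap R D =
      cfgMap (fun s s' => R s s' ∧ readTrack t n (D s).e = readTrack t n (D s').e)
        (fun s => (D s).set .e (clearTrack t n (D s).e)) := by
  rw [resetTrack, runList_resetWires]
  refine filterMap_congr (fun s s' => and_congr_right fun _ => ?_) fun s s' _ => ?_
  · rw [funext_iff, Fin.forall_iff]
    rfl
  · simp only [clearWires_wire, Cfg.get, true_and]

/-- The contents of the memory after an encryption has been added to track 3. -/
theorem xorBits_pair {a b n : ℕ} {t : Fin 4} (ht : t ≠ 3) (x : Bits a) (y : Bits b) {s : Mem}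
    (hs : ∀ i < a + b, s (wire 3 i) = false) :
    xorBits (fun j => wire 3 (a + j)) y (clearTrack t n (xorBits (wire 3) x s)) =
      writeTrack 3 (Bits.pair x y) (clearTrack t n s) := by
  refine eq_of_forall_wire fun t' i => ?_
  by_cases h3 : t' = 3
  · subst h3
    rw [writeTrack_wire]
    by_cases hi : i < a
    · rw [xorBits_of_forall_ne fun j _ h => by have := wire_injective 3 h; omega,
        clearTrack_wire_of_ne ht.symm, xorBits_wire_wire, hs i (by omega), Bool.false_xor]
      simp only [pad, overwrite, hi, show i < a + b by omega, dif_pos]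
      exact (Fin.append_left x y ⟨i, hi⟩).symm
    · by_cases hi' : i < a + b
      · obtain ⟨j, rfl⟩ : ∃ j : Fin b, i = a + j := ⟨⟨i - a, by omega⟩, by simp; omega⟩
        rw [xorBits_apply (wire_offset_injective 3 a) y _ j, clearTrack_wire_of_ne ht.symm,
          xorBits_wire_wire, hs _ hi', overwrite, dif_pos hi', pad, overwrite, dif_neg hi]
        simp only [Bool.false_xor]
        exact (Fin.append_right x y j).symm
      · rw [xorBits_of_forall_ne fun j hj h => by have := wire_injective 3 h; omega,
          clearTrack_wire_of_ne ht.symm, xorBits_wire_wire, overwrite, dif_neg hi',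
          clearTrack_wire_of_ne ht.symm, pad, overwrite, dif_neg hi, Bool.xor_false]
  · have h (s : Mem) : xorBits (wire 3) x s (wire t' i) = s (wire t' i) :=
      xorBits_wire_of_ne (fun j => j) _ _ h3 i
    rw [xorBits_wire_of_ne _ _ _ h3, writeTrack_wire_of_ne _ _ h3]
    by_cases htt : t' = t
    · subst htt
      rw [clearTrack_wire, clearTrack_wire, h]
    · rw [clearTrack_wire_of_ne htt, clearTrack_wire_of_ne htt, h]

theorem xorBits_readTrack (t : Fin 4) (n : ℕ) (s : Mem) :
    xorBits (wire t) (readTrack t n s) s = clearTrack t n s := by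
  refine eq_of_forall_wire fun t' i => ?_
  by_cases h : t' = t
  · subst h
    rw [xorBits_wire_wire, clearTrack_wire]
    by_cases hi : i < n <;> simp [pad, overwrite, readTrack, hi]
  · rw [clearTrack_wire_of_ne h]
    exact xorBits_wire_of_ne (fun j => j) _ _ h i

theorem restrict_of_eq_pad {n : ℕ} {f : ℕ → Bool} {x : Bits n} (h : f = pad x) :
    (fun i : Fin n => f i) = x := by
  subst h; funext i; exact pad_apply x i

theorem read_cell {n : ℕ} {d : Cfg} {r : Reg} {x : Bits n} (h : d.get r = pad x) :
    (fun i : Fin n => asm d (cell r i)) = x := by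
  simp only [asm_cell]
  exact restrict_of_eq_pad h

theorem cell_ne {r r' : Reg} (h : r ≠ r') (i j : ℕ) : cell r i ≠ cell r' j :=
  fun h' => h (cell_inj.1 h').1

namespace SchemeCircuits

variable {S : SKE} {P : PKE S.keyLen} (c : SchemeCircuits S P) (κ : ℕ)

/-- Add the symmetric key with the randomness in register `r1` to the register `r`. -/
def keyGates (r : Reg) : List Gate :=
  c.kgenS.xorGates κ (S.kgenRand κ) (S.keyLen κ) (cell .r1) (cell .work) fun j => cell r j

/-- Replace the message on track 1 of the simulated adversary by its symmetric encryption on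
track 3, with the key in register `r` and the randomness in register `r2`. Decrypting the
ciphertext erases the message. -/
def sealGates (r : Reg) : List Gate :=
  c.encS.xorGates κ (S.keyLen κ + (S.msgLen κ + S.encRand κ)) (S.ctxtLen κ)
      (seqWires (S.keyLen κ) (cell r)
        (seqWires (S.msgLen κ) (fun j => cell .e (wire 1 j)) (cell .r2)))
      (cell .work) (fun j => cell .e (wire 3 j)) ++
    c.decS.xorGates κ (S.keyLen κ + S.ctxtLen κ) (S.msgLen κ)
      (seqWires (S.keyLen κ) (cell r) fun j => cell .e (wire 3 j))
      (cell .work) (fun j => cell .e (wire 1 j))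

/-- Add the public key encryption of register `r`, with the randomness in register `r3`, to
track 3 of the simulated adversary, behind the symmetric ciphertext. -/
def encapsGates (r : Reg) : List Gate :=
  c.encP.xorGates κ (P.pkLen κ + (S.keyLen κ + P.encRand κ)) (P.ctxtLen κ)
    (seqWires (P.pkLen κ) (cell .pk) (seqWires (S.keyLen κ) (cell r) (cell .r3)))
    (cell .work) fun j => cell .e (wire 3 (S.ctxtLen κ + j))

/-- The simulation of the encryption oracle of the hybrid scheme. The symmetric key is computed a
second time to return the register `k` to the state `0`. -/
def queryGates : List Gate :=
  resetTrack 3 (S.ctxtLen κ + P.ctxtLen κ) ++ (coinGates (S.kgenRand κ) (cell .r1) ++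
    (coinGates (S.encRand κ) (cell .r2) ++ (coinGates (P.encRand κ) (cell .r3) ++
      ((c.keyGates κ .k ++ (c.sealGates κ .k ++ (c.encapsGates κ .k ++ c.keyGates κ .k))) ++
        (resetReg .r1 (S.kgenRand κ) ++ (resetReg .r2 (S.encRand κ) ++
          resetReg .r3 (P.encRand κ)))))))

variable {c κ}

theorem act_keyGates {r : Reg} (h₁ : r ≠ .work) (h₂ : r ≠ .r1) {d : Cfg}
    {z : Bits (S.kgenRand κ)} (hz : d.r1 = pad z) (hd : d.work = fun _ => false) :
    actList (c.keyGates κ r) (asm d) =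
      asm (d.set r (xorBits (fun j => j) (S.kgen κ z) (d.get r))) := by
  rw [keyGates, actList_xorGates_asm c.kgenS κ (u := fun j => j) (fun _ _ h => h) h₁
    (fun i _ j => cell_ne (by simp) _ _) (fun i _ j _ => cell_ne h₂.symm _ _) hd,
    read_cell (r := .r1) hz, c.kgenS_eval]

/-- By perfect correctness, the decryption circuit adds to the message register the message itself. -/
theorem act_sealGates (hcorrect : S.PerfectlyCorrect) {r : Reg} (h₁ : r ≠ .work) (h₂ : r ≠ .e)
    {d : Cfg} {z₁ : Bits (S.kgenRand κ)} {z₂ : Bits (S.encRand κ)}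
    (hk : d.get r = pad (S.kgen κ z₁)) (hz : d.r2 = pad z₂) (hd : d.work = fun _ => false)
    (hzero : ∀ i < S.ctxtLen κ, d.e (wire 3 i) = false) :
    actList (c.sealGates κ r) (asm d) =
      asm (d.set .e (clearTrack 1 (S.msgLen κ)
        (xorBits (wire 3) (S.enc κ (S.kgen κ z₁) (readTrack 1 (S.msgLen κ) d.e) z₂) d.e))) := by
  rw [sealGates, actList_append, actList_xorGates_asm c.encS κ (wire_injective 3) (by simp) _ _ hd,
    read_seqWires, read_seqWires, read_cell hk, read_cell (r := .r2) hz]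
  rotate_left
  · exact forall_seqWires (p := fun w => ∀ j, w ≠ cell .work j) (fun i _ j => cell_ne h₁ _ _)
      (forall_seqWires (p := fun w => ∀ j, w ≠ cell .work j)
        (fun i _ j => cell_ne (by simp) _ _) fun i _ j => cell_ne (by simp) _ _)
  · refine forall_seqWires (p := fun w => ∀ j < S.ctxtLen κ, w ≠ cell .e (wire 3 j))
      (fun i _ j _ => cell_ne h₂ _ _)
      (forall_seqWires (p := fun w => ∀ j < S.ctxtLen κ, w ≠ cell .e (wire 3 j))
        (fun i _ j _ h => ?_) fun i _ j _ => cell_ne (by simp) _ _)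
    exact absurd (wire_inj.1 (cell_inj.1 h).2).1 (by decide)
  have hm : (fun i : Fin (S.msgLen κ) => asm d (cell .e (wire 1 i))) =
      readTrack 1 (S.msgLen κ) d.e := by
    funext i; exact asm_cell _ _ _
  rw [hm, c.encS_eval]
  set x := S.enc κ (S.kgen κ z₁) (readTrack 1 (S.msgLen κ) d.e) z₂ with hx
  set d' := d.set .e (xorBits (wire 3) x (d.get .e)) with hd'
  have hk' : d'.get r = pad (S.kgen κ z₁) := by rw [hd', Cfg.get_set_of_ne _ h₂, hk]
  have hc : (fun i : Fin (S.ctxtLen κ) => asm d' (cell .e (wire 3 i))) = x := by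
    funext i
    rw [asm_cell, hd', Cfg.get_set_self, xorBits_wire_wire, pad_apply]
    exact (congrArg (xor · (x i)) (hzero i i.2)).trans (Bool.false_xor _)
  rw [actList_xorGates_asm c.decS κ (d := d') (wire_injective 1) (by simp) _ _ hd, read_seqWires,
    read_cell hk', hc, c.decS_eval, hx, hcorrect, hd', Cfg.get_set_self]
  · have : readTrack 1 (S.msgLen κ) d.e =
        readTrack 1 (S.msgLen κ) (xorBits (wire 3) x (d.get .e)) := by
      funext i
      exact (xorBits_wire_of_ne (fun j => j) x d.e (by decide) i).symm
    rw [← hx, this, xorBits_readTrack]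
    rfl
  · exact forall_seqWires (p := fun w => ∀ j, w ≠ cell .work j) (fun i _ j => cell_ne h₁ _ _)
      fun i _ j => cell_ne (by simp) _ _
  · refine forall_seqWires (p := fun w => ∀ j < S.msgLen κ, w ≠ cell .e (wire 1 j))
      (fun i _ j _ => cell_ne h₂ _ _) fun i _ j _ h => ?_
    exact absurd (wire_inj.1 (cell_inj.1 h).2).1 (by decide)

theorem act_encapsGates {r : Reg} (h₁ : r ≠ .work) (h₂ : r ≠ .e) {d : Cfg}
    {pk : Bits (P.pkLen κ)} {k : Bits (S.keyLen κ)} {z : Bits (P.encRand κ)}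
    (hpk : d.pk = pad pk) (hk : d.get r = pad k) (hz : d.r3 = pad z)
    (hd : d.work = fun _ => false) :
    actList (c.encapsGates κ r) (asm d) =
      asm (d.set .e (xorBits (fun j => wire 3 (S.ctxtLen κ + j)) (P.enc κ pk k z) d.e)) := by
  rw [encapsGates, actList_xorGates_asm c.encP κ (wire_offset_injective 3 _) (by simp) _ _ hd,
    read_seqWires, read_seqWires, read_cell (r := .pk) hpk, read_cell hk, read_cell (r := .r3) hz,
    c.encP_eval]
  · rfl
  · exact forall_seqWires (p := fun w => ∀ j, w ≠ cell .work j)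
      (fun i _ j => cell_ne (by simp) _ _)
      (forall_seqWires (p := fun w => ∀ j, w ≠ cell .work j)
        (fun i _ j => cell_ne h₁ _ _) fun i _ j => cell_ne (by simp) _ _)
  · exact forall_seqWires
      (p := fun w => ∀ j < P.ctxtLen κ, w ≠ cell .e (wire 3 (S.ctxtLen κ + j)))
      (fun i _ j _ => cell_ne (by simp) _ _)
      (forall_seqWires (p := fun w => ∀ j < P.ctxtLen κ, w ≠ cell .e (wire 3 (S.ctxtLen κ + j)))
        (fun i _ j _ => cell_ne h₂ _ _) fun i _ j _ => cell_ne (by simp) _ _)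

theorem isClassical_keyGates {r : Reg} : ∀ g ∈ c.keyGates κ r, g.IsClassical :=
  BoolCircuits.isClassical_xorGates

theorem isClassical_sealGates {r : Reg} : ∀ g ∈ c.sealGates κ r, g.IsClassical :=
  List.forall_mem_append.2
    ⟨BoolCircuits.isClassical_xorGates, BoolCircuits.isClassical_xorGates⟩

theorem isClassical_encapsGates {r : Reg} : ∀ g ∈ c.encapsGates κ r, g.IsClassical :=
  BoolCircuits.isClassical_xorGates

/-- Registers in the state in which the simulation keeps them between oracle calls. -/
structure Ready (pk : Bits (P.pkLen κ)) (d : Cfg) : Prop where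
  pk : d.pk = pad pk
  k : d.k = fun _ => false
  r1 : d.r1 = fun _ => false
  r2 : d.r2 = fun _ => false
  r3 : d.r3 = fun _ => false
  work : d.work = fun _ => false

theorem embed_comp_filterMap (d : Cfg) (R : Mem → Mem → Prop) (f : Mem → Mem) :
    embed d ∘ₗ filterMap R f = cfgMap R fun s => d.set .e (f s) := by
  rw [embed, cfgMap, filterMap_comp]
  exact filterMap_congr (by simp) fun _ _ _ => ⟨rfl, rfl⟩

theorem clearTrack_wire_of_lt {n : ℕ} {t : Fin 4} (s : Mem) {i : ℕ} (hi : i < n) :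
    clearTrack t n s (wire t i) = false := by
  rw [clearTrack_wire, if_pos hi]

/-- On the memory of the simulated adversary, the gates `queryGates` act as the type-2 encryption oracle
of the hybrid scheme, and they restore all other registers. For each choice of the coins the
computation is classical and reversible, so that no information about the message remains outside
the memory of the adversary. -/
theorem runList_queryGates (hcorrect : S.PerfectlyCorrect) (O : Dens →ₗ[ℂ] Dens)
    {pk : Bits (P.pkLen κ)} {d : Cfg} (hd : Ready pk d) :
    runList O (c.queryGates κ) ∘ₗ embed d =
      embed d ∘ₗ type2Oracle 1 (hybridEnc S P κ pk) := by
  obtain ⟨de, dpk, dk, dr1, dr2, dr3, dbeta, dwork, dt1, dt2, dt3⟩ := d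
  obtain ⟨rfl, rfl, rfl, rfl, rfl, rfl⟩ := hd
  rw [type2Oracle_eq, comp_mix, mix_pair]
  rw [queryGates, runList_append_comp, embed, runList_resetTrack, runList_append_comp,
    runList_coins O .r1 _ fun _ => rfl, comp_mix]
  congr 1; funext z₁
  rw [mix_pair, runList_append_comp, runList_coins O .r2 _ fun _ => rfl, comp_mix]
  congr 1; funext z₂
  rw [runList_append_comp, runList_coins O .r3 _ fun _ => rfl, comp_mix]
  congr 1; funext z₃
  rw [runList_append_comp, runList_classical O (List.forall_mem_append.2 ⟨isClassical_keyGates,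
    List.forall_mem_append.2 ⟨isClassical_sealGates,
      List.forall_mem_append.2 ⟨isClassical_encapsGates, isClassical_keyGates⟩⟩⟩)
    (D' := fun s => ⟨writeTrack 3
      (hybridEnc S P κ pk (readTrack 1 (S.msgLen κ)
        (clearTrack 3 (S.ctxtLen κ + P.ctxtLen κ) s))
        (Bits.pair z₁ (Bits.pair z₂ z₃)))
      (clearTrack 1 (S.msgLen κ)
        (clearTrack 3 (S.ctxtLen κ + P.ctxtLen κ) s)),
      pad pk, fun _ => false, pad z₁, pad z₂, pad z₃, dbeta, fun _ => false, dt1, dt2, dt3⟩)]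
  · rw [runList_append_comp, runList_resetPad O .r1 z₁ fun _ => rfl,
      runList_append_comp, runList_resetPad O .r2 z₂ fun _ => rfl,
      runList_resetPad O .r3 z₃ fun _ => rfl, ← embed, embed_comp_filterMap]
    exact filterMap_congr (fun _ _ => iff_of_eq (true_and _)) fun _ _ _ => ⟨rfl, rfl⟩
  · intro s
    rw [actList_append, act_keyGates (r := .k) (by simp) (by simp) (z := z₁) rfl rfl,
      actList_append]
    simp only [Cfg.set, Cfg.get, xorBits_id_zero]
    rw [act_sealGates hcorrect (r := .k) (z₁ := z₁) (z₂ := z₂) (by simp) (by simp) rfl rfl rfl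
        (fun i hi => clearTrack_wire_of_lt (n := S.ctxtLen κ + P.ctxtLen κ) _ (by omega)),
      actList_append]
    simp only [Cfg.set]
    rw [act_encapsGates (r := .k) (pk := pk) (k := S.kgen κ z₁) (z := z₃) (by simp) (by simp) rfl
        rfl rfl rfl]
    simp only [Cfg.set]
    rw [act_keyGates (r := .k) (by simp) (by simp) (z := z₁) rfl rfl]
    simp only [Cfg.set, Cfg.get, xorBits_id_pad]
    rw [xorBits_pair (t := 1) (by decide) _ _
      fun i hi => clearTrack_wire_of_lt (n := S.ctxtLen κ + P.ctxtLen κ) _ hi]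
    rw [hybridEnc_pair]

end SchemeCircuits

/-! ### The challenge of the hybrid scheme -/

theorem readTrack_clearTrack {t t' : Fin 4} (h : t ≠ t') (n m : ℕ) (s : Mem) :
    readTrack t m (clearTrack t' n s) = readTrack t m s := by
  funext i
  exact clearTrack_wire_of_ne h n s i

theorem clearTrack_comm {t t' : Fin 4} (h : t ≠ t') (n m : ℕ) (s : Mem) :
    clearTrack t n (clearTrack t' m s) = clearTrack t' m (clearTrack t n s) := by
  refine eq_of_forall_wire fun u i => ?_
  by_cases h₁ : u = t
  · subst h₁
    rw [clearTrack_wire, clearTrack_wire_of_ne h, clearTrack_wire_of_ne h, clearTrack_wire]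
  · rw [clearTrack_wire_of_ne h₁]
    by_cases h₂ : u = t'
    · subst h₂
      rw [clearTrack_wire, clearTrack_wire, clearTrack_wire_of_ne h₁]
    · rw [clearTrack_wire_of_ne h₂, clearTrack_wire_of_ne h₂, clearTrack_wire_of_ne h₁]

/-- The challenge with message `β` in which the first part of the ciphertext is computed by `x` and
the second part is the constant `y`. The messages are consumed and track 3 is discarded. -/
noncomputable def fixedChallenge (β : Bool) {m a b : ℕ} (x : Bits m → Bits a) (y : Bits b) :
    Dens →ₗ[ℂ] Dens :=
  filterMap (fun s s' => readTrack (msgTrack !β) m s = readTrack (msgTrack !β) m s' ∧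
      readTrack 3 (a + b) s = readTrack 3 (a + b) s')
    fun s => writeTrack 3 (Bits.pair (x (readTrack (msgTrack β) m s)) y)
      (clearTrack 1 m (clearTrack 3 (a + b) (clearTrack 2 m s)))

theorem quantumChallenge_eq (β : Bool) {m r c : ℕ} (enc : Bits m → Bits r → Bits c) :
    quantumChallenge β enc = mix fun z => filterMap
      (fun s s' => readTrack (msgTrack !β) m s = readTrack (msgTrack !β) m s' ∧
        readTrack 3 c s = readTrack 3 c s')
      fun s => writeTrack 3 (enc (readTrack (msgTrack β) m s) z)
        (clearTrack 1 m (clearTrack 3 c (clearTrack 2 m s))) := by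
  rw [quantumChallenge, type2Oracle_eq, mix_comp]
  congr 1; funext z
  rw [discardTrack_eq, filterMap_comp]
  have h₁ : msgTrack β ≠ 3 := by cases β <;> decide
  have h₂ : (3 : Fin 4) ≠ msgTrack !β := by cases β <;> decide
  have h₃ : msgTrack β ≠ msgTrack !β := by cases β <;> decide
  have key (s : Mem) : clearTrack (msgTrack β) m (clearTrack 3 c (clearTrack (msgTrack !β) m s)) =
      clearTrack 1 m (clearTrack 3 c (clearTrack 2 m s)) := by
    cases β
    · rfl
    · change clearTrack 2 _ (clearTrack 3 _ (clearTrack 1 _ s)) = _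
      rw [clearTrack_comm (t := 3) (t' := 1) (by decide),
        clearTrack_comm (t := 2) (t' := 1) (by decide),
        clearTrack_comm (t := 2) (t' := 3) (by decide)]
  refine filterMap_congr (fun s s' => and_congr_right fun _ => ?_) fun s s' _ => ?_
  · rw [readTrack_clearTrack h₂, readTrack_clearTrack h₂]
  · simp only [Function.comp, key, readTrack_clearTrack h₁, readTrack_clearTrack h₃, and_self]

/-- The challenge ciphertext of the hybrid scheme is a mixture of challenges in which only the first
part depends on the message. -/
theorem quantumChallenge_hybridEnc (S : SKE) (P : PKE S.keyLen) (κ : ℕ) (pk : Bits (P.pkLen κ))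
    (β : Bool) : quantumChallenge β (hybridEnc S P κ pk) =
      mix fun z₁ => mix fun z₂ => mix fun z₃ =>
        fixedChallenge β (fun m => S.enc κ (S.kgen κ z₁) m z₂)
          (P.enc κ pk (S.kgen κ z₁) z₃) := by
  rw [quantumChallenge_eq, mix_pair]
  congr 1; funext z₁
  rw [mix_pair]
  simp only [hybridEnc_pair, fixedChallenge]

/-! ### The parts of the reductions -/

/-- The registers of a reduction outside its calls to the encryption oracle. -/
def baseCfg {n : ℕ} (pk : Bits n) (beta t1 t3 : ℕ → Bool) : Cfg where
  e _ := false
  pk := pad pk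
  k _ := false
  r1 _ := false
  r2 _ := false
  r3 _ := false
  beta := beta
  work _ := false
  t1 := t1
  t2 _ := false
  t3 := t3

/-- All registers are in the state `0`. -/
def zeroCfg : Cfg where
  e _ := false
  pk _ := false
  k _ := false
  r1 _ := false
  r2 _ := false
  r3 _ := false
  beta _ := false
  work _ := false
  t1 _ := false
  t2 _ := false
  t3 _ := false

theorem asm_zeroCfg : asm zeroCfg = fun _ => false := by
  ext w
  rw [asm]
  cases regOf w <;> rfl

/-- The state `|0⟩⟨0|`. -/
noncomputable def zeroState : Dens := Finsupp.single (fun _ => false, fun _ => false) 1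

theorem cfgMap_zeroState (d : Cfg) :
    cfgMap (fun _ _ => True) (fun _ => d) zeroState = Finsupp.single (asm d, asm d) 1 := by
  rw [cfgMap, zeroState, filterMap_single, if_pos trivial]

theorem initialState_eq {n : ℕ} (x : Bits n) : initialState x =
    cfgMap (fun _ _ => True) (fun _ => zeroCfg.set .t3 (pad x)) zeroState := by
  rw [cfgMap_zeroState, initialState, ← asm_zeroCfg,
    writeTrack_asm (t := 3) (r := .t3) fun _ => rfl]
  rfl

theorem embed_initialState {n : ℕ} (d : Cfg) (x : Bits n) : embed d (initialState x) =
    cfgMap (fun _ _ => True) (fun _ => d.set .e (writeTrack 3 x fun _ => false)) zeroState := by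
  rw [cfgMap_zeroState, initialState, embed_single]

theorem xorBits_wire_zero {n : ℕ} (t : Fin 4) (x : Bits n) :
    xorBits (wire t) x (fun _ => false) = writeTrack t x fun _ => false := by
  refine eq_of_forall_wire fun t' i => ?_
  by_cases h : t' = t
  · subst h
    rw [xorBits_wire_wire, writeTrack_wire, Bool.false_xor, pad]
  · rw [writeTrack_wire_of_ne _ _ h]
    exact xorBits_wire_of_ne (fun j => j) _ _ h i

/-- Move the public key from track 3 to the register `pk` and to track 3 of the simulated
adversary. -/
def receiveGates (n : ℕ) : List Gate :=
  copyGates n (fun j => cell .t3 j) (fun j => cell .pk j) ++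
    (copyGates n (fun j => cell .pk j) (fun j => cell .e (wire 3 j)) ++
      copyGates n (fun j => cell .pk j) (fun j => cell .t3 j))

theorem runList_receiveGates (O : Dens →ₗ[ℂ] Dens) {n : ℕ} (pk : Bits n) :
    runList O (receiveGates n) (initialState pk) =
      embed (baseCfg pk (fun _ => false) (fun _ => false) fun _ => false) (initialState pk) := by
  rw [embed_initialState, initialState_eq, ← LinearMap.comp_apply, receiveGates]
  congr 1
  refine runList_classical O (List.forall_mem_append.2 ⟨isClassical_copyGates,
    List.forall_mem_append.2 ⟨isClassical_copyGates, isClassical_copyGates⟩⟩) fun _ => ?_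
  rw [actList_append, actList_append,
    actList_copyGates_asm (u := fun j => j) (v := fun j => j) (fun _ _ h => h)
      (fun _ _ => cell_ne (by simp) _ _)]
  simp only [zeroCfg, Cfg.set, Cfg.get, pad_apply, xorBits_id_zero]
  rw [actList_copyGates_asm (r := .e) (u := wire 3) (v := fun j => j) (wire_injective 3)
      (fun _ _ => cell_ne (by simp) _ _)]
  simp only [Cfg.set, Cfg.get, pad_apply, xorBits_wire_zero]
  rw [actList_copyGates_asm (r := .t3) (u := fun j => j) (v := fun j => j) (fun _ _ h => h)
      (fun _ _ => cell_ne (by simp) _ _)]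
  simp only [Cfg.set, Cfg.get, pad_apply, xorBits_id_pad]
  rfl

/-- Write the guess of the simulated adversary, plus the bit in register `beta`, to the first qubit
of track 1. -/
def guessGates : List Gate :=
  resetReg .t1 1 ++ (copyGates 1 (fun j => cell .e (wire 1 j)) (fun j => cell .t1 j) ++
    copyGates 1 (fun j => cell .beta j) (fun j => cell .t1 j))

theorem guessProb_guessGates (O : Dens →ₗ[ℂ] Dens) (v : Bool) (d : Cfg) (ρ : Dens) :
    guessProb v (runList O guessGates (embed d ρ)) = guessProb (xor v (d.beta 0)) ρ := by
  rw [guessProb_eq, guessProb_eq, ← LinearMap.comp_apply, ← LinearMap.comp_apply]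
  congr 2
  rw [LinearMap.comp_assoc, guessGates, runList_append_comp, embed, resetReg,
    runList_resetWires O .t1 (fun j => j) 1,
    runList_classical O (List.forall_mem_append.2 ⟨isClassical_copyGates, isClassical_copyGates⟩)]
  rotate_left
  · intro s
    rw [actList_append, actList_copyGates_asm (u := fun j => j) (v := wire 1) (fun _ _ h => h)
        (fun _ _ => cell_ne (by simp) _ _),
      actList_copyGates_asm (u := fun j => j) (v := fun j => j) (fun _ _ h => h)
        (fun _ _ => cell_ne (by simp) _ _)]
  classical
  refine Dens.hom_ext fun s t => ?_
  rw [LinearMap.comp_apply, cfgMap, filterMap_single, if_pos ⟨trivial, fun _ _ => rfl⟩,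
    guessFunctional_single, guessFunctional_single]
  refine if_congr (and_congr ⟨fun h => ?_, fun h => by rw [h]⟩ ?_) rfl rfl
  · ext a
    have := congrFun h (cell .e a)
    rw [asm_cell, asm_cell] at this
    exact this
  · rw [show wire 1 0 = cell .t1 0 from rfl, asm_cell, Cfg.get_set_self]
    have h₀ (x : Bits 1) (f : ℕ → Bool) : xorBits (fun j => j) x f 0 = xor (f 0) (x 0) :=
      xorBits_apply (w := fun j => j) (fun _ _ h => h) x f 0
    rw [h₀, Cfg.get_set_self, h₀, Cfg.get_set_self]
    have h₁ : clearWires 1 (fun j => j) (((d.set .e s).get .t1)) 0 = false := by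
      simp [clearWires]
    rw [h₁]
    have h₂ : cell .t1 0 = wire 1 0 := rfl
    change xor (xor false (s (wire 1 0))) (d.beta 0) = v ↔ s (cell .t1 0) = xor v (d.beta 0)
    rw [h₂]
    cases s (wire 1 0) <;> cases d.beta 0 <;> cases v <;> simp

/-- Exchange the first `n` bits of tracks 1 and 2 if `β` is true, by three additions. -/
def swapMem (β : Bool) (n : ℕ) (s : Mem) : Mem :=
  let s₁ := xorBits (wire 2) (readTrack 1 n s) s
  let s₂ := xorBits (wire 1) (fun j : Fin n => β && s₁ (wire 2 j)) s₁
  xorBits (wire 2) (readTrack 1 n s₂) s₂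

theorem swapMem_wire (β : Bool) (n : ℕ) (s : Mem) (t : Fin 4) (i : ℕ) :
    swapMem β n s (wire t i) =
      if i < n ∧ t = 1 then s (wire (msgTrack β) i)
      else if i < n ∧ t = 2 then s (wire (msgTrack !β) i) else s (wire t i) := by
  have hx (t t' : Fin 4) (h : t' ≠ t) (z : Bits n) (s : Mem) (i : ℕ) :
      xorBits (wire t) z s (wire t' i) = s (wire t' i) :=
    xorBits_wire_of_ne (fun j => j) _ _ h i
  have h₁₂ : (1 : Fin 4) ≠ 2 := by decide
  have h₂₁ : (2 : Fin 4) ≠ 1 := by decide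
  simp only [swapMem]
  by_cases ht₁ : t = 1
  · subst ht₁
    rw [hx 2 1 h₁₂, xorBits_wire_wire, hx 2 1 h₁₂]
    by_cases hi : i < n
    · simp only [pad, overwrite, hi, dif_pos, xorBits_wire_wire, readTrack, and_self, if_true]
      cases β
      · simp [msgTrack]
      · simp only [msgTrack, if_true, Bool.true_and]
        cases s (wire 1 i) <;> cases s (wire 2 i) <;> rfl
    · simp [pad, overwrite, hi]
  · by_cases ht₂ : t = 2
    · subst ht₂
      rw [xorBits_wire_wire, hx 1 2 h₂₁, xorBits_wire_wire]
      by_cases hi : i < n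
      · simp only [pad, overwrite, hi, dif_pos, xorBits_wire_wire, readTrack, hx 2 1 h₁₂]
        cases β <;> simp [msgTrack]
      · simp [pad, overwrite, hi]
    · simp [hx 2 t ht₂, hx 1 t ht₁, ht₁, ht₂]

theorem readTrack_swapMem (β b : Bool) (n : ℕ) (s : Mem) :
    readTrack (msgTrack b) n (swapMem β n s) = readTrack (msgTrack (xor b β)) n s := by
  funext i
  cases b <;> cases β <;> simp [readTrack, swapMem_wire, msgTrack]

theorem readTrack_three_swapMem (β : Bool) (n m : ℕ) (s : Mem) :
    readTrack 3 m (swapMem β n s) = readTrack 3 m s := by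
  funext i
  simp only [readTrack]
  rw [swapMem_wire, if_neg (by simp), if_neg (by simp)]

theorem clearTrack_swapMem (β : Bool) (n m : ℕ) (s : Mem) :
    clearTrack 1 n (clearTrack 3 m (clearTrack 2 n (swapMem β n s))) =
      clearTrack 1 n (clearTrack 3 m (clearTrack 2 n s)) := by
  have h (s : Mem) : clearTrack 1 n (clearTrack 3 m (clearTrack 2 n s)) =
      clearTrack 3 m (clearTrack 1 n (clearTrack 2 n s)) := clearTrack_comm (by decide) _ _ _
  rw [h, h]
  congr 1
  refine eq_of_forall_wire fun t i => ?_
  by_cases ht₁ : t = 1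
  · subst ht₁
    rw [clearTrack_wire, clearTrack_wire, clearTrack_wire_of_ne (by decide),
      clearTrack_wire_of_ne (by decide), swapMem_wire]
    by_cases hi : i < n <;> simp [hi]
  · rw [clearTrack_wire_of_ne ht₁, clearTrack_wire_of_ne ht₁]
    by_cases ht₂ : t = 2
    · subst ht₂
      rw [clearTrack_wire, clearTrack_wire, swapMem_wire]
      by_cases hi : i < n <;> simp [hi]
    · rw [clearTrack_wire_of_ne ht₂, clearTrack_wire_of_ne ht₂, swapMem_wire]
      simp [ht₁, ht₂]

/-- Exchange tracks 1 and 2 of the simulated adversary, controlled by the first qubit of register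
`beta`. -/
def swapGates (n : ℕ) : List Gate :=
  copyGates n (fun j => cell .e (wire 1 j)) (fun j => cell .e (wire 2 j)) ++
    ((List.range n).map (fun j =>
      Gate.ccx (cell .beta 0) (cell .e (wire 2 j)) (cell .e (wire 1 j))) ++
        copyGates n (fun j => cell .e (wire 1 j)) (fun j => cell .e (wire 2 j)))

theorem isClassical_swapGates {n : ℕ} : ∀ g ∈ swapGates n, g.IsClassical := by
  refine List.forall_mem_append.2 ⟨isClassical_copyGates,
    List.forall_mem_append.2 ⟨?_, isClassical_copyGates⟩⟩
  simp only [List.mem_map]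
  rintro g ⟨j, -, rfl⟩
  trivial

theorem cell_wire_ne (r r' : Reg) {t t' : Fin 4} (h : t ≠ t') (i j : ℕ) :
    cell r (wire t i) ≠ cell r' (wire t' j) :=
  fun h' => h (wire_inj.1 (cell_inj.1 h').2).1

theorem actList_swapGates (n : ℕ) (d : Cfg) :
    actList (swapGates n) (asm d) = asm (d.set .e (swapMem (d.beta 0) n d.e)) := by
  rw [swapGates, actList_append, actList_append,
    actList_copyGates_asm (wire_injective 2) fun _ _ => cell_wire_ne _ _ (by decide) _ _]
  simp only [Cfg.set, Cfg.get]
  rw [actList_eq_xorBits (cell_comp_injective .e (wire_injective 1))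
    (val := fun j s => s (cell .beta 0) && s (cell .e (wire 2 j))) (fun j hj s => ?_) ?_,
    xorBits_asm]
  rotate_left
  · intro j _ s s' h
    have h₁ := h (cell .beta 0) fun i _ => cell_ne (by simp) _ _
    have h₂ := h (cell .e (wire 2 j)) fun i _ => cell_wire_ne _ _ (by decide) _ _
    simp only [h₁, h₂]
  · refine if_neg ?_
    rintro (h | h)
    · exact cell_ne (by simp) _ _ h
    · exact cell_wire_ne _ _ (by decide) _ _ h
  · simp only [Cfg.set, asm_cell, Cfg.get]
    rw [actList_copyGates_asm (wire_injective 2) fun _ _ => cell_wire_ne _ _ (by decide) _ _]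
    rfl

/-- Move the two challenge messages of the simulated adversary to tracks 1 and 2. -/
def moveGates (n : ℕ) : List Gate :=
  copyGates n (fun j => cell .e (wire 1 j)) (fun j => cell .t1 j) ++
    (copyGates n (fun j => cell .t1 j) (fun j => cell .e (wire 1 j)) ++
      (copyGates n (fun j => cell .e (wire 2 j)) (fun j => cell .t2 j) ++
        copyGates n (fun j => cell .t2 j) (fun j => cell .e (wire 2 j))))

theorem isClassical_moveGates {n : ℕ} : ∀ g ∈ moveGates n, g.IsClassical :=
  List.forall_mem_append.2 ⟨isClassical_copyGates, List.forall_mem_append.2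
    ⟨isClassical_copyGates, List.forall_mem_append.2
      ⟨isClassical_copyGates, isClassical_copyGates⟩⟩⟩

theorem actList_moveGates (n : ℕ) {d : Cfg} (h₁ : d.t1 = fun _ => false)
    (h₂ : d.t2 = fun _ => false) :
    actList (moveGates n) (asm d) =
      asm { d with
        e := clearTrack 2 n (clearTrack 1 n d.e)
        t1 := pad (readTrack 1 n d.e)
        t2 := pad (readTrack 2 n d.e) } := by
  have key (t : Fin 4) (s : Mem) : (fun j : Fin n => s (wire t j)) = readTrack t n s := rfl
  rw [moveGates, actList_append, actList_append, actList_append,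
    actList_copyGates_asm (u := fun j => j) (fun _ _ h => h) fun _ _ => cell_ne (by simp) _ _]
  simp only [Cfg.set, Cfg.get, key, h₁, xorBits_id_zero]
  rw [actList_copyGates_asm (v := fun j => j) (wire_injective 1) fun _ _ => cell_ne (by simp) _ _]
  simp only [Cfg.set, Cfg.get, pad_apply, xorBits_readTrack]
  rw [actList_copyGates_asm (u := fun j => j) (fun _ _ h => h) fun _ _ => cell_ne (by simp) _ _]
  simp only [Cfg.set, Cfg.get, key, h₂, xorBits_id_zero]
  rw [actList_copyGates_asm (v := fun j => j) (wire_injective 2) fun _ _ => cell_ne (by simp) _ _]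
  simp only [Cfg.set, Cfg.get, pad_apply, xorBits_readTrack]
  rw [readTrack_clearTrack (by decide)]

/-- Move a ciphertext from track 3 to track 3 of the simulated adversary. -/
def deliverGates (n : ℕ) : List Gate :=
  copyGates n (fun j => cell .t3 j) (fun j => cell .e (wire 3 j)) ++
    copyGates n (fun j => cell .e (wire 3 j)) (fun j => cell .t3 j)

theorem isClassical_deliverGates {n : ℕ} : ∀ g ∈ deliverGates n, g.IsClassical :=
  List.forall_mem_append.2 ⟨isClassical_copyGates, isClassical_copyGates⟩

theorem actList_deliverGates {n : ℕ} {d : Cfg} {x : Bits n} (hx : d.t3 = pad x)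
    (hd : ∀ i < n, d.e (wire 3 i) = false) :
    actList (deliverGates n) (asm d) =
      asm { d with e := xorBits (wire 3) x d.e, t3 := fun _ => false } := by
  rw [deliverGates, actList_append,
    actList_copyGates_asm (v := fun j => j) (wire_injective 3) fun _ _ => cell_ne (by simp) _ _]
  simp only [Cfg.set, Cfg.get, hx, pad_apply]
  rw [actList_copyGates_asm (u := fun j => j) (fun _ _ h => h) fun _ _ => cell_ne (by simp) _ _]
  have : (fun j : Fin n => xorBits (wire 3) x d.e (wire 3 j)) = x := by
    funext j
    rw [xorBits_wire_wire, hd j j.2, pad_apply, Bool.false_xor]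
  simp only [Cfg.set, Cfg.get, this, xorBits_id_pad]

namespace SchemeCircuits

variable {S : SKE} {P : PKE S.keyLen} (c : SchemeCircuits S P) (κ : ℕ)

/-! ### The reduction to the public key scheme -/

/-- Generate a symmetric key and output it as the challenge message on track 1. The message on
track 2 is `0`, the initial state of that track. -/
def keyMessageGates : List Gate :=
  coinGates (S.kgenRand κ) (cell .r1) ++ (c.keyGates κ .t1 ++ resetReg .r1 (S.kgenRand κ))

/-- Choose a bit `β` and encrypt challenge message `β` of the simulated adversary with the symmetric
key on track 1; the second part of the ciphertext is the challenge ciphertext on track 3. -/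
def sealChallengeGates : List Gate :=
  coinGates 1 (cell .beta) ++ (swapGates (S.msgLen κ) ++ (resetTrack 2 (S.msgLen κ) ++
    (resetTrack 3 (S.ctxtLen κ + P.ctxtLen κ) ++ (coinGates (S.encRand κ) (cell .r2) ++
      ((c.sealGates κ .t1 ++ copyGates (P.ctxtLen κ) (fun j => cell .t3 j)
        (fun j => cell .e (wire 3 (S.ctxtLen κ + j)))) ++ resetReg .r2 (S.encRand κ))))))

variable {c κ}

/-- The symmetric key is left on track 1, where it is both the challenge message and the copy that the
second stage uses. -/
theorem runList_keyMessageGates (O : Dens →ₗ[ℂ] Dens) (pk : Bits (P.pkLen κ)) :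
    runList O (c.keyMessageGates κ) ∘ₗ
        embed (baseCfg pk (fun _ => false) (fun _ => false) fun _ => false) =
      mix fun z => embed (baseCfg pk (fun _ => false) (pad (S.kgen κ z)) fun _ => false) := by
  rw [keyMessageGates, runList_append_comp, embed, runList_coins O .r1 _ fun _ => rfl, comp_mix]
  congr 1; funext z
  rw [runList_append_comp, runList_classical O isClassical_keyGates
    (fun s => act_keyGates (by simp) (by simp) (z := z) rfl rfl), runList_resetPad O .r1 z
      fun _ => rfl]
  refine cfgMap_congr (fun _ _ => Iff.rfl) fun s => ?_
  simp only [baseCfg, Cfg.set, Cfg.get, xorBits_id_zero]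

/-- For the coin `β`, the simulated adversary gets the hybrid challenge with message `β` whose second
part is the ciphertext `y` from the game for the public key scheme. -/
theorem runList_sealChallengeGates (hcorrect : S.PerfectlyCorrect) (O : Dens →ₗ[ℂ] Dens)
    (pk : Bits (P.pkLen κ)) (z₁ : Bits (S.kgenRand κ)) (y : Bits (P.ctxtLen κ)) :
    runList O (c.sealChallengeGates κ) ∘ₗ
        embed (baseCfg pk (fun _ => false) (pad (S.kgen κ z₁)) (pad y)) =
      mix fun β : Bits 1 => mix fun z₂ =>
        embed (baseCfg pk (pad β) (pad (S.kgen κ z₁)) (pad y)) ∘ₗ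
          fixedChallenge (β 0) (fun m => S.enc κ (S.kgen κ z₁) m z₂) y := by
  rw [sealChallengeGates, runList_append_comp, embed, runList_coins O .beta _ fun _ => rfl,
    comp_mix]
  congr 1; funext β
  rw [runList_append_comp, runList_classical O isClassical_swapGates
      (fun s => actList_swapGates _ _), runList_append_comp, runList_resetTrack,
    runList_append_comp, runList_resetTrack, runList_append_comp,
    runList_coins O .r2 _ fun _ => rfl, comp_mix]
  congr 1; funext z₂
  have hβ : pad β 0 = β 0 := pad_apply β 0
  simp only [baseCfg, Cfg.set, hβ]
  rw [runList_append_comp, runList_classical O (List.forall_mem_append.2 ⟨isClassical_sealGates,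
    isClassical_copyGates⟩)
    (D' := fun s => ⟨writeTrack 3
      (Bits.pair (S.enc κ (S.kgen κ z₁) (readTrack (msgTrack (β 0)) (S.msgLen κ) s) z₂) y)
      (clearTrack 1 (S.msgLen κ) (clearTrack 3 (S.ctxtLen κ + P.ctxtLen κ)
        (clearTrack 2 (S.msgLen κ) s))),
      pad pk, fun _ => false, fun _ => false, pad z₂, fun _ => false, pad β, fun _ => false,
      pad (S.kgen κ z₁), fun _ => false, pad y⟩)]
  · rw [runList_resetPad O .r2 z₂ fun _ => rfl, fixedChallenge, embed_comp_filterMap]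
    refine filterMap_congr (fun s t => ?_) fun s t _ => ⟨rfl, rfl⟩
    rw [true_and]
    have h₂ (s : Mem) : readTrack 2 (S.msgLen κ) (swapMem (β 0) (S.msgLen κ) s) =
        readTrack (msgTrack !(β 0)) (S.msgLen κ) s := by
      have := readTrack_swapMem (β 0) true (S.msgLen κ) s
      rwa [Bool.true_xor] at this
    rw [h₂, h₂, readTrack_clearTrack (by decide), readTrack_clearTrack (by decide),
      readTrack_three_swapMem, readTrack_three_swapMem]
  · intro s
    rw [actList_append, act_sealGates hcorrect (r := .t1) (z₁ := z₁) (z₂ := z₂) (by simp)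
      (by simp) rfl rfl rfl
      (fun i hi => clearTrack_wire_of_lt (n := S.ctxtLen κ + P.ctxtLen κ) _ (by omega))]
    simp only [Cfg.set]
    rw [actList_copyGates_asm (v := fun j => j) (wire_offset_injective 3 _)
      fun _ _ => cell_ne (by simp) _ _]
    simp only [Cfg.set, Cfg.get, pad_apply]
    rw [xorBits_pair (t := 1) (by decide) _ _
      fun i hi => clearTrack_wire_of_lt (n := S.ctxtLen κ + P.ctxtLen κ) _ hi,
      clearTrack_swapMem, readTrack_clearTrack (by decide), readTrack_clearTrack (by decide)]
    have h₁ : readTrack 1 (S.msgLen κ) (swapMem (β 0) (S.msgLen κ) s) =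
        readTrack (msgTrack (β 0)) (S.msgLen κ) s := by
      have := readTrack_swapMem (β 0) false (S.msgLen κ) s
      rwa [Bool.false_xor] at this
    rw [h₁]

/-- The challenge of the game for the public key scheme, in which the messages are the symmetric key
and `0`. -/
theorem classicalChallenge_embed (b : Bool) (pk : Bits (P.pkLen κ)) (k : Bits (S.keyLen κ)) :
    classicalChallenge b (P.enc κ pk) ∘ₗ
        embed (baseCfg pk (fun _ => false) (pad k) fun _ => false) =
      mix fun z => embed (baseCfg pk (fun _ => false) (pad k)
        (pad (P.enc κ pk (if b then fun _ => false else k) z))) := by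
  have hclass : classicalChallenge b (P.enc κ pk) = mix fun z =>
      (conjugate (basisMap fun s =>
        writeTrack 3 (P.enc κ pk (readTrack (msgTrack b) (S.keyLen κ) s) z) s)) ∘ₗ
      discardTrack 3 (P.ctxtLen κ) ∘ₗ measureTrack 2 (S.keyLen κ) ∘ₗ
        measureTrack 1 (S.keyLen κ) := rfl
  rw [hclass, mix_comp]
  congr 1; funext z
  rw [conjugate_basisMap, discardTrack_eq, measureTrack_eq, measureTrack_eq, embed, cfgMap,
    filterMap_comp, filterMap_comp, filterMap_comp, filterMap_comp, embed, cfgMap]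
  have h₁ (i : ℕ) : cell .t1 i = wire 1 i := rfl
  have h₂ (i : ℕ) : cell .t2 i = wire 2 i := rfl
  have h₃ (i : ℕ) : cell .t3 i = wire 3 i := rfl
  refine filterMap_congr (fun s t => ?_) fun s t _ => ?_
  · simp only [Function.comp, readTrack_asm h₁, readTrack_asm h₂, readTrack_asm h₃, Cfg.get, Cfg.set,
      and_self]
  · have key (s : Mem) : writeTrack 3 (P.enc κ pk (readTrack (msgTrack b) (S.keyLen κ)
          (clearTrack 3 (P.ctxtLen κ) (asm ((baseCfg pk (fun _ => false) (pad k)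
            fun _ => false).set .e s)))) z)
        (clearTrack 3 (P.ctxtLen κ) (asm ((baseCfg pk (fun _ => false) (pad k)
            fun _ => false).set .e s))) =
        asm ((baseCfg pk (fun _ => false) (pad k)
          (pad (P.enc κ pk (if b then fun _ => false else k) z))).set .e s) := by
      have hm : readTrack (msgTrack b) (S.keyLen κ) (clearTrack 3 (P.ctxtLen κ)
          (asm ((baseCfg pk (fun _ => false) (pad k) fun _ => false).set .e s))) =
          if b then fun _ => false else k := by
        cases b
        · rw [readTrack_clearTrack (by decide)]
          exact (readTrack_asm h₁ _ _).trans (restrict_of_eq_pad rfl)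
        · rw [readTrack_clearTrack (by decide)]
          exact readTrack_asm h₂ _ _
      rw [hm, clearTrack, writeTrack_asm h₃, writeTrack_asm h₃]
      congr 1
      simp only [Cfg.set, Cfg.get, baseCfg, Cfg.mk.injEq, true_and]
      ext i
      simp only [pad, overwrite]
      split_ifs <;> rfl
    exact ⟨key s, key t⟩

end SchemeCircuits

/-! ### The reduction to the symmetric scheme -/

theorem overwrite_false_pad {n : ℕ} (x : Bits n) :
    overwrite (fun _ : Fin n => false) (pad x) = fun _ => false := by
  ext i
  simp only [pad, overwrite]
  split_ifs <;> rfl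

theorem overwrite_false_zero (n : ℕ) :
    overwrite (fun _ : Fin n => false) (fun _ => false) = fun _ => false := by
  ext i
  simp [overwrite]

theorem clearTrack_zero (t : Fin 4) (s : Mem) : clearTrack t 0 s = s :=
  eq_of_forall_wire fun t' i => by
    by_cases h : t' = t
    · subst h; simp [clearTrack_wire]
    · rw [clearTrack_wire_of_ne h]

namespace SchemeCircuits

variable {S : SKE} {P : PKE S.keyLen} (c : SchemeCircuits S P) (κ : ℕ)

/-- Generate a key pair and hand the public key to the simulated adversary. -/
def publicKeyGates : List Gate :=
  coinGates (P.kgenRand κ) (cell .r1) ++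
    ((c.kgenP.xorGates κ (P.kgenRand κ) (P.pkLen κ) (cell .r1) (cell .work)
        (fun j => cell .pk j) ++
      copyGates (P.pkLen κ) (fun j => cell .pk j) (fun j => cell .e (wire 3 j))) ++
        resetReg .r1 (P.kgenRand κ))

/-- Complete the challenge ciphertext on track 3 by an encryption of `0` in the public key scheme
and deliver it to the simulated adversary. -/
def completeGates : List Gate :=
  resetTrack 3 (S.ctxtLen κ + P.ctxtLen κ) ++ (deliverGates (S.ctxtLen κ) ++
    (coinGates (P.encRand κ) (cell .r3) ++ (c.encapsGates κ .k ++ resetReg .r3 (P.encRand κ))))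

variable {c κ}

theorem runList_publicKeyGates (O : Dens →ₗ[ℂ] Dens) :
    runList O (c.publicKeyGates κ) (initialState fun i : Fin 0 => i.elim0) =
      mix fun z => embed (baseCfg (P.kgen κ z).1 (fun _ => false) (fun _ => false) fun _ => false)
        (initialState (P.kgen κ z).1) := by
  have h₀ : zeroCfg.set .t3 (pad fun i : Fin 0 => i.elim0) = zeroCfg := by
    have : pad (fun i : Fin 0 => i.elim0) = fun _ => false := by
      ext i; simp [pad, overwrite]
    rw [this]
    rfl
  simp only [embed_initialState]
  rw [initialState_eq, ← LinearMap.comp_apply, publicKeyGates, runList_append_comp, h₀,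
    runList_coins O .r1 _ fun _ => rfl, comp_mix, mix_apply]
  congr 1; funext z
  rw [runList_append_comp, runList_classical O (List.forall_mem_append.2
    ⟨BoolCircuits.isClassical_xorGates, isClassical_copyGates⟩) (D' := fun _ =>
      ⟨writeTrack 3 (P.kgen κ z).1 fun _ => false, pad (P.kgen κ z).1, fun _ => false, pad z,
        fun _ => false, fun _ => false, fun _ => false, fun _ => false, fun _ => false,
        fun _ => false, fun _ => false⟩), runList_resetPad O .r1 z fun _ => rfl]
  · rfl
  · intro s
    rw [actList_append, actList_xorGates_asm c.kgenP κ (r := .pk) (u := fun j => j)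
      (fun _ _ h => h) (by simp) (fun i _ j => cell_ne (by simp) _ _)
      (fun i _ j _ => cell_ne (by simp) _ _) rfl, read_cell (r := .r1) (x := z) rfl,
      c.kgenP_eval]
    simp only [zeroCfg, Cfg.set, Cfg.get, xorBits_id_zero]
    rw [actList_copyGates_asm (v := fun j => j) (wire_injective 3)
      fun _ _ => cell_ne (by simp) _ _]
    simp only [Cfg.set, Cfg.get, pad_apply, xorBits_wire_zero]

/-- The challenge of the game for the symmetric scheme consumes the messages of the simulated adversary
and leaves the symmetric ciphertext on track 3. The relation records that the other message has
been traced out. -/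
theorem quantumChallenge_moveGates (O : Dens →ₗ[ℂ] Dens) (b : Bool) (pk : Bits (P.pkLen κ))
    {r : ℕ} (enc : Bits (S.msgLen κ) → Bits r → Bits (S.ctxtLen κ)) :
    quantumChallenge b enc ∘ₗ (runList O (moveGates (S.msgLen κ)) ∘ₗ
        embed (baseCfg pk (fun _ => false) (fun _ => false) fun _ => false)) =
      mix fun z => cfgMap
        (fun s s' => readTrack (msgTrack !b) (S.msgLen κ) s =
          readTrack (msgTrack !b) (S.msgLen κ) s')
        fun s => (baseCfg pk (fun _ => false) (fun _ => false)
          (pad (enc (readTrack (msgTrack b) (S.msgLen κ) s) z))).set .e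
            (clearTrack 2 (S.msgLen κ) (clearTrack 1 (S.msgLen κ) s)) := by
  rw [embed, runList_classical O isClassical_moveGates fun s => actList_moveGates _ rfl rfl,
    quantumChallenge_eq, mix_comp]
  congr 1; funext z
  rw [cfgMap, filterMap_comp, cfgMap]
  have h₁ (i : ℕ) : cell .t1 i = wire 1 i := rfl
  have h₂ (i : ℕ) : cell .t2 i = wire 2 i := rfl
  have h₃ (i : ℕ) : cell .t3 i = wire 3 i := rfl
  have hr (b : Bool) (s : Mem) : readTrack (msgTrack b) (S.msgLen κ)
      (asm { (baseCfg pk (fun _ => false) (fun _ => false) fun _ => false).set .e s with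
        e := clearTrack 2 (S.msgLen κ) (clearTrack 1 (S.msgLen κ) s)
        t1 := pad (readTrack 1 (S.msgLen κ) s)
        t2 := pad (readTrack 2 (S.msgLen κ) s) }) = readTrack (msgTrack b) (S.msgLen κ) s := by
    cases b
    · exact (readTrack_asm h₁ _ _).trans (restrict_of_eq_pad rfl)
    · exact (readTrack_asm h₂ _ _).trans (restrict_of_eq_pad rfl)
  refine filterMap_congr (fun s t => ?_) fun s t _ => ?_
  · rw [true_and]
    refine Iff.trans (and_iff_left ?_) (Iff.of_eq (congrArg₂ (· = ·) (hr _ s) (hr _ t)))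
    rw [readTrack_asm h₃, readTrack_asm h₃]
    rfl
  · have key (s : Mem) : writeTrack 3 (enc (readTrack (msgTrack b) (S.msgLen κ) s) z)
        (clearTrack 1 (S.msgLen κ) (clearTrack 3 (S.ctxtLen κ) (clearTrack 2 (S.msgLen κ)
      (asm { (baseCfg pk (fun _ => false) (fun _ => false) fun _ => false).set .e s with
        e := clearTrack 2 (S.msgLen κ) (clearTrack 1 (S.msgLen κ) s)
        t1 := pad (readTrack 1 (S.msgLen κ) s)
        t2 := pad (readTrack 2 (S.msgLen κ) s) })))) =
        asm ((baseCfg pk (fun _ => false) (fun _ => false)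
          (pad (enc (readTrack (msgTrack b) (S.msgLen κ) s) z))).set .e
            (clearTrack 2 (S.msgLen κ) (clearTrack 1 (S.msgLen κ) s))) := by
      simp only [clearTrack, writeTrack_asm h₁, writeTrack_asm h₂, writeTrack_asm h₃, Cfg.set,
        Cfg.get, baseCfg, overwrite_false_pad, overwrite_false_zero]
      rfl
    refine ⟨Eq.trans ?_ (key s), Eq.trans ?_ (key t)⟩
    · rw [← hr b s]
      rfl
    · rw [← hr b t]
      rfl

/-- Together with `quantumChallenge_moveGates`, this gives the simulated adversary the hybrid challenge
whose second part is an encryption of `0`. -/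
theorem runList_completeGates (O : Dens →ₗ[ℂ] Dens) (b : Bool) (pk : Bits (P.pkLen κ))
    (x : Bits (S.msgLen κ) → Bits (S.ctxtLen κ)) :
    runList O (c.completeGates κ) ∘ₗ cfgMap
        (fun s s' => readTrack (msgTrack !b) (S.msgLen κ) s =
          readTrack (msgTrack !b) (S.msgLen κ) s')
        (fun s => (baseCfg pk (fun _ => false) (fun _ => false)
          (pad (x (readTrack (msgTrack b) (S.msgLen κ) s)))).set .e
            (clearTrack 2 (S.msgLen κ) (clearTrack 1 (S.msgLen κ) s))) =
      mix fun z => embed (baseCfg pk (fun _ => false) (fun _ => false) fun _ => false) ∘ₗ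
        fixedChallenge b x (P.enc κ pk (fun _ => false) z) := by
  have hzero (s : Mem) : ∀ i < S.ctxtLen κ + P.ctxtLen κ, clearTrack 3
      (S.ctxtLen κ + P.ctxtLen κ) s (wire 3 i) = false := fun i hi => clearTrack_wire_of_lt _ hi
  rw [completeGates, runList_append_comp, runList_resetTrack, runList_append_comp,
    runList_classical O isClassical_deliverGates fun s => actList_deliverGates
      (x := x (readTrack (msgTrack b) (S.msgLen κ) s)) rfl fun i hi => hzero _ i (by omega),
    runList_append_comp, runList_coins O .r3 _ fun _ => rfl, comp_mix]
  congr 1; funext z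
  -- the register `k` is in the state `0`, which serves as the encrypted message
  rw [runList_append_comp, runList_classical O isClassical_encapsGates fun s =>
    act_encapsGates (r := .k) (pk := pk) (k := fun _ => false) (z := z) (by simp) (by simp) rfl
      (by ext i; simp [pad, overwrite, baseCfg, Cfg.set, Cfg.get]) rfl rfl,
    runList_resetPad O .r3 z fun _ => rfl, fixedChallenge, embed_comp_filterMap]
  refine cfgMap_congr (fun s t => and_congr_right fun _ => ?_) fun s => ?_
  · simp only [Cfg.set]
    rw [readTrack_clearTrack (by decide), readTrack_clearTrack (by decide),
      readTrack_clearTrack (by decide), readTrack_clearTrack (by decide)]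
  · simp only [Cfg.set, baseCfg, Cfg.mk.injEq, and_true]
    have := xorBits_pair (n := 0) (t := 1) (by decide)
      (x (readTrack (msgTrack b) (S.msgLen κ) s)) (P.enc κ pk (fun _ => false) z)
      (hzero (clearTrack 2 (S.msgLen κ) (clearTrack 1 (S.msgLen κ) s)))
    rw [clearTrack_zero, clearTrack_zero] at this
    rw [this, clearTrack_comm (t := 2) (t' := 1) (by decide),
      clearTrack_comm (t := 3) (t' := 1) (by decide)]

end SchemeCircuits

/-! ### Uniformity of the reductions -/

theorem UniformProg.resetReg {n : ℕ → ℕ} (hn : UniformLength n) (r : Reg) :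
    UniformProg fun κ => _root_.resetReg r (n κ) := reset hn (UniformIndex.id.cell r)

theorem UniformProg.resetTrack {n : ℕ → ℕ} (hn : UniformLength n) (t : Fin 4) :
    UniformProg fun κ => _root_.resetTrack t (n κ) := reset hn ((UniformIndex.id.wire t).cell .e)

theorem uniformProg_swapGates {n : ℕ → ℕ} (hn : UniformLength n) :
    UniformProg fun κ => swapGates (n κ) :=
  have h (t : Fin 4) : UniformIndex fun _ j => cell .e (wire t j) := (UniformIndex.id.wire t).cell .e
  (UniformProg.copyGates hn (h 1) (h 2)).append
    ((UniformProg.ccx hn ((UniformIndex.const 0).cell .beta) (h 2) (h 1)).append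
      (UniformProg.copyGates hn (h 1) (h 2)))

theorem uniformProg_moveGates {n : ℕ → ℕ} (hn : UniformLength n) :
    UniformProg fun κ => moveGates (n κ) :=
  have h (t : Fin 4) : UniformIndex fun _ j => cell .e (wire t j) := (UniformIndex.id.wire t).cell .e
  have h' (r : Reg) : UniformIndex fun _ j => cell r j := UniformIndex.id.cell r
  (UniformProg.copyGates hn (h 1) (h' .t1)).append ((UniformProg.copyGates hn (h' .t1) (h 1)).append
    ((UniformProg.copyGates hn (h 2) (h' .t2)).append (UniformProg.copyGates hn (h' .t2) (h 2))))

theorem uniformProg_deliverGates {n : ℕ → ℕ} (hn : UniformLength n) :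
    UniformProg fun κ => deliverGates (n κ) :=
  have h : UniformIndex fun _ j => cell .e (wire 3 j) := (UniformIndex.id.wire 3).cell .e
  have h' : UniformIndex fun _ j => cell .t3 j := UniformIndex.id.cell .t3
  (UniformProg.copyGates hn h' h).append (UniformProg.copyGates hn h h')

theorem uniformProg_receiveGates {n : ℕ → ℕ} (hn : UniformLength n) :
    UniformProg fun κ => receiveGates (n κ) :=
  have h (r : Reg) : UniformIndex fun _ j => cell r j := UniformIndex.id.cell r
  (UniformProg.copyGates hn (h .t3) (h .pk)).append
    ((UniformProg.copyGates hn (h .pk) ((UniformIndex.id.wire 3).cell .e)).append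
      (UniformProg.copyGates hn (h .pk) (h .t3)))

theorem uniformProg_guessGates : UniformProg fun _ => guessGates :=
  have h (r : Reg) : UniformIndex fun _ j => cell r j := UniformIndex.id.cell r
  (UniformProg.resetReg (.const 1) .t1).append
    ((UniformProg.copyGates (.const 1) ((UniformIndex.id.wire 1).cell .e) (h .t1)).append
      (UniformProg.copyGates (.const 1) (h .beta) (h .t1)))

namespace SchemeCircuits

variable {S : SKE} {P : PKE S.keyLen} (c : SchemeCircuits S P) (hS : S.Efficient)
  (hP : P.Efficient)
include hS hP

omit hP in
theorem uniformProg_keyGates (r : Reg) : UniformProg fun κ => c.keyGates κ r :=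
  UniformProg.xorGates c.kgenS hS.kgenRand_uniform hS.keyLen_uniform (UniformIndex.id.cell .r1)
    (UniformIndex.id.cell .work) (UniformIndex.id.cell r)

omit hP in
theorem uniformProg_sealGates (r : Reg) : UniformProg fun κ => c.sealGates κ r :=
  have h (r : Reg) : UniformIndex fun _ j => cell r j := UniformIndex.id.cell r
  have h' (t : Fin 4) : UniformIndex fun _ j => cell .e (wire t j) :=
    (UniformIndex.id.wire t).cell .e
  (UniformProg.xorGates c.encS
    (hS.keyLen_uniform.add (hS.msgLen_uniform.add hS.encRand_uniform)) hS.ctxtLen_uniform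
    (.seqWires hS.keyLen_uniform (h r) (.seqWires hS.msgLen_uniform (h' 1) (h .r2)))
    (h .work) (h' 3)).append
  (UniformProg.xorGates c.decS (hS.keyLen_uniform.add hS.ctxtLen_uniform) hS.msgLen_uniform
    (.seqWires hS.keyLen_uniform (h r) (h' 3)) (h .work) (h' 1))

omit hP in
theorem uniformIndex_secondPart :
    UniformIndex fun κ j => cell .e (wire 3 (S.ctxtLen κ + j)) :=
  ((hS.ctxtLen_uniform.index.add .id).wire 3).cell .e

theorem uniformProg_encapsGates (r : Reg) : UniformProg fun κ => c.encapsGates κ r :=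
  have h (r : Reg) : UniformIndex fun _ j => cell r j := UniformIndex.id.cell r
  UniformProg.xorGates c.encP (hP.pkLen_uniform.add (hS.keyLen_uniform.add hP.encRand_uniform))
    hP.ctxtLen_uniform
    (.seqWires hP.pkLen_uniform (h .pk) (.seqWires hS.keyLen_uniform (h r) (h .r3)))
    (h .work) (uniformIndex_secondPart hS)

theorem uniformProg_queryGates : UniformProg c.queryGates :=
  have h (r : Reg) : UniformIndex fun _ j => cell r j := UniformIndex.id.cell r
  (UniformProg.resetTrack (hS.ctxtLen_uniform.add hP.ctxtLen_uniform) 3).append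
    ((UniformProg.coinGates hS.kgenRand_uniform (h .r1)).append
      ((UniformProg.coinGates hS.encRand_uniform (h .r2)).append
        ((UniformProg.coinGates hP.encRand_uniform (h .r3)).append
          (((c.uniformProg_keyGates hS .k).append ((c.uniformProg_sealGates hS .k).append
            ((c.uniformProg_encapsGates hS hP .k).append (c.uniformProg_keyGates hS .k)))).append
          ((UniformProg.resetReg hS.kgenRand_uniform .r1).append
            ((UniformProg.resetReg hS.encRand_uniform .r2).append
              (UniformProg.resetReg hP.encRand_uniform .r3)))))))

theorem uniformProg_simulate (A : QuantumCircuits) :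
    UniformProg fun κ => (A.gates κ).flatMap (Gate.simulate (cell .e) (c.queryGates κ)) :=
  UniformProg.simulate A (c.uniformProg_queryGates hS hP) (UniformIndex.id.cell .e)

omit hP in
theorem uniformProg_keyMessageGates : UniformProg c.keyMessageGates :=
  (UniformProg.coinGates hS.kgenRand_uniform (UniformIndex.id.cell .r1)).append
    ((c.uniformProg_keyGates hS .t1).append (UniformProg.resetReg hS.kgenRand_uniform .r1))

theorem uniformProg_sealChallengeGates : UniformProg c.sealChallengeGates :=
  have h (r : Reg) : UniformIndex fun _ j => cell r j := UniformIndex.id.cell r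
  (UniformProg.coinGates (.const 1) (h .beta)).append
    ((uniformProg_swapGates hS.msgLen_uniform).append
      ((UniformProg.resetTrack hS.msgLen_uniform 2).append
        ((UniformProg.resetTrack (hS.ctxtLen_uniform.add hP.ctxtLen_uniform) 3).append
          ((UniformProg.coinGates hS.encRand_uniform (h .r2)).append
            (((c.uniformProg_sealGates hS .t1).append
              (UniformProg.copyGates hP.ctxtLen_uniform (h .t3)
                (uniformIndex_secondPart hS))).append
              (UniformProg.resetReg hS.encRand_uniform .r2))))))

omit hS in
theorem uniformProg_publicKeyGates : UniformProg c.publicKeyGates :=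
  have h (r : Reg) : UniformIndex fun _ j => cell r j := UniformIndex.id.cell r
  (UniformProg.coinGates hP.kgenRand_uniform (h .r1)).append
    (((UniformProg.xorGates c.kgenP hP.kgenRand_uniform hP.pkLen_uniform (h .r1) (h .work)
      (h .pk)).append (UniformProg.copyGates hP.pkLen_uniform (h .pk)
        ((UniformIndex.id.wire 3).cell .e))).append
      (UniformProg.resetReg hP.kgenRand_uniform .r1))

theorem uniformProg_completeGates : UniformProg c.completeGates :=
  (UniformProg.resetTrack (hS.ctxtLen_uniform.add hP.ctxtLen_uniform) 3).append
    ((uniformProg_deliverGates hS.ctxtLen_uniform).append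
      ((UniformProg.coinGates hP.encRand_uniform (UniformIndex.id.cell .r3)).append
        ((c.uniformProg_encapsGates hS hP .k).append
          (UniformProg.resetReg hP.encRand_uniform .r3))))

/-- The adversary against the public key scheme. -/
theorem exists_reduction_PKE (E : Adversary) : ∃ B : Adversary,
    (∀ κ, B.stage₁.gates κ = receiveGates (P.pkLen κ) ++
      ((E.stage₁.gates κ).flatMap (Gate.simulate (cell .e) (c.queryGates κ)) ++
        c.keyMessageGates κ)) ∧
    ∀ κ, B.stage₂.gates κ = c.sealChallengeGates κ ++
      ((E.stage₂.gates κ).flatMap (Gate.simulate (cell .e) (c.queryGates κ)) ++ guessGates) := by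
  obtain ⟨A₁, h₁⟩ := (uniformProg_receiveGates hP.pkLen_uniform).append
    ((c.uniformProg_simulate hS hP E.stage₁).append (c.uniformProg_keyMessageGates hS))
  obtain ⟨A₂, h₂⟩ := (c.uniformProg_sealChallengeGates hS hP).append
    ((c.uniformProg_simulate hS hP E.stage₂).append uniformProg_guessGates)
  exact ⟨⟨A₁, A₂⟩, h₁, h₂⟩

/-- The adversary against the symmetric scheme. -/
theorem exists_reduction_SKE (E : Adversary) : ∃ C : Adversary,
    (∀ κ, C.stage₁.gates κ = c.publicKeyGates κ ++
      ((E.stage₁.gates κ).flatMap (Gate.simulate (cell .e) (c.queryGates κ)) ++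
        moveGates (S.msgLen κ))) ∧
    ∀ κ, C.stage₂.gates κ = c.completeGates κ ++
      ((E.stage₂.gates κ).flatMap (Gate.simulate (cell .e) (c.queryGates κ)) ++ guessGates) := by
  obtain ⟨A₁, h₁⟩ := (c.uniformProg_publicKeyGates hP).append
    ((c.uniformProg_simulate hS hP E.stage₁).append (uniformProg_moveGates hS.msgLen_uniform))
  obtain ⟨A₂, h₂⟩ := (c.uniformProg_completeGates hS hP).append
    ((c.uniformProg_simulate hS hP E.stage₂).append uniformProg_guessGates)
  exact ⟨⟨A₁, A₂⟩, h₁, h₂⟩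

end SchemeCircuits

/-! ### Averages -/

theorem average_congr {n : ℕ} {f g : Bits n → ℝ} (h : ∀ z, f z = g z) : average f = average g := by
  rw [funext h]

theorem average_comm {m n : ℕ} (f : Bits m → Bits n → ℝ) :
    (average fun x => average fun y => f x y) = average fun y => average fun x => f x y := by
  simp only [average, ← Finset.sum_div]
  rw [Finset.sum_comm, div_right_comm]

theorem average_sub {n : ℕ} (f g : Bits n → ℝ) :
    (average fun z => f z - g z) = average f - average g := by
  simp only [average, Finset.sum_sub_distrib, sub_div]

theorem average_sum_div_two {n : ℕ} (f : Bits n → Bool → ℝ) :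
    (average fun z => (∑ b, f z b) / 2) = (∑ b, average fun z => f z b) / 2 := by
  simp only [average, ← Finset.sum_div, Fintype.sum_bool, Finset.sum_add_distrib]
  ring

theorem average_div_two_add {n : ℕ} (f : Bits n → ℝ) :
    (average fun z => (1 + f z) / 2) = (1 + average f) / 2 := by
  simp only [average, ← Finset.sum_div, Finset.sum_add_distrib, Finset.sum_const,
    Finset.card_univ, Fintype.card_pi, Fintype.card_bool, Finset.prod_const, Fintype.card_fin,
    nsmul_eq_mul, mul_one]
  push_cast
  field_simp

theorem average_one_bit (f : Bool → ℝ) : (average fun z : Bits 1 => f (z 0)) = (∑ b, f b) / 2 := by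
  rw [average, pow_one,
    Fintype.sum_equiv (Equiv.funUnique (Fin 1) Bool) (fun z => f (z 0)) f fun _ => rfl]

/-! ### The games -/

theorem trace_initialState {n : ℕ} (x : Bits n) : trace (initialState x) = 1 := by
  rw [initialState, trace_single, if_pos rfl]

namespace SchemeCircuits

variable {S : SKE} {P : PKE S.keyLen} {c : SchemeCircuits S P} {κ : ℕ}

/-- The probability that the guess of the adversary `E` against the hybrid scheme is `v` if it gets
the challenge `fixedChallenge β x y`. -/
noncomputable def guessValue (P : PKE S.keyLen) (E : Adversary) (κ : ℕ) (pk : Bits (P.pkLen κ))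
    (β : Bool) (x : Bits (S.msgLen κ) → Bits (S.ctxtLen κ)) (y : Bits (P.ctxtLen κ))
    (v : Bool) : ℝ :=
  guessProb v (runList (type2Oracle 1 (hybridEnc S P κ pk)) (E.stage₂.gates κ)
    (fixedChallenge β x y (runList (type2Oracle 1 (hybridEnc S P κ pk)) (E.stage₁.gates κ)
      (initialState pk))))

theorem ready_baseCfg (pk : Bits (P.pkLen κ)) (beta t1 t3 : ℕ → Bool) :
    Ready pk (baseCfg pk beta t1 t3) := ⟨rfl, rfl, rfl, rfl, rfl, rfl⟩

/-- The game for the hybrid scheme: the second part of the challenge encrypts the symmetric key. -/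
theorem guessProb_hybrid (E : Adversary) (pk : Bits (P.pkLen κ)) (b v : Bool) :
    guessProb v (E.stage₂.run κ (type2Oracle 1 ((hybrid S P).enc κ pk))
      (quantumChallenge b ((hybrid S P).enc κ pk)
        (E.stage₁.run κ (type2Oracle 1 ((hybrid S P).enc κ pk)) (initialState pk)))) =
      average fun z₁ => average fun z₂ => average fun z₃ =>
        guessValue P E κ pk b (fun m => S.enc κ (S.kgen κ z₁) m z₂)
          (P.enc κ pk (S.kgen κ z₁) z₃) v := by
  change guessProb v (E.stage₂.run κ (type2Oracle 1 (hybridEnc S P κ pk))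
      (quantumChallenge b (hybridEnc S P κ pk)
        (E.stage₁.run κ (type2Oracle 1 (hybridEnc S P κ pk)) (initialState pk)))) = _
  rw [quantumChallenge_hybridEnc, QuantumCircuits.run_eq, QuantumCircuits.run_eq]
  simp only [mix_apply, map_mix, guessProb_mix]
  rfl

theorem run_simulate (hcorrect : S.PerfectlyCorrect) (O : Dens →ₗ[ℂ] Dens) {pk : Bits (P.pkLen κ)}
    {d : Cfg} (hd : Ready pk d) (l : List Gate) (ρ : Dens) :
    runList O (l.flatMap (Gate.simulate (cell .e) (c.queryGates κ))) (embed d ρ) =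
      embed d (runList (type2Oracle 1 (hybridEnc S P κ pk)) l ρ) :=
  LinearMap.congr_fun (runList_simulate O d _ (runList_queryGates hcorrect O hd) l) ρ

/-- The simulated second stage and the guess. -/
theorem guessProb_simulate (hcorrect : S.PerfectlyCorrect) (O : Dens →ₗ[ℂ] Dens)
    {pk : Bits (P.pkLen κ)} {d : Cfg} (hd : Ready pk d) (l : List Gate) (ρ : Dens) (v : Bool) :
    guessProb v (runList O guessGates
      (runList O (l.flatMap (Gate.simulate (cell .e) (c.queryGates κ))) (embed d ρ))) =
      guessProb (xor v (d.beta 0)) (runList (type2Oracle 1 (hybridEnc S P κ pk)) l ρ) := by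
  rw [run_simulate hcorrect O hd, guessProb_guessGates]

section PKE

variable {E B : Adversary} (hcorrect : S.PerfectlyCorrect)
  (h₁ : ∀ κ, B.stage₁.gates κ = receiveGates (P.pkLen κ) ++
    ((E.stage₁.gates κ).flatMap (Gate.simulate (cell .e) (c.queryGates κ)) ++
      c.keyMessageGates κ))
  (h₂ : ∀ κ, B.stage₂.gates κ = c.sealChallengeGates κ ++
    ((E.stage₂.gates κ).flatMap (Gate.simulate (cell .e) (c.queryGates κ)) ++ guessGates))
include hcorrect h₁

theorem run_stage₁_PKE (O : Dens →ₗ[ℂ] Dens) (pk : Bits (P.pkLen κ)) :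
    B.stage₁.run κ O (initialState pk) = mix fun z =>
      embed (baseCfg pk (fun _ => false) (pad (S.kgen κ z)) fun _ => false)
        (runList (type2Oracle 1 (hybridEnc S P κ pk)) (E.stage₁.gates κ) (initialState pk)) := by
  rw [QuantumCircuits.run_eq, h₁, runList_append, runList_append, LinearMap.comp_apply,
    LinearMap.comp_apply, runList_receiveGates, run_simulate hcorrect O (ready_baseCfg _ _ _ _),
    ← LinearMap.comp_apply, runList_keyMessageGates, mix_apply]

theorem classicalChallenge_stage₁ (O : Dens →ₗ[ℂ] Dens) (pk : Bits (P.pkLen κ)) (b : Bool) :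
    classicalChallenge b (P.enc κ pk) (B.stage₁.run κ O (initialState pk)) =
      mix fun z₁ => mix fun z₃ => embed (baseCfg pk (fun _ => false) (pad (S.kgen κ z₁))
          (pad (P.enc κ pk (if b then fun _ => false else S.kgen κ z₁) z₃)))
        (runList (type2Oracle 1 (hybridEnc S P κ pk)) (E.stage₁.gates κ) (initialState pk)) := by
  rw [run_stage₁_PKE hcorrect h₁, map_mix]
  congr 1; funext z₁
  rw [← LinearMap.comp_apply, classicalChallenge_embed, mix_apply]

include h₂ in
/-- The guess of `B` is the guess of the simulated adversary plus its own coin `β`, so that `B` guesses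
`false`, which stands for an encryption of the symmetric key, if the simulated adversary wins. -/
theorem guessProb_PKE (O : Dens →ₗ[ℂ] Dens) (pk : Bits (P.pkLen κ)) (b v : Bool) :
    guessProb v (B.stage₂.run κ O
      (classicalChallenge b (P.enc κ pk) (B.stage₁.run κ O (initialState pk)))) =
      average fun z₁ => average fun z₃ => average fun β : Bits 1 => average fun z₂ =>
        guessValue P E κ pk (β 0) (fun m => S.enc κ (S.kgen κ z₁) m z₂)
          (P.enc κ pk (if b then fun _ => false else S.kgen κ z₁) z₃) (xor v (β 0)) := by
  rw [classicalChallenge_stage₁ hcorrect h₁, QuantumCircuits.run_eq, h₂, runList_append,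
    runList_append, map_mix, guessProb_mix]
  refine average_congr fun z₁ => ?_
  rw [map_mix, guessProb_mix]
  refine average_congr fun z₃ => ?_
  rw [LinearMap.comp_apply, ← LinearMap.comp_apply _ (embed _),
    runList_sealChallengeGates hcorrect, mix_apply, map_mix, guessProb_mix]
  refine average_congr fun β => ?_
  rw [mix_apply, map_mix, guessProb_mix]
  refine average_congr fun z₂ => ?_
  rw [LinearMap.comp_apply, LinearMap.comp_apply,
    guessProb_simulate hcorrect O (ready_baseCfg _ _ _ _), guessValue]
  congr 2

theorem guessProb_add_PKE {O : Dens →ₗ[ℂ] Dens} (hO : trace ∘ₗ O = trace) (pk : Bits (P.pkLen κ))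
    (b : Bool) :
    guessProb false (B.stage₂.run κ O
      (classicalChallenge b (P.enc κ pk) (B.stage₁.run κ O (initialState pk)))) +
    guessProb true (B.stage₂.run κ O
      (classicalChallenge b (P.enc κ pk) (B.stage₁.run κ O (initialState pk)))) = 1 := by
  -- the trace of the state of the simulated adversary is the trace of the state of `B` after its
  -- first stage, which consists of trace preserving gates
  have h : trace (runList (type2Oracle 1 (hybridEnc S P κ pk)) (E.stage₁.gates κ)
      (initialState pk)) = 1 := by
    have := congrArg trace (run_stage₁_PKE hcorrect h₁ O pk)
    rw [QuantumCircuits.run_eq, trace_runList hO, trace_initialState, map_mix] at this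
    simp only [trace_embed, mix_const] at this
    exact this.symm
  rw [guessProb_false_add_true, QuantumCircuits.run_eq, trace_runList hO,
    classicalChallenge_stage₁ hcorrect h₁]
  simp only [map_mix, trace_embed, mix_const, h, Complex.one_re]

end PKE

/-- The quantum challenge of the symmetric scheme, seen by the simulated adversary. -/
theorem guessProb_SKE {E C : Adversary} (hcorrect : S.PerfectlyCorrect)
    (h₁ : ∀ κ, C.stage₁.gates κ = c.publicKeyGates κ ++
      ((E.stage₁.gates κ).flatMap (Gate.simulate (cell .e) (c.queryGates κ)) ++
        moveGates (S.msgLen κ)))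
    (h₂ : ∀ κ, C.stage₂.gates κ = c.completeGates κ ++
      ((E.stage₂.gates κ).flatMap (Gate.simulate (cell .e) (c.queryGates κ)) ++ guessGates))
    (O : Dens →ₗ[ℂ] Dens) (k : Bits (S.keyLen κ)) (b v : Bool) :
    guessProb v (C.stage₂.run κ O (quantumChallenge b (S.enc κ k)
      (C.stage₁.run κ O (initialState fun i : Fin 0 => i.elim0)))) =
      average fun r => average fun z₂ => average fun z₃ =>
        guessValue P E κ (P.kgen κ r).1 b (fun m => S.enc κ k m z₂)
          (P.enc κ (P.kgen κ r).1 (fun _ => false) z₃) v := by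
  rw [QuantumCircuits.run_eq, QuantumCircuits.run_eq, h₁, h₂, runList_append, runList_append,
    LinearMap.comp_apply, runList_append O (c.publicKeyGates κ), LinearMap.comp_apply,
    LinearMap.comp_apply (runList O (_ ++ _)),
    runList_publicKeyGates, runList_append O (List.flatMap _ _) (moveGates _)]
  simp only [map_mix, guessProb_mix]
  refine average_congr fun r => ?_
  rw [LinearMap.comp_apply (runList O (moveGates _)),
    run_simulate hcorrect O (ready_baseCfg _ _ _ _), ← LinearMap.comp_apply _ (embed _),
    ← LinearMap.comp_apply (quantumChallenge b _), quantumChallenge_moveGates, mix_apply]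
  simp only [map_mix, guessProb_mix]
  refine average_congr fun z₂ => ?_
  rw [← LinearMap.comp_apply _ (cfgMap _ _),
    runList_completeGates O b _ fun m => S.enc κ k m z₂, mix_apply]
  simp only [map_mix, guessProb_mix]
  refine average_congr fun z₃ => ?_
  rw [LinearMap.comp_apply,
    guessProb_simulate hcorrect O (ready_baseCfg _ _ _ _), guessValue]
  congr 1
  exact Bool.xor_false v

end SchemeCircuits

open SchemeCircuits in
/-- The security reduction for all adversaries against the hybrid scheme. -/
theorem exists_reductions (S : SKE) (P : PKE S.keyLen) (hS : S.Efficient)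
    (hcorrect : S.PerfectlyCorrect) (hP : P.Efficient) (E : Adversary) :
    ∃ B C : Adversary, ∀ κ : ℕ,
      (hybrid S P).qINDqCPAAdv E κ ≤ 2 * P.INDqCPAAdv B κ + S.qINDAdv C κ := by
  obtain ⟨c⟩ := SchemeCircuits.nonempty hS hP
  obtain ⟨B, hB₁, hB₂⟩ := c.exists_reduction_PKE hS hP E
  obtain ⟨C, hC₁, hC₂⟩ := c.exists_reduction_SKE hS hP E
  refine ⟨B, C, fun κ => ?_⟩
  -- the winning probability of `E` for the public key `pk` if the second part of the challenge
  -- ciphertext encrypts the message `0` (for `b = true`) or the symmetric key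
  let win (pk : Bits (P.pkLen κ)) (b : Bool) : ℝ :=
    average fun z₁ => average fun z₃ => average fun β : Bits 1 => average fun z₂ =>
      guessValue P E κ pk (β 0) (fun m => S.enc κ (S.kgen κ z₁) m z₂)
        (P.enc κ pk (if b then fun _ => false else S.kgen κ z₁) z₃) (β 0)
  have hwin (pk : Bits (P.pkLen κ)) (b : Bool) : win pk b = (∑ β : Bool,
      average fun z₁ => average fun z₂ => average fun z₃ =>
        guessValue P E κ pk β (fun m => S.enc κ (S.kgen κ z₁) m z₂)
          (P.enc κ pk (if b then fun _ => false else S.kgen κ z₁) z₃) β) / 2 := by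
    simp only [win]
    rw [← average_sum_div_two]
    refine average_congr fun z₁ => ?_
    rw [← average_one_bit fun β => average fun z₂ => average fun z₃ =>
      guessValue P E κ pk β (fun m => S.enc κ (S.kgen κ z₁) m z₂)
        (P.enc κ pk (if b then fun _ => false else S.kgen κ z₁) z₃) β, average_comm]
    exact average_congr fun β => average_comm _
  have hE : (hybrid S P).qINDqCPAAdv E κ =
      |(average fun r => win (P.kgen κ r).1 false) - 1 / 2| := by
    rw [PKE.qINDqCPAAdv]
    congr 2
    refine average_congr fun r => ?_
    rw [hwin]
    simp only [Adversary.winProb]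
    congr 1
    exact Finset.sum_congr rfl fun β _ => guessProb_hybrid E (P.kgen κ r).1 β β
  have hB : 2 * P.INDqCPAAdv B κ =
      |(average fun r => win (P.kgen κ r).1 false) - average fun r => win (P.kgen κ r).1 true| := by
    have hO : trace ∘ₗ LinearMap.id = trace := LinearMap.comp_id _
    have hgp (pk : Bits (P.pkLen κ)) (b : Bool) : guessProb false (B.stage₂.run κ LinearMap.id
        (classicalChallenge b (P.enc κ pk) (B.stage₁.run κ LinearMap.id (initialState pk)))) =
        win pk b := by
      rw [guessProb_PKE hcorrect hB₁ hB₂]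
      simp only [Bool.false_xor, win]
    have hsum (pk : Bits (P.pkLen κ)) := guessProb_add_PKE hcorrect hB₁ hO pk true
    have : P.INDqCPAAdv B κ = |(average fun r => (1 + (win (P.kgen κ r).1 false -
        win (P.kgen κ r).1 true)) / 2) - 1 / 2| := by
      rw [PKE.INDqCPAAdv]
      congr 2
      refine average_congr fun r => ?_
      have := hsum (P.kgen κ r).1
      rw [hgp] at this
      -- `B` wins for `b = true` if the simulated adversary loses
      rw [Adversary.winProb, Fintype.sum_bool, hgp]
      linarith
    rw [this, average_div_two_add, average_sub, add_div, add_sub_cancel_left, abs_div,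
      abs_of_pos (zero_lt_two' ℝ)]
    ring
  have hC : S.qINDAdv C κ = |(average fun r => win (P.kgen κ r).1 true) - 1 / 2| := by
    rw [SKE.qINDAdv]
    congr 2
    simp only [Adversary.winProb, guessProb_SKE hcorrect hC₁ hC₂]
    rw [average_sum_div_two]
    simp only [hwin]
    rw [average_sum_div_two]
    congr 1
    refine Finset.sum_congr rfl fun β _ => ?_
    rw [average_comm]
    rfl
  rw [hE, hB, hC]
  exact abs_sub_le _ _ _

theorem mainTheorem1 (S : SKE) (P : PKE S.keyLen) (hS : S.Efficient)
    (hcorrect : S.PerfectlyCorrect) (hP : P.Efficient) :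
    (∀ E : Adversary, ∃ B C : Adversary, ∀ κ : ℕ,
        (hybrid S P).qINDqCPAAdv E κ ≤ 2 * P.INDqCPAAdv B κ + S.qINDAdv C κ) ∧
      (P.INDqCPASecure → S.QINDSecure → (hybrid S P).QINDqCPASecure) := by
  refine ⟨exists_reductions S P hS hcorrect hP, fun hPsec hSsec E => ?_⟩
  obtain ⟨B, C, h⟩ := exists_reductions S P hS hcorrect hP E
  refine Asymptotics.SuperpolynomialDecay.trans_abs_le
    (((hPsec B).const_mul 2).add (hSsec C)) fun κ => ?_
  refine (abs_of_nonneg (abs_nonneg _)).trans_le ((h κ).trans ?_)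
  exact le_abs_self _
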